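/- **Setting.** Let $d\ge 1$ and let $\Delta=\{x\in\mathfrak t^*:\langle x,v_j\rangle+a_j\ge 0,\ j=1,\dots,n\}$, $\mathfrak t=\mathbb R^d$, $v_j\in\mathbb Z^d$, $a_j>0$, be a compact smooth (Delzant) polytope with exactly $n$ facets. Let $\mathfrak k=\ker(\mathbb R^n\to\mathfrak t,\ \epsilon_j\mapsto v_j)$, $\mathfrak k_{\mathbb Z}=\mathfrak k\cap\mathbb Z^n$, and $p\in\mathfrak k^*$, $p(\lambda)=\sum_j a_j\lambda_j$. Assume $p(\mathfrak k_{\mathbb Z})\subset\mathbb Z$ (the toric manifold of $\Delta$ is rational). The tori $\mathbb K=\exp(\mathfrak k)$ and $\mathbb K_0=\exp(\mathfrak k_0)$, $\mathfrak k_0=\ker p$, act on $\mathbb C^n$ by $\exp(\lambda)z=(e^{2\pi i\lambda_k}z_k)_k$; let $P_{\mathbb K}:\mathbb C^n\to\mathfrak k^*$, $\langle\lambda,P_{\mathbb K}\rangle(z)=\pi\sum_k\lambda_k|z_k|^2$. Let $V=P_{\mathbb K}^{-1}(p)/\mathbb K_0$ with projection $\rho$ and contact form $\alpha$, $\rho^*\alpha=\alpha_{\rm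 std}=\frac12\sum(x_kdy_k-y_kdx_k)$, and let $\{\phi_\alpha^s\}$ be its Reeb flow. A point $q\in V$ is an $\alpha$-translated point with shift $s$ of a map $f:V\to V$ if $f(q)=\phi_\alpha^s(q)$ and $(f^*\alpha)_q=\alpha_q$. Let $h:V\times[0,1]\to\mathbb R$ be a smooth contact Hamiltonian (conventions $\alpha(X_h)=h$, $d\alpha(X_h,\cdot)=-dh+dh(R_\alpha)\alpha$) with contact isotopy $\phi_h^t$, and $\phi_h=\phi_h^1$. Fix $b\in\mathfrak k$ with all $b_k>0$, let $S_p=\{\pi\sum_k b_k|z_k|^2=p(b)\}$ and let $pr:\mathbb C^n\setminus 0\to S_p$ be the radial projection. Let $\widetilde H$ be a Hamiltonian lift of $h$: $\widetilde H_t(z)=\frac{|z|^2}{|pr(z)|^2}\,\overline h_t(pr(z))$ for $z\neq 0$, $\widetilde H_t(0)=0$, where $\overline h:S_p\times[0,1]\to\mathbb R$ is smooth, $\mathbb K_0$-invariant and equal to $\rho^*h$ on $P_{\mathbb K}^{-1}(p)$. Let $\Phi^t$ be the Hamiltonian isotopy of $\widetilde H$ (convention $\omega_{\rm std}(X_H,\cdot)=-dH$,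 $\Phi^t(0)=0$). Let $N_1\ge1$ and $\Phi_j=\Phi^{j/2N_1}\circ(\Phi^{(j-1)/2N_1})^{-1}$, $1\le j\le 2N_1$, where $N_1$ is large enough for each $\Phi_j$ to have a $C^1$ generating function $\mathcal H_j$, $\mathcal H_j(0)=0$, i.e. the map $\Psi(z,w)=(\frac{z+w}2,i(z-w))$ takes the graph of $\Phi_j$ to the graph of $d\mathcal H_j$. For an integer $N_2$ put $N=N_1+N_2$ and, for $x\in(\mathbb C^n)^{2N}$ and $\lambda\in\mathfrak k$ with $|\lambda_k|<N_2$ for all $k$, $$\mathcal F_N(x,\lambda)=\mathcal Q(x)-\sum_{j\le 2N_1}\mathcal H_j(x_j)-\sum_{2N_1<j\le 2N}\ \sum_{k=1}^n\tan\!\Big(\frac{\pi\lambda_k}{2N_2}\Big)|x_j^k|^2 ,$$ where $\mathcal Q$ is the quadratic form whose gradient at $x$ is $(i(z_j-z_{j+1}))_j$, with $z=z(x)$ the unique sequence such that $x_j=\frac{z_j+z_{j+1}}2$ for $1\le j\le 2N$ and $z_{2N+1}=-z_1$. Let $\Lambda_N$ be any subset of $\{\lambda\in\mathfrak k:|\lambda_k|<N_2\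 \forall k\}$ (for instance a closed cube), $S_N$ the unit sphere of $\mathbb C^{2nN}$, and $F_N=\mathcal F_N|_{S_N\times\Lambda_N}$; differentials in $\lambda$ are those of $\mathcal F_N$ on the open window $|\lambda_k|<N_2$ of $\mathfrak k$. Let $\hat p_N:F_N^{-1}(0)\to\mathbb R$, $\hat p_N(x,\lambda)=p(\lambda)$. Finally let $g:V\to V$ be the $\alpha$-preserving contactomorphism induced by $-\mathrm{Id}_{\mathbb C^n}$. **Proposition.** 1. $0$ is a regular value of $F_N$ on $S_N\times\Lambda_N$. 2. The set of critical points of $\hat p_N$ is $\mathbb K_0$-invariant, and its $\mathbb K_0$-orbits correspond to $\alpha$-translated points of $g\circ\phi_h$, in the following sense. * (a) If $(x,\lambda)$ is a critical point of $\hat p_N$, the ray through $z_1(x)$ meets $P_{\mathbb K}^{-1}(p)$ over exactly one point $q(x)\in V$, and $q(x)$ is an $\alpha$-translated point of $g\circ\phi_h$ with shift $-p(\lambda)$. * (b) Two critical points $(x,\lambda)$, $(x',\lambda)$ with the same $\lambda$ satisfy $q(x)=q(x')$ if and only if they lie in the same $\mathbb K_0$-orbit. * (c) For every $\alpha$-translated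 point $q$ of $g\circ\phi_h$ with shift $s$ there is $\lambda\in\mathfrak k$ with $p(\lambda)=-s$ such that, for all $N_2$, all $\Lambda_N$ as above and all $\lambda'\in\Lambda_N$: there is a critical point $(x,\lambda')$ of $\hat p_N$ with $q(x)=q$ if and only if $\lambda'-\lambda\in\mathfrak k_{\mathbb Z}$. -/

import Mathlib

open scoped ContDiff

noncomputable section

/-- `ℂⁿ`. The Euclidean norm, `ω_std` and `α_std` are written out below. -/
abbrev Cn (n : ℕ) : Type := Fin n → ℂ

namespace Cn

/-- The real Euclidean scalar product `⟨z, w⟩ = ∑ (Re z_k Re w_k + Im z_k Im w_k)`. -/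
def dot {n : ℕ} (z w : Cn n) : ℝ := ∑ k, ((z k).re * (w k).re + (z k).im * (w k).im)

/-- `ω_std = ∑ dx_k ∧ dy_k`. -/
def omega {n : ℕ} (z w : Cn n) : ℝ := ∑ k, ((z k).re * (w k).im - (z k).im * (w k).re)

/-- `α_std = (1/2) ∑ (x_k dy_k - y_k dx_k)`, at the point `z`, on the vector `w`;
its exterior derivative is `ω_std`. -/
def alpha {n : ℕ} (z w : Cn n) : ℝ :=
  (1 / 2) * ∑ k, ((z k).re * (w k).im - (z k).im * (w k).re)

/-- `exp(l)` for `l ∈ ℝⁿ = Lie(𝕋ⁿ)`, acting on `ℂⁿ` by rotation of each coordinate. -/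
def rot {n : ℕ} (l : Fin n → ℝ) (z : Cn n) : Cn n :=
  fun k => Complex.exp (2 * Real.pi * Complex.I * (l k : ℂ)) * z k

/-- The momentum map of `𝕋ⁿ`: `⟨l, P⟩(z) = π ∑ l_k |z_k|²`. -/
def moment {n : ℕ} (l : Fin n → ℝ) (z : Cn n) : ℝ := Real.pi * ∑ k, l k * ‖z k‖ ^ 2

theorem rot_zero {n : ℕ} (z : Cn n) : rot 0 z = z := by
  funext k; simp [rot]

theorem rot_add {n : ℕ} (l m : Fin n → ℝ) (z : Cn n) : rot (l + m) z = rot l (rot m z) := by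
  funext k
  simp only [rot, Pi.add_apply, ← mul_assoc, ← Complex.exp_add]
  congr 2
  push_cast
  ring

end Cn

/-- A compact smooth (Delzant) polytope
`Δ = {x ∈ 𝔱* | ⟨x, v_j⟩ + a_j ≥ 0, j = 1, …, n}` with exactly `n` facets, in dimension `d ≥ 1`,
where `𝔱 = ℝᵈ`, `𝔱_ℤ = ℤᵈ`, and `a_j > 0`.
(Each `v_j` is primitive, being a member of a basis of the lattice.) -/
structure DelzantPolytope (d n : ℕ) where
  /-- the inward conormals -/
  v : Fin n → Fin d → ℤ
  a : Fin n → ℝ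
  dim_pos : 0 < d
  a_pos : ∀ j, 0 < a j
  compact : IsCompact {x : Fin d → ℝ | ∀ j, 0 ≤ ∑ i, x i * (v j i : ℝ) + a j}
  /-- Each inequality defines a facet, and different inequalities define different facets:
  some point of `Δ` lies on the `j`-th hyperplane and on no other one. -/
  facet : ∀ j, ∃ x : Fin d → ℝ, (∀ i, 0 ≤ ∑ r, x r * (v i r : ℝ) + a i) ∧
    ∀ i, (∑ r, x r * (v i r : ℝ) + a i = 0 ↔ i = j)
  /-- The conormals of the facets through any point of `Δ` (equivalently, of the facets that
  contain a given face) extend to a basis of the lattice. -/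
  smooth : ∀ x : Fin d → ℝ, (∀ j, 0 ≤ ∑ i, x i * (v j i : ℝ) + a j) →
    ∃ (B : Module.Basis (Fin d) ℤ (Fin d → ℤ))
      (e : {j // ∑ i, x i * (v j i : ℝ) + a j = 0} → Fin d),
      Function.Injective e ∧ ∀ j, B (e j) = v j.1

namespace DelzantPolytope

variable {d n : ℕ} (D : DelzantPolytope d n)

/-- `𝔨 = ker (β_Δ : ℝⁿ → 𝔱, ε_j ↦ v_j)`, the Lie algebra of the torus `𝕂`. -/
def lieK : Submodule ℝ (Fin n → ℝ) where
  carrier := {l | ∀ i, ∑ j, l j * (D.v j i : ℝ) = 0}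
  add_mem' := by
    intro l m hl hm i
    have h1 := hl i
    have h2 := hm i
    simp only [Pi.add_apply, add_mul, Finset.sum_add_distrib, h1, h2, add_zero]
  zero_mem' := by intro i; simp
  smul_mem' := by
    intro c l hl i
    have h1 := hl i
    simp only [Pi.smul_apply, smul_eq_mul, mul_assoc, ← Finset.mul_sum, h1, mul_zero]

/-- `p = ι^*(a)`, i.e. `p(l) = ∑ a_j l_j`. It is used on `𝔨` only. -/
def p : (Fin n → ℝ) →ₗ[ℝ] ℝ where
  toFun l := ∑ j, D.a j * l j
  map_add' := by intro l m; simp [mul_add, Finset.sum_add_distrib]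
  map_smul' := by
    intro c l
    simp only [Pi.smul_apply, smul_eq_mul, RingHom.id_apply, Finset.mul_sum]
    exact Finset.sum_congr rfl fun j _ => by ring

/-- The lattice `𝔨_ℤ = ker (exp : 𝔨 → 𝕂) = 𝔨 ∩ ℤⁿ`. -/
def latticeK : Set (Fin n → ℝ) := {l | l ∈ D.lieK ∧ ∀ j, ∃ m : ℤ, l j = m}

/-- Rationality of the toric manifold: `p ∈ 𝔨_ℤ^*`. -/
def IsRational : Prop := ∀ l ∈ D.latticeK, ∃ m : ℤ, D.p l = m

/-- `𝔨₀ = ker (p : 𝔨 → ℝ)`, the Lie algebra of `𝕂₀ = exp(𝔨₀)`. -/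
def lieK₀ : Submodule ℝ (Fin n → ℝ) := D.lieK ⊓ LinearMap.ker D.p

/-- The level `P_𝕂⁻¹(p) ⊂ ℂⁿ` of the momentum map of `𝕂`. -/
def level : Set (Cn n) := {z | ∀ l ∈ D.lieK, Cn.moment l z = D.p l}

/-- The tangent space of `P_𝕂⁻¹(p)` at `z`: the kernel of `d_z P_𝕂`, where
`d_z⟨l, P⟩(w) = 2π ∑ l_k ⟨z_k, w_k⟩`. -/
def IsTangent (z w : Cn n) : Prop :=
  ∀ l ∈ D.lieK, 2 * Real.pi * ∑ k, l k * ((z k).re * (w k).re + (z k).im * (w k).im) = 0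

/-- Two points of `P_𝕂⁻¹(p)` are equivalent if they lie in the same `𝕂₀`-orbit. -/
def orbitSetoid : Setoid D.level where
  r z w := ∃ l ∈ D.lieK₀, (w : Cn n) = Cn.rot l z
  iseqv :=
    { refl := fun z => ⟨0, D.lieK₀.zero_mem, (Cn.rot_zero _).symm⟩
      symm := by
        rintro z w ⟨l, hl, h⟩
        refine ⟨-l, D.lieK₀.neg_mem hl, ?_⟩
        rw [h, ← Cn.rot_add, neg_add_cancel, Cn.rot_zero]
      trans := by
        rintro z w u ⟨l, hl, h⟩ ⟨m, hm, h'⟩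
        exact ⟨m + l, D.lieK₀.add_mem hm hl, by rw [h', h, Cn.rot_add]⟩ }

/-- The prequantization space `V = P_𝕂⁻¹(p) / 𝕂₀`. Its tangent vectors and its contact form `α`
are handled through the projection `ρ`: a tangent vector of `V` at `ρ(z)` is the image of a vector
tangent to `P_𝕂⁻¹(p)` at `z`, the smooth curves of `V` are the images of the smooth curves of
`P_𝕂⁻¹(p)`, and `α` is given by `ρ^*α = α_std`, `ρ^*dα = ω_std`. -/
def V : Type := Quotient D.orbitSetoid

/-- The projection `ρ : P_𝕂⁻¹(p) → V`. -/
def proj (z : D.level) : D.V := Quotient.mk D.orbitSetoid z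

/-- `R` projects to the Reeb vector field of `(V, α)` at `ρ(z)`:
`α(R) = 1` and `dα(R, ·) = 0`. -/
def IsReebVector (z R : Cn n) : Prop :=
  D.IsTangent z R ∧ Cn.alpha z R = 1 ∧ ∀ w, D.IsTangent z w → Cn.omega R w = 0

/-- `q' = φ_α^s(q)`: an integral curve of the Reeb vector field goes from `q` to `q'` in
(signed) time `s`. -/
def ReebFlowsTo (q : D.V) (s : ℝ) (q' : D.V) : Prop :=
  ∃ c : ℝ → D.level, ContDiff ℝ ∞ (fun t => (c t : Cn n)) ∧ D.proj (c 0) = q ∧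
    D.proj (c s) = q' ∧ ∀ t, D.IsReebVector (c t) (deriv (fun u => (c u : Cn n)) t)

/-- `(f^*α)_q = α_q` for `f : V → V`: a smooth curve through `q` and its image under `f`
have velocities (computed on lifts to `P_𝕂⁻¹(p)`) of equal `α`-value. -/
def PreservesFormAt (f : D.V → D.V) (q : D.V) : Prop :=
  ∀ c : ℝ → D.level, ContDiff ℝ ∞ (fun u => (c u : Cn n)) → D.proj (c 0) = q →
    ∃ c' : ℝ → D.level, ContDiff ℝ ∞ (fun u => (c' u : Cn n)) ∧
      (∀ u, D.proj (c' u) = f (D.proj (c u))) ∧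
      Cn.alpha (c' 0) (deriv (fun u => (c' u : Cn n)) 0)
        = Cn.alpha (c 0) (deriv (fun u => (c u : Cn n)) 0)

/-- `q` is an `α`-translated point of `f` with shift `s`: `f(q) = φ_α^s(q)` and
`(f^*α)_q = α_q`. -/
def IsTranslatedPoint (f : D.V → D.V) (q : D.V) (s : ℝ) : Prop :=
  D.ReebFlowsTo q s (f q) ∧ D.PreservesFormAt f q

theorem neg_mem_level {z : Cn n} (hz : z ∈ D.level) : -z ∈ D.level := by
  intro l hl
  have h := hz l hl
  simpa [Cn.moment] using h

/-- The `α`-preserving contactomorphism of `V` induced by `-Id` of `ℂⁿ`. -/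
def negV : D.V → D.V :=
  Quotient.map (sa := D.orbitSetoid) (sb := D.orbitSetoid)
    (fun z : D.level => (⟨-z.1, D.neg_mem_level z.2⟩ : D.level)) (by
      rintro z w ⟨l, hl, h⟩
      refine ⟨l, hl, ?_⟩
      funext k
      simp [h, Cn.rot])

open Classical in
/-- `ρ^*f` as a function on `ℂⁿ`, with an irrelevant value off `P_𝕂⁻¹(p)`. -/
def pull (f : D.V → ℝ) (z : Cn n) : ℝ := if hz : z ∈ D.level then f (D.proj ⟨z, hz⟩) else 0

/-- `X` projects to the contact vector field of the function `f : V → ℝ` at `ρ(z)`: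
`α(X) = f` and `dα(X, ·) = - df + df(R_α) α`. -/
def IsContactVector (f : D.V → ℝ) (z : D.level) (X : Cn n) : Prop :=
  D.IsTangent z X ∧ Cn.alpha z X = f (D.proj z) ∧
    ∃ df : Cn n →L[ℝ] ℝ, HasFDerivWithinAt (D.pull f) df D.level z ∧
      ∃ R, D.IsReebVector z R ∧
        ∀ w, D.IsTangent z w → Cn.omega X w = - df w + df R * Cn.alpha z w

/-- `φ` is the contact isotopy `{φ_h^t}`, `t ∈ [0,1]`, generated by the contact Hamiltonian
`h`: every `t ↦ φ t q` is the integral curve of the contact vector field of `h` that starts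
at `q`. -/
def IsContactIsotopy (h : ℝ → D.V → ℝ) (φ : ℝ → D.V → D.V) : Prop :=
  ∀ q, φ 0 q = q ∧ ∃ c : ℝ → D.level,
    ContDiffOn ℝ ∞ (fun t => (c t : Cn n)) (Set.Icc 0 1) ∧
    ∀ t ∈ Set.Icc (0 : ℝ) 1, D.proj (c t) = φ t q ∧
      D.IsContactVector (h t) (c t) (derivWithin (fun u => (c u : Cn n)) (Set.Icc 0 1) t)

/-- The contact sphere `S_p = {z | ∑ b_j π |z_j|² = p(b)}`. -/
def sphere (b : Fin n → ℝ) : Set (Cn n) := {z | Cn.moment b z = D.p b}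

/-- The radial projection `pr : ℂⁿ ∖ {0} → S_p`. -/
def radialProj (b : Fin n → ℝ) (z : Cn n) : Cn n :=
  Real.sqrt (D.p b / Cn.moment b z) • z

/-- `H` is a Hamiltonian lift of the contact Hamiltonian `h`: for some smooth
`𝕂₀`-invariant `hbar : S_p × [0,1] → ℝ` that restricts to `ρ^*h` on `P_𝕂⁻¹(p)`,
`H_t(z) = (|z|² / |pr(z)|²) hbar_t(pr(z))` for `z ≠ 0`, and `H_t(0) = 0`.
A function on `S_p` is smooth when its composition with `pr` is; a function on `V` is smooth
exactly when such an `hbar` exists. -/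
def IsHamiltonianLift (b : Fin n → ℝ) (h : ℝ → D.V → ℝ) (H : ℝ → Cn n → ℝ) : Prop :=
  ∃ hbar : ℝ → Cn n → ℝ,
    ContDiffOn ℝ ∞ (fun y : ℝ × Cn n => hbar y.1 (D.radialProj b y.2))
      (Set.Icc (0 : ℝ) 1 ×ˢ {0}ᶜ) ∧
    (∀ t ∈ Set.Icc (0 : ℝ) 1, ∀ z ∈ D.sphere b, ∀ l ∈ D.lieK₀,
      hbar t (Cn.rot l z) = hbar t z) ∧
    (∀ t ∈ Set.Icc (0 : ℝ) 1, ∀ z : D.level, hbar t z = h t (D.proj z)) ∧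
    ∀ t ∈ Set.Icc (0 : ℝ) 1, H t 0 = 0 ∧ ∀ z, z ≠ 0 →
      H t z = Cn.dot z z / Cn.dot (D.radialProj b z) (D.radialProj b z)
        * hbar t (D.radialProj b z)

end DelzantPolytope

/-- `Φ` is the Hamiltonian isotopy `{Φ_H^t}`, `t ∈ [0,1]`, of `ℂⁿ ∖ {0}`, extended by
`Φ^t(0) = 0`, where the Hamiltonian vector field is given by `ω_std(X_H, ·) = - dH`. -/
def IsHamiltonianIsotopy {n : ℕ} (H : ℝ → Cn n → ℝ) (Φ : ℝ → Equiv.Perm (Cn n)) : Prop :=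
  (∀ z, Φ 0 z = z) ∧
  (∀ t ∈ Set.Icc (0 : ℝ) 1, Φ t 0 = 0) ∧
  ContDiffOn ℝ ∞ (fun y : ℝ × Cn n => Φ y.1 y.2) (Set.Icc (0 : ℝ) 1 ×ˢ {0}ᶜ) ∧
  ∀ z, z ≠ 0 → ∀ t ∈ Set.Icc (0 : ℝ) 1, ∀ w,
    Cn.omega (derivWithin (fun u => Φ u z) (Set.Icc 0 1) t) w
      = - fderiv ℝ (H t) (Φ t z) w

/-- The small pieces of the decomposition `Φ^1 = Φ_{2N₁} ∘ ⋯ ∘ Φ_1`; the index `j` counts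
from `0`, so that this is `Φ_{j+1} = Φ^{(j+1)/2N₁} ∘ (Φ^{j/2N₁})⁻¹`. -/
def pieceOf {n : ℕ} (Φ : ℝ → Equiv.Perm (Cn n)) (N₁ j : ℕ) : Cn n → Cn n :=
  fun z => Φ (((j : ℝ) + 1) / (2 * N₁)) ((Φ ((j : ℝ) / (2 * N₁))).symm z)

/-- `G` is a generating function of the map `f` of `ℂⁿ`: the linear map
`Ψ(z, w) = ((z + w)/2, i(z - w))` sends the graph of `f` onto the graph of `dG`,
`T^*ℂⁿ` being identified with `ℂⁿ × ℂⁿ` by the Euclidean scalar product. -/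
def IsGeneratingFunction {n : ℕ} (f : Cn n → Cn n) (G : Cn n → ℝ) : Prop :=
  ContDiff ℝ 1 G ∧ ∀ x y : Cn n,
    (∃ z, (2⁻¹ : ℂ) • (z + f z) = x ∧ Complex.I • (z - f z) = y) ↔
      ∀ u, fderiv ℝ G x u = Cn.dot y u

/-- The twisted cyclic shift `(z_1, …, z_M) ↦ (z_2, …, z_M, -z_1)`. -/
def twistedShift {n M : ℕ} (z : Fin M → Cn n) : Fin M → Cn n :=
  fun j => if h : (j : ℕ) + 1 < M then z ⟨j + 1, h⟩ else - z ⟨0, j.pos⟩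

/-- For `M` even, the sequence `z` with `x_j = (z_j + z_{j+1})/2` for all `j`, where
`z_{M+1} = -z_1`. -/
def discretePath {n M : ℕ} (x : Fin M → Cn n) : Fin M → Cn n :=
  fun j => ∑ k, (if j ≤ k then (1 : ℝ) else -1) • ((-1 : ℝ) ^ ((j : ℕ) + (k : ℕ)) • x k)

theorem discretePath_add_twistedShift {n M : ℕ} (hM : Even M) (x : Fin M → Cn n) (j : Fin M) :
    discretePath x j + twistedShift (discretePath x) j = (2 : ℝ) • x j := by
  have key : ∀ j' : Fin M, ∀ e : ℝ,
      (∀ k : Fin M, (if j ≤ k then (1 : ℝ) else -1) * (-1 : ℝ) ^ ((j : ℕ) + (k : ℕ)) +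
        e * ((if j' ≤ k then (1 : ℝ) else -1) * (-1 : ℝ) ^ ((j' : ℕ) + (k : ℕ)))
          = if k = j then 2 else 0) →
      discretePath x j + e • discretePath x j' = (2 : ℝ) • x j := by
    intro j' e h
    simp only [discretePath, Finset.smul_sum, smul_smul, ← Finset.sum_add_distrib, ← add_smul, h]
    simp
  unfold twistedShift
  split_ifs with h
  · have := key ⟨j + 1, h⟩ 1 (by
      intro k
      simp only [Fin.le_def, Fin.ext_iff]
      rcases lt_trichotomy (j : ℕ) k with hk | hk | hk
      · rw [if_pos (by omega), if_pos (by omega), if_neg (by omega)]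
        ring
      · rw [if_pos (by omega), if_neg (by omega), if_pos (by omega), ← hk]
        have : (-1 : ℝ) ^ ((j : ℕ) + (j : ℕ)) = 1 := Even.neg_one_pow ⟨_, rfl⟩
        rw [show (j : ℕ) + 1 + (j : ℕ) = (j + j) + 1 by ring, pow_succ, this]
        norm_num
      · rw [if_neg (by omega), if_neg (by omega), if_neg (by omega)]
        ring)
    simpa using this
  · have hj : (j : ℕ) + 1 = M := by omega
    have hodd : (-1 : ℝ) ^ (j : ℕ) = -1 := by
      have : (-1 : ℝ) ^ ((j : ℕ) + 1) = 1 := by rw [hj]; exact hM.neg_one_pow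
      rw [pow_succ] at this
      linarith
    have := key ⟨0, j.pos⟩ (-1) (by
      intro k
      have hk := k.2
      simp only [Fin.le_def, Fin.ext_iff, Nat.zero_le, if_true, zero_add, pow_add, hodd]
      rcases lt_or_eq_of_le (show (k : ℕ) ≤ j by omega) with hk | hk
      · rw [if_neg (by omega), if_neg (by omega)]
        ring
      · rw [if_pos (by omega), if_pos hk, hk, hodd]
        norm_num)
    simpa using this

/-- The quadratic form `𝒬` that generates the graph of the twisted shift: its gradient at `x`
has the components `i(z_j - z_{j+1})`, where `z` is the sequence `discretePath x`. -/
def shiftForm {n M : ℕ} (x : Fin M → Cn n) : ℝ :=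
  (1 / 2) * ∑ j, Cn.dot (Complex.I • (discretePath x j - twistedShift (discretePath x) j)) (x j)

/-- `𝒯_l(x) = ∑ tan(π l_k / 2N₂) |x_k|²`, the generating function of `exp(l / 2N₂)`. -/
def rotGen {n : ℕ} (N₂ : ℕ) (l : Fin n → ℝ) (x : Cn n) : ℝ :=
  ∑ k, Real.tan (Real.pi * l k / (2 * N₂)) * ‖x k‖ ^ 2

/-- The homogeneous generating family `ℱ_N(x, l) = 𝒬(x) - ∑ 𝒢_j(x_j) - ∑ 𝒯_l(x_j)`,
`N = N₁ + N₂`, where `G j` (`j = 0, …, 2N₁ - 1`) are the generating functions of the pieces. -/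
def genFamily {n : ℕ} (G : ℕ → Cn n → ℝ) (N₁ N₂ : ℕ)
    (y : (Fin (2 * (N₁ + N₂)) → Cn n) × (Fin n → ℝ)) : ℝ :=
  shiftForm y.1 -
    ∑ j : Fin (2 * (N₁ + N₂)), if (j : ℕ) < 2 * N₁ then G j (y.1 j) else rotGen N₂ y.2 (y.1 j)

/-- The unit sphere of `(ℂⁿ)^M` (Euclidean norm). -/
def unitSphere (n M : ℕ) : Set (Fin M → Cn n) := {x | ∑ j, Cn.dot (x j) (x j) = 1}

/-- The first entry `z_1 = ∑ (-1)^k x_{k+1}` of `discretePath x`. -/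
def initialPoint {n M : ℕ} (x : Fin M → Cn n) : Cn n :=
  ∑ k : Fin M, (-1 : ℝ) ^ (k : ℕ) • x k

theorem discretePath_zero {n M : ℕ} (x : Fin M → Cn n) (h : 0 < M) :
    discretePath x ⟨0, h⟩ = initialPoint x := by
  simp [discretePath, initialPoint, Fin.le_def]

namespace DelzantPolytope

variable {d n : ℕ} (D : DelzantPolytope d n)

/-- The parameters for which `ℱ_N` is defined: `l ∈ 𝔨` with `ι(l) ∈ ]-N₂, N₂[ⁿ`. -/
def window (N₂ : ℕ) : Set (Fin n → ℝ) := {l | l ∈ D.lieK ∧ ∀ k, |l k| < N₂}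

/-- The tangent space of `S_N × 𝔨` at `(x, l)`. -/
def IsTangentDir {M : ℕ} (x : Fin M → Cn n) (y : (Fin M → Cn n) × (Fin n → ℝ)) : Prop :=
  ∑ j, Cn.dot (x j) (y.1 j) = 0 ∧ y.2 ∈ D.lieK

/-- The zero set `F_N⁻¹(0) ⊂ S_N × Λ` of the generating family `F_N = ℱ_N|_{S_N × Λ}`. -/
def zeroSet (G : ℕ → Cn n → ℝ) (N₁ N₂ : ℕ) (Λ : Set (Fin n → ℝ)) :
    Set ((Fin (2 * (N₁ + N₂)) → Cn n) × (Fin n → ℝ)) :=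
  {y | y.1 ∈ unitSphere n (2 * (N₁ + N₂)) ∧ y.2 ∈ Λ ∧ genFamily G N₁ N₂ y = 0}

/-- `0` is a regular value of `F_N`: at every point of `F_N⁻¹(0)` the differential does not
vanish on the tangent space of `S_N × 𝔨`. -/
def ZeroIsRegularValue (G : ℕ → Cn n → ℝ) (N₁ N₂ : ℕ) (Λ : Set (Fin n → ℝ)) : Prop :=
  ∀ y ∈ zeroSet G N₁ N₂ Λ, DifferentiableAt ℝ (genFamily G N₁ N₂) y ∧
    ∃ u, D.IsTangentDir y.1 u ∧ fderiv ℝ (genFamily G N₁ N₂) y u ≠ 0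

/-- `y = (x, l)` is a critical point of `p̂_N : F_N⁻¹(0) → ℝ, (x, l) ↦ p(l)`: the differential
of `p̂_N` vanishes on the tangent space of `F_N⁻¹(0)`, which is the kernel of `dF_N`. -/
def IsCriticalPoint (G : ℕ → Cn n → ℝ) (N₁ N₂ : ℕ) (Λ : Set (Fin n → ℝ))
    (y : (Fin (2 * (N₁ + N₂)) → Cn n) × (Fin n → ℝ)) : Prop :=
  y ∈ zeroSet G N₁ N₂ Λ ∧ ∀ u, D.IsTangentDir y.1 u →
    fderiv ℝ (genFamily G N₁ N₂) y u = 0 → D.p u.2 = 0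

/-- `x` and `x'` lie in the same orbit of the diagonal action of `𝕂₀` on `(ℂⁿ)^M`. -/
def SameOrbit {M : ℕ} (x x' : Fin M → Cn n) : Prop :=
  ∃ l ∈ D.lieK₀, ∀ j, x' j = Cn.rot l (x j)

/-- `x` corresponds to the point `q ∈ V`: the ray through the first point `z_1` of the discrete
trajectory of `x` meets `P_𝕂⁻¹(p)` in a point over `q`. -/
def CorrespondsTo {M : ℕ} (x : Fin M → Cn n) (q : D.V) : Prop :=
  ∃ r : ℝ, 0 < r ∧ ∃ z : D.level, (z : Cn n) = r • initialPoint x ∧ D.proj z = q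

end DelzantPolytope

end

/-! The map `ℱ_N` generates the closed discrete trajectories of `exp(λ) ∘ Φ¹`. Its `x`-gradient
vanishes exactly when the points `z_j` of the discrete path follow the pieces `Φ_j` and then `2N₂`
equal rotations, and the twisted closing condition reads `exp(λ) Φ¹(z₁) = -z₁`
(`fderiv_genFamily_fst_eq_zero_iff`, `IsTrajectory.rot_flow`). At such a point the `λ`-derivative is
`-P_𝕂(z₁)` (`IsTrajectory.fderiv_snd`).

`ℱ_N` satisfies Euler's relation of degree two in `x`, so on its zero set the radial derivative is
automatically zero and the constraint to the sphere costs nothing. A critical point of `p̂_N`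
satisfies a Lagrange condition, `dF_N` proportional to `p`. Its `x`-part says that `x` is a
trajectory. Its `λ`-part says that `P_𝕂(z₁)` is proportional to `p`, and testing on the positive
vector `b` shows that the factor is positive, so the ray of `z₁` meets the level
(`isCriticalPoint_iff`). Positivity of the moment of `b` also gives regularity of `0`.

It remains to compare solutions of `exp(λ) Φ¹(z) = -z` on the level with translated points. The flow
of a lift covers the contact isotopy up to a positive rescaling
(`IsContactIsotopy.exists_smul_mem_level`), and `Φ¹` preserves `α_std` (`omega_fderiv_flow`), so the
conformal factor of `φ_h` at `q` is the square of that rescaling. It is `1` exactly when `Φ¹(z)` is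
already on the level. The Reeb flow lifts to rotations by elements of `𝔨`, with time measured by `p`
(`reebFlowsTo_rot`, `ReebFlowsTo.exists_rot`). Together these translate one condition into the
other.

Two facts about the Delzant polytope are used throughout. `𝕂` acts freely on the level
(`exists_int_combination`), which makes `λ` unique modulo `𝔨_ℤ` and lets orbit directions be
integrated. And `α` of a velocity on `V` does not depend on the lift of the curve
(`alpha_eq_of_proj_eq`); this is where rationality enters. -/

noncomputable section

/-! ### Linear symplectic algebra and the torus action on `ℂⁿ`. -/

namespace Cn

variable {n : ℕ}

theorem dot_comm (z w : Cn n) : dot z w = dot w z :=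
  Finset.sum_congr rfl fun k _ => by ring

theorem dot_add_left (z z' w : Cn n) : dot (z + z') w = dot z w + dot z' w := by
  simp only [dot, ← Finset.sum_add_distrib]
  exact Finset.sum_congr rfl fun k _ => by simp only [Pi.add_apply, Complex.add_re, Complex.add_im]; ring

theorem dot_add_right (z w w' : Cn n) : dot z (w + w') = dot z w + dot z w' := by
  rw [dot_comm, dot_add_left, dot_comm w, dot_comm w']

theorem dot_smul_left (r : ℝ) (z w : Cn n) : dot (r • z) w = r * dot z w := by
  simp only [dot, Finset.mul_sum]
  exact Finset.sum_congr rfl fun k _ => by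
    simp only [Pi.smul_apply, Complex.smul_re, Complex.smul_im, smul_eq_mul]; ring

theorem dot_smul_right (r : ℝ) (z w : Cn n) : dot z (r • w) = r * dot z w := by
  rw [dot_comm, dot_smul_left, dot_comm w]

theorem dot_neg_left (z w : Cn n) : dot (-z) w = - dot z w := by
  simpa using dot_smul_left (-1) z w

theorem dot_neg_right (z w : Cn n) : dot z (-w) = - dot z w := by
  simpa using dot_smul_right (-1) z w

theorem dot_sub_left (z z' w : Cn n) : dot (z - z') w = dot z w - dot z' w := by
  rw [sub_eq_add_neg, dot_add_left, dot_neg_left, ← sub_eq_add_neg]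

theorem dot_sub_right (z w w' : Cn n) : dot z (w - w') = dot z w - dot z w' := by
  rw [sub_eq_add_neg, dot_add_right, dot_neg_right, ← sub_eq_add_neg]

@[simp] theorem dot_zero_left (w : Cn n) : dot 0 w = 0 := by simp [dot]

@[simp] theorem dot_zero_right (w : Cn n) : dot w 0 = 0 := by simp [dot]

theorem dot_self_eq_sum (z : Cn n) : dot z z = ∑ k, ‖z k‖ ^ 2 :=
  Finset.sum_congr rfl fun k _ => by rw [Complex.sq_norm, Complex.normSq_apply]

theorem dot_self_nonneg (z : Cn n) : 0 ≤ dot z z := by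
  rw [dot_self_eq_sum]; positivity

theorem dot_self_eq_zero {z : Cn n} : dot z z = 0 ↔ z = 0 := by
  constructor
  · intro h
    rw [dot_self_eq_sum, Finset.sum_eq_zero_iff_of_nonneg (fun k _ => by positivity)] at h
    funext k
    simpa using h k (Finset.mem_univ k)
  · rintro rfl; simp

theorem dot_self_pos {z : Cn n} (hz : z ≠ 0) : 0 < dot z z :=
  lt_of_le_of_ne (dot_self_nonneg z) fun h => hz (dot_self_eq_zero.1 h.symm)

theorem eq_of_dot_eq {z w : Cn n} (h : ∀ u, dot z u = dot w u) : z = w := by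
  have := h (z - w)
  rw [← sub_eq_zero, ← dot_sub_left, dot_self_eq_zero] at this
  exact sub_eq_zero.1 this

theorem omega_eq_dot (z w : Cn n) : omega z w = dot (Complex.I • z) w :=
  Finset.sum_congr rfl fun k _ => by simp; ring

theorem omega_I_smul_left (z w : Cn n) : omega (Complex.I • z) w = - dot z w := by
  simp only [omega, dot, ← Finset.sum_neg_distrib]
  exact Finset.sum_congr rfl fun k _ => by simp; ring

theorem omega_swap (z w : Cn n) : omega z w = - omega w z := by
  simp only [omega, ← Finset.sum_neg_distrib]
  exact Finset.sum_congr rfl fun k _ => by ring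

@[simp] theorem omega_self (z : Cn n) : omega z z = 0 := by
  have := omega_swap z z
  linarith

theorem omega_add_left (z z' w : Cn n) : omega (z + z') w = omega z w + omega z' w := by
  simp only [omega_eq_dot, smul_add, dot_add_left]

theorem omega_add_right (z w w' : Cn n) : omega z (w + w') = omega z w + omega z w' := by
  simp only [omega_eq_dot, dot_add_right]

theorem omega_sub_left (z z' w : Cn n) : omega (z - z') w = omega z w - omega z' w := by
  simp only [omega_eq_dot, smul_sub, dot_sub_left]

theorem omega_sub_right (z w w' : Cn n) : omega z (w - w') = omega z w - omega z w' := by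
  simp only [omega_eq_dot, dot_sub_right]

theorem omega_smul_left (r : ℝ) (z w : Cn n) : omega (r • z) w = r * omega z w := by
  rw [omega_eq_dot, smul_comm, dot_smul_left, omega_eq_dot]

theorem omega_smul_right (r : ℝ) (z w : Cn n) : omega z (r • w) = r * omega z w := by
  rw [omega_eq_dot, dot_smul_right, omega_eq_dot]

theorem omega_neg_left (z w : Cn n) : omega (-z) w = - omega z w := by
  simpa using omega_smul_left (-1) z w

theorem omega_neg_right (z w : Cn n) : omega z (-w) = - omega z w := by
  simpa using omega_smul_right (-1) z w

theorem alpha_eq (z w : Cn n) : alpha z w = (1 / 2) * omega z w := rfl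

theorem eq_of_omega_eq {z w : Cn n} (h : ∀ u, omega z u = omega w u) : z = w := by
  have : Complex.I • z = Complex.I • w := eq_of_dot_eq fun u => by
    simpa only [omega_eq_dot] using h u
  exact (smul_right_injective _ Complex.I_ne_zero) this

/-- The infinitesimal action of `l ∈ ℝⁿ` on `ℂⁿ`. -/
def inf (l : Fin n → ℝ) (z : Cn n) : Cn n := fun k => (2 * Real.pi * Complex.I * (l k : ℂ)) * z k

theorem inf_add (l m : Fin n → ℝ) (z : Cn n) : inf (l + m) z = inf l z + inf m z := by
  funext k; simp [inf]; ring

theorem inf_smul (r : ℝ) (l : Fin n → ℝ) (z : Cn n) : inf (r • l) z = r • inf l z := by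
  funext k; simp [inf]; ring

theorem omega_inf_left (l : Fin n → ℝ) (z w : Cn n) :
    omega (inf l z) w
      = - (2 * Real.pi * ∑ k, l k * ((z k).re * (w k).re + (z k).im * (w k).im)) := by
  simp only [omega, inf, Finset.mul_sum, ← Finset.sum_neg_distrib]
  exact Finset.sum_congr rfl fun k _ => by simp; ring

theorem alpha_inf (l : Fin n → ℝ) (z : Cn n) : alpha z (inf l z) = moment l z := by
  rw [alpha_eq, omega_swap, omega_inf_left, moment]
  simp only [Complex.sq_norm, Complex.normSq_apply]
  ring

theorem dot_inf (l : Fin n → ℝ) (z : Cn n) : dot (inf l z) z = 0 :=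
  Finset.sum_eq_zero fun k _ => by simp [inf]; ring

theorem rot_add_vec (l : Fin n → ℝ) (z w : Cn n) : rot l (z + w) = rot l z + rot l w := by
  funext k; simp [rot, mul_add]

theorem rot_smul (l : Fin n → ℝ) (r : ℝ) (z : Cn n) : rot l (r • z) = r • rot l z := by
  funext k; simp [rot]; ring

theorem rot_neg_vec (l : Fin n → ℝ) (z : Cn n) : rot l (-z) = -rot l z := by
  funext k; simp [rot]

theorem rot_zero_vec (l : Fin n → ℝ) : rot l (0 : Cn n) = 0 := by
  funext k; simp [rot]

theorem rot_neg_rot (l : Fin n → ℝ) (z : Cn n) : rot (-l) (rot l z) = z := by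
  rw [← rot_add, neg_add_cancel, rot_zero]

theorem rot_rot_neg (l : Fin n → ℝ) (z : Cn n) : rot l (rot (-l) z) = z := by
  rw [← rot_add, add_neg_cancel, rot_zero]

theorem rot_comm (l m : Fin n → ℝ) (z : Cn n) : rot l (rot m z) = rot m (rot l z) := by
  rw [← rot_add, add_comm, rot_add]

theorem inf_rot (l m : Fin n → ℝ) (z : Cn n) : inf l (rot m z) = rot m (inf l z) := by
  funext k; simp only [rot, inf]; ring

theorem rot_eq_zero {l : Fin n → ℝ} {z : Cn n} : rot l z = 0 ↔ z = 0 := by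
  constructor
  · intro h; rw [← rot_neg_rot l z, h, rot_zero_vec]
  · rintro rfl; exact rot_zero_vec l

theorem norm_exp_rot (x : ℝ) : ‖Complex.exp (2 * Real.pi * Complex.I * (x : ℂ))‖ = 1 := by
  rw [show (2 * Real.pi * Complex.I * (x : ℂ)) = ((2 * Real.pi * x : ℝ) : ℂ) * Complex.I by
    push_cast; ring]
  exact Complex.norm_exp_ofReal_mul_I _

theorem norm_rot_apply (l : Fin n → ℝ) (z : Cn n) (k : Fin n) : ‖rot l z k‖ = ‖z k‖ := by
  rw [rot, norm_mul, norm_exp_rot, one_mul]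

theorem dot_self_rot (l : Fin n → ℝ) (z : Cn n) : dot (rot l z) (rot l z) = dot z z := by
  simp only [dot_self_eq_sum, norm_rot_apply]

theorem dot_rot (l : Fin n → ℝ) (z w : Cn n) : dot (rot l z) (rot l w) = dot z w := by
  have h1 := dot_self_rot l (z + w)
  rw [rot_add_vec] at h1
  simp only [dot_add_left, dot_add_right] at h1
  have h2 := dot_self_rot l z
  have h3 := dot_self_rot l w
  have h4 := dot_comm w z
  have h5 := dot_comm (rot l w) (rot l z)
  linarith

theorem rot_I_smul (l : Fin n → ℝ) (z : Cn n) :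
    rot l (Complex.I • z) = Complex.I • rot l z := by
  funext k; simp only [rot, Pi.smul_apply, smul_eq_mul]; ring

theorem omega_rot (l : Fin n → ℝ) (z w : Cn n) : omega (rot l z) (rot l w) = omega z w := by
  rw [omega_eq_dot, ← rot_I_smul, dot_rot, omega_eq_dot]

theorem moment_rot (l m : Fin n → ℝ) (z : Cn n) : moment l (rot m z) = moment l z := by
  simp only [moment, norm_rot_apply]

theorem moment_smul (l : Fin n → ℝ) (r : ℝ) (z : Cn n) :
    moment l (r • z) = r ^ 2 * moment l z := by
  simp only [moment, Finset.mul_sum, Pi.smul_apply, norm_smul, mul_pow, Real.norm_eq_abs, sq_abs]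
  exact Finset.sum_congr rfl fun k _ => by ring

theorem moment_pos {b : Fin n → ℝ} (hb : ∀ k, 0 < b k) {z : Cn n} (hz : z ≠ 0) :
    0 < moment b z := by
  obtain ⟨k, hk⟩ := Function.ne_iff.1 hz
  refine mul_pos Real.pi_pos (Finset.sum_pos' (fun j _ => ?_) ⟨k, Finset.mem_univ k, ?_⟩)
  · have := (hb j).le; positivity
  · have := hb k
    have : 0 < ‖z k‖ := norm_pos_iff.2 hk
    positivity

theorem rot_eq_of_int {l m : Fin n → ℝ} (h : ∀ k, ∃ a : ℤ, l k - m k = a) (z : Cn n) :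
    rot l z = rot m z := by
  funext k
  obtain ⟨a, ha⟩ := h k
  have : (l k : ℂ) = m k + a := by
    rw [sub_eq_iff_eq_add] at ha; rw [ha]; push_cast; ring
  rw [rot, rot, this, mul_add, Complex.exp_add,
    show 2 * Real.pi * Complex.I * (a : ℂ) = a * (2 * Real.pi * Complex.I) by ring,
    Complex.exp_int_mul_two_pi_mul_I, mul_one]

theorem int_of_rot_eq {l m : Fin n → ℝ} {z : Cn n} {k : Fin n} (hz : z k ≠ 0)
    (h : rot l z k = rot m z k) : ∃ a : ℤ, l k - m k = a := by
  have h1 := mul_right_cancel₀ hz h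
  rw [Complex.exp_eq_exp_iff_exists_int] at h1
  obtain ⟨a, ha⟩ := h1
  refine ⟨a, ?_⟩
  have h2 : (2 * Real.pi * Complex.I : ℂ) * (l k - m k - a) = 0 := by linear_combination ha
  have h3 : ((l k : ℂ) - m k - a) = 0 :=
    (mul_eq_zero.1 h2).resolve_left Complex.two_pi_I_ne_zero
  have h4 : ((l k - m k - a : ℝ) : ℂ) = 0 := by push_cast; exact h3
  exact sub_eq_zero.1 (Complex.ofReal_eq_zero.1 h4)

theorem hasDerivWithinAt_rot {g : ℝ → Fin n → ℝ} {g' : Fin n → ℝ} {c : ℝ → Cn n} {c' : Cn n}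
    {s : Set ℝ} {t : ℝ} (hg : HasDerivWithinAt g g' s t) (hc : HasDerivWithinAt c c' s t) :
    HasDerivWithinAt (fun u => rot (g u) (c u)) (rot (g t) (c' + inf g' (c t))) s t := by
  rw [hasDerivWithinAt_pi] at hg hc ⊢
  intro k
  have h1 : HasDerivWithinAt (fun u => ((g u k : ℝ) : ℂ)) ((g' k : ℝ) : ℂ) s t := (hg k).ofReal_comp
  have h2 := ((h1.const_mul (2 * Real.pi * Complex.I : ℂ)).cexp).mul (hc k)
  refine h2.congr_deriv ?_
  simp only [rot, inf, Pi.add_apply]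
  ring

/-- The gradient of a linear functional on `ℂⁿ`. -/
def grad (L : Cn n →L[ℝ] ℝ) : Cn n :=
  fun k => ⟨L (Pi.single k 1), L (Pi.single k Complex.I)⟩

theorem dot_grad (L : Cn n →L[ℝ] ℝ) (w : Cn n) : dot (grad L) w = L w := by
  have hw : w = ∑ k, ((w k).re • (Pi.single k 1 : Cn n) + (w k).im • (Pi.single k Complex.I : Cn n)) := by
    funext j
    simp only [Finset.sum_apply, Pi.add_apply, Pi.smul_apply, Pi.single_apply]
    rw [Finset.sum_eq_single j]
    · simp [Complex.re_add_im]
    · intro k _ hk; simp [hk.symm]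
    · simp
  conv_rhs => rw [hw]
  simp only [map_sum, map_add, map_smul, smul_eq_mul, dot, grad]
  exact Finset.sum_congr rfl fun k _ => by ring

theorem contDiff_grad : ContDiff ℝ ∞ (grad : (Cn n →L[ℝ] ℝ) → Cn n) := by
  rw [contDiff_pi]
  intro k
  have : (fun L : Cn n →L[ℝ] ℝ => grad L k)
      = fun L => ((L (Pi.single k 1) : ℝ) : ℂ) + (L (Pi.single k Complex.I) : ℝ) * Complex.I := by
    funext L; exact Complex.mk_eq_add_mul_I _ _
  rw [this]
  have h (v : Cn n) : ContDiff ℝ ∞ (fun L : Cn n →L[ℝ] ℝ => ((L v : ℝ) : ℂ)) :=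
    Complex.ofRealCLM.contDiff.comp (ContinuousLinearMap.apply ℝ ℝ v).contDiff
  exact (h _).add ((h _).mul contDiff_const)

theorem hasDerivWithinAt_dot {f g : ℝ → Cn n} {f' g' : Cn n} {s : Set ℝ} {t : ℝ}
    (hf : HasDerivWithinAt f f' s t) (hg : HasDerivWithinAt g g' s t) :
    HasDerivWithinAt (fun u => dot (f u) (g u)) (dot f' (g t) + dot (f t) g') s t := by
  rw [hasDerivWithinAt_pi] at hf hg
  have hre {a : ℝ → ℂ} {a' : ℂ} (ha : HasDerivWithinAt a a' s t) :
      HasDerivWithinAt (fun u => (a u).re) a'.re s t :=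
    Complex.reCLM.hasFDerivAt.comp_hasDerivWithinAt t ha
  have him {a : ℝ → ℂ} {a' : ℂ} (ha : HasDerivWithinAt a a' s t) :
      HasDerivWithinAt (fun u => (a u).im) a'.im s t :=
    Complex.imCLM.hasFDerivAt.comp_hasDerivWithinAt t ha
  unfold dot
  rw [← Finset.sum_add_distrib]
  refine (HasDerivWithinAt.fun_sum fun k _ => ((hre (hf k)).mul (hre (hg k))).add
    ((him (hf k)).mul (him (hg k)))).congr_deriv ?_
  exact Finset.sum_congr rfl fun k _ => by ring

theorem hasDerivWithinAt_omega {f g : ℝ → Cn n} {f' g' : Cn n} {s : Set ℝ} {t : ℝ}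
    (hf : HasDerivWithinAt f f' s t) (hg : HasDerivWithinAt g g' s t) :
    HasDerivWithinAt (fun u => omega (f u) (g u)) (omega f' (g t) + omega (f t) g') s t := by
  simp only [omega_eq_dot]
  exact hasDerivWithinAt_dot (hf.const_smul Complex.I) hg

theorem contDiff_dot : ContDiff ℝ ∞ (fun y : Cn n × Cn n => dot y.1 y.2) := by
  unfold dot
  have hre (f : Cn n × Cn n → Cn n) (hf : ContDiff ℝ ∞ f) (k) :
      ContDiff ℝ ∞ fun y => (f y k).re :=
    Complex.reCLM.contDiff.comp ((contDiff_pi.1 hf) k)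
  have him (f : Cn n × Cn n → Cn n) (hf : ContDiff ℝ ∞ f) (k) :
      ContDiff ℝ ∞ fun y => (f y k).im :=
    Complex.imCLM.contDiff.comp ((contDiff_pi.1 hf) k)
  exact ContDiff.sum fun k _ => ((hre _ contDiff_fst k).mul (hre _ contDiff_snd k)).add
    ((him _ contDiff_fst k).mul (him _ contDiff_snd k))

theorem contDiff_moment (l : Fin n → ℝ) : ContDiff ℝ ∞ (moment l) := by
  have : moment l = fun z : Cn n =>
      Real.pi * ∑ k, l k * ((z k).re * (z k).re + (z k).im * (z k).im) := by
    funext z; simp only [moment, Complex.sq_norm, Complex.normSq_apply]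
  rw [this]
  have hre (k) : ContDiff ℝ ∞ fun z : Cn n => (z k).re :=
    Complex.reCLM.contDiff.comp (contDiff_apply ℝ ℂ k)
  have him (k) : ContDiff ℝ ∞ fun z : Cn n => (z k).im :=
    Complex.imCLM.contDiff.comp (contDiff_apply ℝ ℂ k)
  exact contDiff_const.mul (ContDiff.sum fun k _ =>
    contDiff_const.mul (((hre k).mul (hre k)).add ((him k).mul (him k))))

/-- `rot l` as a real linear map. -/
def rotL (l : Fin n → ℝ) : Cn n →ₗ[ℝ] Cn n where
  toFun := rot l
  map_add' := rot_add_vec l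
  map_smul' := rot_smul l

end Cn

/-! ### The Delzant condition and the orbits of `𝕂` on the level. -/

namespace DelzantPolytope

variable {d n : ℕ} (D : DelzantPolytope d n)

/-- The map `β_Δ : ℝⁿ → 𝔱, ε_j ↦ v_j`. -/
def beta : (Fin n → ℝ) →ₗ[ℝ] (Fin d → ℝ) where
  toFun l := fun i => ∑ j, l j * (D.v j i : ℝ)
  map_add' := by
    intro l m; funext i
    simp only [Pi.add_apply, add_mul, Finset.sum_add_distrib]
  map_smul' := by
    intro c l; funext i
    simp only [Pi.smul_apply, smul_eq_mul, mul_assoc, ← Finset.mul_sum, RingHom.id_apply]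

theorem mem_lieK_iff {l : Fin n → ℝ} : l ∈ D.lieK ↔ D.beta l = 0 := by
  rw [funext_iff]; exact Iff.rfl

theorem ker_beta : LinearMap.ker D.beta = D.lieK := by
  ext l; rw [LinearMap.mem_ker, mem_lieK_iff]

theorem mem_lieK₀_iff {l : Fin n → ℝ} : l ∈ D.lieK₀ ↔ l ∈ D.lieK ∧ D.p l = 0 := by
  rw [lieK₀, Submodule.mem_inf, LinearMap.mem_ker]

/-- The annihilator of `ker β_Δ` is the range of the transpose of `β_Δ`. -/
theorem exists_of_annihilates {η : Fin n → ℝ} (h : ∀ l ∈ D.lieK, ∑ j, l j * η j = 0) :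
    ∃ x : Fin d → ℝ, ∀ j, η j = ∑ i, x i * (D.v j i : ℝ) := by
  let f : Module.Dual ℝ (Fin n → ℝ) := ∑ j, η j • LinearMap.proj j
  have hf (l) : f l = ∑ j, l j * η j := by
    simp [f, LinearMap.sum_apply, mul_comm]
  have hmem : f ∈ (LinearMap.ker D.beta).dualAnnihilator := by
    rw [Submodule.mem_dualAnnihilator]
    intro l hl
    rw [hf]; exact h l (D.ker_beta ▸ hl)
  rw [← LinearMap.range_dualMap_eq_dualAnnihilator_ker] at hmem
  obtain ⟨ψ, hψ⟩ := hmem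
  refine ⟨fun i => ψ (Pi.single i 1), fun j => ?_⟩
  have h1 : f (Pi.single j 1) = η j := by
    rw [hf, Finset.sum_eq_single j] <;> simp +contextual
  have h2 : D.beta (Pi.single j 1) = ∑ i, (D.v j i : ℝ) • (Pi.single i 1 : Fin d → ℝ) := by
    funext i
    simp [beta, Pi.single_apply]
  rw [← h1, ← hψ, LinearMap.dualMap_apply, h2, map_sum]
  exact Finset.sum_congr rfl fun i _ => by rw [map_smul, smul_eq_mul, mul_comm]

theorem n_pos {d n : ℕ} (D : DelzantPolytope d n) : 0 < n := by
  by_contra hn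
  have hn : n = 0 := by omega
  subst hn
  have h := D.compact
  have : {x : Fin d → ℝ | ∀ j : Fin 0, 0 ≤ ∑ i, x i * (D.v j i : ℝ) + D.a j} = Set.univ := by
    ext x; simp
  rw [this] at h
  have : Nonempty (Fin d) := ⟨⟨0, D.dim_pos⟩⟩
  exact noncompact_univ _ h

theorem p_pos {b : Fin n → ℝ} (hb : ∀ k, 0 < b k) : 0 < D.p b :=
  Finset.sum_pos (fun j _ => mul_pos (D.a_pos j) (hb j)) ⟨⟨0, D.n_pos⟩, Finset.mem_univ _⟩

/-- The covector `π|z_j|² - a_j` annihilates `𝔨` by the level equation. The resulting `x` lies in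
`Δ`, and the facets through it are those with `z_j = 0`; this is how the smoothness of `Δ` reaches
points of the level. -/
theorem exists_polytope_point {z : Cn n} (hz : z ∈ D.level) :
    ∃ x : Fin d → ℝ, ∀ j, ∑ i, x i * (D.v j i : ℝ) + D.a j = Real.pi * ‖z j‖ ^ 2 := by
  obtain ⟨x, hx⟩ := D.exists_of_annihilates (η := fun j => Real.pi * ‖z j‖ ^ 2 - D.a j) (by
    intro l hl
    have h1 : Real.pi * ∑ k, l k * ‖z k‖ ^ 2 = ∑ j, D.a j * l j := hz l hl
    rw [Finset.mul_sum] at h1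
    simp only [mul_sub, Finset.sum_sub_distrib]
    rw [sub_eq_zero, ← Finset.sum_congr rfl fun j _ => mul_comm (D.a j) (l j), ← h1]
    exact Finset.sum_congr rfl fun j _ => by ring)
  exact ⟨x, fun j => by have := hx j; linarith⟩

/-- On the stabilizer side the torus acts freely: on `𝔨` every coordinate that vanishes at a point
of the level is an integral combination of the coordinates that do not. -/
theorem exists_int_combination {z : Cn n} (hz : z ∈ D.level) :
    ∃ c : Fin n → Fin n → ℤ, (∀ j k, z k = 0 → c j k = 0) ∧
      ∀ l ∈ D.lieK, ∀ j, z j = 0 → l j = ∑ k, (c j k : ℝ) * l k := by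
  classical
  obtain ⟨x, hx⟩ := D.exists_polytope_point hz
  obtain ⟨B, e, he, hB⟩ := D.smooth x fun j => by rw [hx]; positivity
  have hzero {j : Fin n} (hj : z j = 0) : ∑ i, x i * (D.v j i : ℝ) + D.a j = 0 := by
    rw [hx, hj]; simp
  let e' : Fin n → Fin d := fun j => if hj : z j = 0 then e ⟨j, hzero hj⟩ else ⟨0, D.dim_pos⟩
  have he'B {j : Fin n} (hj : z j = 0) : B (e' j) = D.v j := by
    simp only [e', dif_pos hj]; exact hB _
  have he'inj {j k : Fin n} (hj : z j = 0) (hk : z k = 0) (h : e' j = e' k) : j = k := by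
    simp only [e', dif_pos hj, dif_pos hk] at h
    exact congrArg Subtype.val (he h)
  -- Apply to `∑ l_k v_k = 0` the coordinate of the lattice basis `B` dual to `v_j`. Among the
  -- indices with `z_k = 0` only `k = j` contributes, with coefficient `1`; the other indices
  -- contribute integers.
  refine ⟨fun j k => if z k = 0 then 0 else - B.repr (D.v k) (e' j),
    fun j k hk => if_pos hk, fun l hl j hj => ?_⟩
  have hrepr (w : Fin d → ℤ) :
      (B.repr w (e' j) : ℝ) = ∑ i, (w i : ℝ) * (B.repr (Pi.single i 1) (e' j) : ℝ) := by
    have h1 : w = ∑ i, w i • (Pi.single i 1 : Fin d → ℤ) := by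
      funext r
      simp [Pi.single_apply]
    conv_lhs => rw [h1]
    rw [map_sum, Finsupp.finsetSum_apply]
    push_cast
    exact Finset.sum_congr rfl fun i _ => by
      rw [map_smul, Finsupp.smul_apply, smul_eq_mul]; push_cast; rfl
  have h0 : ∑ k, l k * (B.repr (D.v k) (e' j) : ℝ) = 0 := by
    rw [Finset.sum_congr rfl fun k _ => by rw [hrepr, Finset.mul_sum]]
    rw [Finset.sum_comm]
    refine Finset.sum_eq_zero fun i _ => ?_
    rw [← Finset.sum_congr rfl fun k _ => mul_assoc (l k) _ _, ← Finset.sum_mul, hl i, zero_mul]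
  have h1 : ∀ k, l k * (B.repr (D.v k) (e' j) : ℝ) =
      (if k = j then l j else 0)
        - ((if z k = 0 then 0 else - B.repr (D.v k) (e' j) : ℤ) : ℝ) * l k := by
    intro k
    by_cases hk : z k = 0
    · rw [if_pos hk, ← he'B hk, B.repr_self, Finsupp.single_apply]
      by_cases hkj : k = j
      · subst hkj; simp
      · rw [if_neg fun h => hkj (he'inj hk hj h), if_neg hkj]; simp
    · have hkj : k ≠ j := fun h => hk (h ▸ hj)
      rw [if_neg hk, if_neg hkj]; push_cast; ring
  rw [Finset.sum_congr rfl fun k _ => h1 k, Finset.sum_sub_distrib] at h0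
  simp only [Finset.sum_ite_eq', Finset.mem_univ, if_true] at h0
  linarith

/-- Integrality passes from the nonzero coordinates to the others through the integral relations.
This is the freeness of the `𝕂`-action; the next lemma is its infinitesimal form. -/
theorem mem_latticeK_of_int {z : Cn n} (hz : z ∈ D.level) {l : Fin n → ℝ} (hl : l ∈ D.lieK)
    (h : ∀ k, z k ≠ 0 → ∃ m : ℤ, l k = m) : l ∈ D.latticeK := by
  obtain ⟨c, hc0, hc⟩ := D.exists_int_combination hz
  choose! m hm using h
  refine ⟨hl, fun j => ?_⟩
  by_cases hj : z j = 0
  · refine ⟨∑ k, c j k * m k, ?_⟩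
    rw [hc l hl j hj]
    push_cast
    refine Finset.sum_congr rfl fun k _ => ?_
    by_cases hk : z k = 0
    · rw [hc0 j k hk]; simp
    · rw [hm k hk]
  · exact ⟨m j, hm j hj⟩

theorem eq_zero_of_inf_eq_zero {z : Cn n} (hz : z ∈ D.level) {l : Fin n → ℝ} (hl : l ∈ D.lieK)
    (h : Cn.inf l z = 0) : l = 0 := by
  obtain ⟨c, hc0, hc⟩ := D.exists_int_combination hz
  have h1 (k) (hk : z k ≠ 0) : l k = 0 := by
    have := (mul_eq_zero.1 (congrFun h k)).resolve_right hk
    simpa using (mul_eq_zero.1 this).resolve_left Complex.two_pi_I_ne_zero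
  funext j
  by_cases hj : z j = 0
  · rw [hc l hl j hj]
    refine Finset.sum_eq_zero fun k _ => ?_
    by_cases hk : z k = 0
    · rw [hc0 j k hk]; simp
    · rw [h1 k hk, mul_zero]
  · exact h1 j hj

theorem sub_mem_latticeK_of_rot_eq {z : Cn n} (hz : z ∈ D.level) {l m : Fin n → ℝ}
    (hl : l ∈ D.lieK) (hm : m ∈ D.lieK) (h : Cn.rot l z = Cn.rot m z) : l - m ∈ D.latticeK :=
  D.mem_latticeK_of_int hz (D.lieK.sub_mem hl hm) fun k hk => by
    simpa using Cn.int_of_rot_eq hk (congrFun h k)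

theorem isTangent_iff {z w : Cn n} :
    D.IsTangent z w ↔ ∀ l ∈ D.lieK, Cn.omega (Cn.inf l z) w = 0 := by
  simp only [Cn.omega_inf_left, neg_eq_zero]; exact Iff.rfl

theorem rot_mem_level {z : Cn n} (hz : z ∈ D.level) (l : Fin n → ℝ) : Cn.rot l z ∈ D.level :=
  fun m hm => by rw [Cn.moment_rot]; exact hz m hm

theorem smul_mem_level_iff {b : Fin n → ℝ} (hb : b ∈ D.lieK) (hb_pos : ∀ k, 0 < b k) {z : Cn n}
    (hz : z ∈ D.level) {r : ℝ} (hr : 0 < r) : r • z ∈ D.level ↔ r = 1 := by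
  constructor
  · intro h
    have h1 := h b hb
    rw [Cn.moment_smul, hz b hb] at h1
    have h2 := D.p_pos hb_pos
    have h3 : r ^ 2 = 1 := by
      have : (r ^ 2 - 1) * D.p b = 0 := by linarith
      linarith [(mul_eq_zero.1 this).resolve_right h2.ne']
    nlinarith
  · rintro rfl; simpa using hz

theorem ne_zero_of_mem_level {b : Fin n → ℝ} (hb : b ∈ D.lieK) (hb_pos : ∀ k, 0 < b k) {z : Cn n}
    (hz : z ∈ D.level) : z ≠ 0 := by
  rintro rfl
  have h1 := hz b hb
  have h2 := D.p_pos hb_pos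
  simp [Cn.moment] at h1
  exact h2.ne h1

/-- The symplectic complement of the tangent space of a level is the tangent space of the orbit. -/
theorem exists_eq_inf {z Y : Cn n} (h : ∀ w, D.IsTangent z w → Cn.omega Y w = 0) :
    ∃ m ∈ D.lieK, Y = Cn.inf m z := by
  let om (v : Cn n) : Cn n →ₗ[ℝ] ℝ :=
    { toFun := Cn.omega v
      map_add' := Cn.omega_add_right v
      map_smul' := fun r w => by rw [Cn.omega_smul_right]; rfl }
  -- `T` is, up to sign, the differential of `P_𝕂` at `z`. A functional that vanishes on its kernel
  -- factors through it, and a functional on the dual of `𝔨` is evaluation at some `m ∈ 𝔨`.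
  let T : Cn n →ₗ[ℝ] Module.Dual ℝ D.lieK :=
    { toFun := fun w =>
        { toFun := fun l => Cn.omega (Cn.inf l z) w
          map_add' := fun l m => by
            rw [Submodule.coe_add, Cn.inf_add, Cn.omega_add_left]
          map_smul' := fun r l => by
            rw [Submodule.coe_smul, Cn.inf_smul, Cn.omega_smul_left]; rfl }
      map_add' := fun w w' => by ext l; exact Cn.omega_add_right _ _ _
      map_smul' := fun r w => by ext l; exact Cn.omega_smul_right _ _ _ }
  have hmem : om Y ∈ (LinearMap.ker T).dualAnnihilator := by
    rw [Submodule.mem_dualAnnihilator]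
    intro w hw
    refine h w (D.isTangent_iff.2 fun l hl => ?_)
    exact LinearMap.congr_fun (LinearMap.mem_ker.1 hw) ⟨l, hl⟩
  rw [← LinearMap.range_dualMap_eq_dualAnnihilator_ker] at hmem
  obtain ⟨ψ, hψ⟩ := hmem
  obtain ⟨m, rfl⟩ := (Module.evalEquiv ℝ D.lieK).surjective ψ
  exact ⟨m, m.2, Cn.eq_of_omega_eq fun u => (LinearMap.congr_fun hψ u).symm⟩

end DelzantPolytope

/-! ### Derivatives along the level. -/

namespace DelzantPolytope

variable {d n : ℕ} (D : DelzantPolytope d n)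

open Topology in
/-- Every vector that satisfies the linearized equations of the level is the velocity of a curve
in the level. -/
theorem exists_curve_of_isTangent {z w : Cn n} (hz : z ∈ D.level) (hw : D.IsTangent z w) :
    ∃ c : ℝ → Cn n, c 0 = z ∧ HasDerivAt c w 0 ∧ ∀ᶠ u in 𝓝 0, c u ∈ D.level := by
  obtain ⟨C, hC0, hC⟩ := D.exists_int_combination hz
  let η : Fin n → ℝ := fun k => 2 * Real.pi * ((z k).re * (w k).re + (z k).im * (w k).im)
  -- `η` is the first variation of `π|z_k|²`. A vanishing coordinate that moves as `u w_k`
  -- contributes `π u² |w_k|²` at second order; `ζ` compensates it on the nonzero coordinates by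
  -- means of the integral relations, so that both `η` and `ζ` annihilate `𝔨`.
  let ζ : Fin n → ℝ := fun k => if z k = 0 then Real.pi * ‖w k‖ ^ 2 else
    - ∑ j, if z j = 0 then Real.pi * ‖w j‖ ^ 2 * C j k else 0
  have hη (l) (hl : l ∈ D.lieK) : ∑ k, l k * η k = 0 := by
    rw [← hw l hl, Finset.mul_sum]
    exact Finset.sum_congr rfl fun k _ => by simp only [η]; ring
  have hζ (l) (hl : l ∈ D.lieK) : ∑ k, l k * ζ k = 0 := by
    have h1 : ∀ k, l k * ζ k = (if z k = 0 then Real.pi * ‖w k‖ ^ 2 * l k else 0)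
        - ∑ j, if z j = 0 then Real.pi * ‖w j‖ ^ 2 * (C j k * l k) else 0 := by
      intro k
      by_cases hk : z k = 0
      · simp only [ζ, if_pos hk]
        rw [Finset.sum_eq_zero fun j _ => by rw [hC0 j k hk]; simp]
        ring
      · simp only [ζ, if_neg hk, mul_neg, Finset.mul_sum, zero_sub]
        congr 1
        refine Finset.sum_congr rfl fun j _ => ?_
        split_ifs <;> ring
    rw [Finset.sum_congr rfl fun k _ => h1 k, Finset.sum_sub_distrib, Finset.sum_comm,
      ← Finset.sum_sub_distrib]
    refine Finset.sum_eq_zero fun j _ => ?_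
    by_cases hj : z j = 0
    · simp only [if_pos hj]
      rw [← Finset.mul_sum, ← hC l hl j hj, sub_self]
    · simp [if_neg hj]
  -- Modulus and argument of the nonzero coordinates are prescribed separately: `ρ` gives `π|c_k|² =
  -- π|z_k|² + u η_k + u² ζ_k` exactly, and `θ` is the angular velocity of `w_k`. The level
  -- equations then hold identically wherever `ρ > 0`.
  let ρ : Fin n → ℝ → ℝ := fun k u => 1 + (u * η k + u ^ 2 * ζ k) / (Real.pi * ‖z k‖ ^ 2)
  let θ : Fin n → ℝ := fun k => ((z k).re * (w k).im - (z k).im * (w k).re) / ‖z k‖ ^ 2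
  let c : ℝ → Cn n := fun u k => if z k = 0 then (u : ℂ) * w k else
    (Real.sqrt (ρ k u) : ℂ) * Complex.exp (((u * θ k : ℝ) : ℂ) * Complex.I) * z k
  have hρ0 (k) : ρ k 0 = 1 := by simp [ρ]
  have hρ (k) : HasDerivAt (ρ k) (η k / (Real.pi * ‖z k‖ ^ 2)) 0 := by
    have h1 : HasDerivAt (fun u : ℝ => u * η k + u ^ 2 * ζ k) (η k) 0 := by
      have := ((hasDerivAt_id (0 : ℝ)).mul_const (η k)).add
        (((hasDerivAt_id (0 : ℝ)).pow 2).mul_const (ζ k))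
      simpa using! this
    exact (h1.div_const _).const_add 1
  refine ⟨c, ?_, ?_, ?_⟩
  · funext k
    by_cases hk : z k = 0
    · simp [c, hk]
    · simp [c, hk, hρ0]
  · rw [hasDerivAt_pi]
    intro k
    by_cases hk : z k = 0
    · simp only [c, if_pos hk]
      simpa using (hasDerivAt_id (0 : ℝ)).ofReal_comp.mul_const (w k)
    · simp only [c, if_neg hk]
      have h1 := ((hρ k).sqrt (by rw [hρ0]; norm_num)).ofReal_comp
      have h2 : HasDerivAt (fun u : ℝ => Complex.exp (((u * θ k : ℝ) : ℂ) * Complex.I))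
          ((θ k : ℂ) * Complex.I) 0 := by
        have := (((hasDerivAt_id (0 : ℝ)).mul_const (θ k)).ofReal_comp.mul_const Complex.I).cexp
        simpa using this
      refine ((h1.mul h2).mul_const (z k)).congr_deriv ?_
      have hn : (‖z k‖ : ℝ) ^ 2 ≠ 0 := by simpa using hk
      have hz2 : (z k).re * (z k).re + (z k).im * (z k).im = ‖z k‖ ^ 2 := by
        rw [Complex.sq_norm, Complex.normSq_apply]
      have hr : η k / (Real.pi * ‖z k‖ ^ 2) / (2 * Real.sqrt (ρ k 0))
          = ((z k).re * (w k).re + (z k).im * (w k).im) / ‖z k‖ ^ 2 := by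
        rw [hρ0, Real.sqrt_one]
        simp only [η]
        field_simp
      rw [hr]
      set a := ((z k).re * (w k).re + (z k).im * (w k).im) / ‖z k‖ ^ 2 with ha
      have ha' : a * ‖z k‖ ^ 2 = (z k).re * (w k).re + (z k).im * (w k).im := by
        rw [ha]; field_simp
      have ht' : θ k * ‖z k‖ ^ 2 = (z k).re * (w k).im - (z k).im * (w k).re := by
        simp only [θ]; field_simp
      generalize θ k = t at ht'
      rw [← hz2] at ha' ht' hn
      apply Complex.ext
      · simp [hρ0]
        refine mul_right_cancel₀ hn ?_
        linear_combination (z k).re * ha' - (z k).im * ht'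
      · simp [hρ0]
        refine mul_right_cancel₀ hn ?_
        linear_combination (z k).im * ha' + (z k).re * ht'
  · have hpos : ∀ᶠ u in 𝓝 (0 : ℝ), ∀ k, 0 < ρ k u := by
      rw [Filter.eventually_all]
      intro k
      exact (hρ k).continuousAt.eventually (lt_mem_nhds (by rw [hρ0]; exact one_pos))
    filter_upwards [hpos] with u hu l hl
    have h1 : ∀ k, Real.pi * (l k * ‖c u k‖ ^ 2) =
        Real.pi * (l k * ‖z k‖ ^ 2) + u * (l k * η k) + u ^ 2 * (l k * ζ k) := by
      intro k
      by_cases hk : z k = 0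
      · simp [c, ζ, η, hk, mul_pow]
        ring
      · have hn : (‖z k‖ : ℝ) ^ 2 ≠ 0 := by simpa using hk
        have h2 : ‖c u k‖ ^ 2 = ρ k u * ‖z k‖ ^ 2 := by
          simp only [c, if_neg hk, norm_mul, Complex.norm_exp_ofReal_mul_I, mul_one, mul_pow,
            Complex.norm_real, Real.norm_eq_abs, sq_abs]
          rw [Real.sq_sqrt (hu k).le]
        rw [h2]
        simp only [ρ]
        field_simp
        ring
    have h3 := hz l hl
    rw [Cn.moment, Finset.mul_sum] at h3 ⊢
    rw [Finset.sum_congr rfl fun k _ => h1 k, Finset.sum_add_distrib, Finset.sum_add_distrib, h3,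
      ← Finset.mul_sum, ← Finset.mul_sum, hη l hl, hζ l hl]
    ring

/-- Derivatives within the level are not unique as functionals on `ℂⁿ`, but each tangent vector is
the velocity of a curve in the level, and the derivative along the curve is unique. This compares
the `df` of a contact vector with `dH`. -/
theorem fderiv_eq_on_tangent {f : Cn n → ℝ} {A B : Cn n →L[ℝ] ℝ} {z w : Cn n} (hz : z ∈ D.level)
    (hA : HasFDerivWithinAt f A D.level z) (hB : HasFDerivWithinAt f B D.level z)
    (hw : D.IsTangent z w) : A w = B w := by
  obtain ⟨c, hc0, hc, hcl⟩ := D.exists_curve_of_isTangent hz hw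
  let s : Set ℝ := {u | c u ∈ D.level}
  have hs : s ∈ nhds (0 : ℝ) := hcl
  have key {L : Cn n →L[ℝ] ℝ} (hL : HasFDerivWithinAt f L D.level z) :
      HasDerivAt (f ∘ c) (L w) 0 := by
    rw [← hc0] at hL
    exact (hL.comp_hasDerivWithinAt 0 (hc.hasDerivWithinAt (s := s)) fun u hu => hu).hasDerivAt hs
  exact (key hA).unique (key hB)

end DelzantPolytope

/-! ### Uniqueness for differential equations. -/

open Set in
/-- Uniqueness of the solutions of a `C¹` differential equation on an open set. -/
theorem eqOn_of_hasDerivWithinAt {E : Type*} [NormedAddCommGroup E] [NormedSpace ℝ E]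
    [FiniteDimensional ℝ E] {Ω : Set E} (hΩ : IsOpen Ω) {v : ℝ → E → E}
    (hv : ContDiffOn ℝ 1 (fun y : ℝ × E => v y.1 y.2) (Icc (0 : ℝ) 1 ×ˢ Ω)) {f g : ℝ → E}
    (hf : ∀ t ∈ Icc (0 : ℝ) 1, HasDerivWithinAt f (v t (f t)) (Icc 0 1) t)
    (hfΩ : ∀ t ∈ Icc (0 : ℝ) 1, f t ∈ Ω)
    (hg : ∀ t ∈ Icc (0 : ℝ) 1, HasDerivWithinAt g (v t (g t)) (Icc 0 1) t)
    (h0 : f 0 = g 0) : EqOn f g (Icc 0 1) := by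
  have hfc : ContinuousOn f (Icc 0 1) := fun t ht => (hf t ht).continuousWithinAt
  have hgc : ContinuousOn g (Icc 0 1) := fun t ht => (hg t ht).continuousWithinAt
  have hclosed : IsClosed ({t | f t = g t} ∩ Icc 0 1) := by
    have := (hfc.sub hgc).preimage_isClosed_of_isClosed isClosed_Icc (isClosed_singleton (x := 0))
    convert this using 1
    ext t
    simp [sub_eq_zero, and_comm]
  refine hclosed.Icc_subset_of_forall_exists_gt h0 ?_
  rintro t₀ ⟨ht₀, ht₀1⟩ y hy
  have ht₀' : t₀ ∈ Icc (0 : ℝ) 1 := ⟨ht₀1.1, ht₀1.2.le⟩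
  obtain ⟨r, hr, hrΩ⟩ := Metric.nhds_basis_closedBall.mem_iff.1 (hΩ.mem_nhds (hfΩ t₀ ht₀'))
  -- A `C¹` field is Lipschitz on the compact convex set `[0,1] × ball`, so agreement at `t₀`
  -- propagates to the right as long as both curves stay in the ball.
  obtain ⟨K, hK⟩ := (hv.mono (prod_mono_right hrΩ)).exists_lipschitzOnWith one_ne_zero
    ((convex_Icc 0 1).prod (convex_closedBall (f t₀) r))
    (isCompact_Icc.prod (isCompact_closedBall (f t₀) r))
  have hball := Metric.closedBall_mem_nhds (f t₀) hr
  have hev := ((hfc t₀ ht₀').eventually_mem hball).and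
    ((hgc t₀ ht₀').eventually_mem (by rw [← show f t₀ = g t₀ from ht₀]; exact hball))
  obtain ⟨δ, hδ, hδs⟩ := Metric.mem_nhdsWithin_iff.1 hev
  -- The endpoint has to stay below the prescribed `y`, inside `[0,1]`, and within the time `δ`
  -- during which both curves remain in the ball.
  let b := min y (min 1 (t₀ + δ / 2))
  have hb : t₀ < b := lt_min hy (lt_min ht₀1.2 (by linarith))
  have hby : b ≤ y := min_le_left _ _
  have hb1 : b ≤ 1 := (min_le_right _ _).trans (min_le_left _ _)
  have hbδ : b ≤ t₀ + δ / 2 := (min_le_right _ _).trans (min_le_right _ _)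
  have hsub : Icc t₀ b ⊆ Icc 0 1 := Icc_subset_Icc ht₀1.1 hb1
  have hmem : ∀ t ∈ Icc t₀ b, f t ∈ Metric.closedBall (f t₀) r ∧
      g t ∈ Metric.closedBall (f t₀) r := fun t ht => hδs ⟨by
    rw [Metric.mem_ball, Real.dist_eq, abs_of_nonneg (by linarith [ht.1])]
    linarith [ht.2], hsub ht⟩
  have hder {e : ℝ → E} (he : ∀ t ∈ Icc (0 : ℝ) 1, HasDerivWithinAt e (v t (e t)) (Icc 0 1) t) :
      ∀ t ∈ Ico t₀ b, HasDerivWithinAt e (v t (e t)) (Ici t) t := fun t ht => by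
    have ht' := hsub (Ico_subset_Icc_self ht)
    refine (he t ht').mono_of_mem_nhdsWithin ?_
    have : Icc t 1 ∈ nhdsWithin t (Ici t) := Icc_mem_nhdsGE (ht.2.trans_le hb1)
    exact Filter.mem_of_superset this (Icc_subset_Icc_left ht'.1)
  have huniq := ODE_solution_unique_of_mem_Icc_right (v := v) (K := K)
    (s := fun _ => Metric.closedBall (f t₀) r) (a := t₀) (b := b)
    (fun t ht => by
      intro x hx x' hx'
      have ht' := hsub (Ico_subset_Icc_self ht)
      have := hK (show (t, x) ∈ _ from ⟨ht', hx⟩) (show (t, x') ∈ _ from ⟨ht', hx'⟩)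
      simpa [Prod.edist_eq] using this)
    (hfc.mono hsub) (hder hf) (fun t ht => (hmem t (Ico_subset_Icc_self ht)).1)
    (hgc.mono hsub) (hder hg) (fun t ht => (hmem t (Ico_subset_Icc_self ht)).2) ht₀
  exact ⟨b, huniq ⟨hb.le, le_rfl⟩, hb, hby⟩

/-- The Hamiltonian vector field of `H t` on `ℂⁿ`. -/
def hamVF {n : ℕ} (H : ℝ → Cn n → ℝ) (t : ℝ) (z : Cn n) : Cn n :=
  Complex.I • Cn.grad (fderiv ℝ (H t) z)

theorem omega_hamVF {n : ℕ} (H : ℝ → Cn n → ℝ) (t : ℝ) (z w : Cn n) :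
    Cn.omega (hamVF H t z) w = - fderiv ℝ (H t) z w := by
  rw [hamVF, Cn.omega_I_smul_left, Cn.dot_grad]

/-! ### Homogeneous Hamiltonians and their flows. -/

namespace DelzantPolytope

variable {d n : ℕ} (D : DelzantPolytope d n)

open Set

/-- The properties of a Hamiltonian lift that do not refer to its restriction to the level. -/
structure IsConicHamiltonian (H : ℝ → Cn n → ℝ) : Prop where
  smooth : ContDiffOn ℝ ∞ (fun y : ℝ × Cn n => H y.1 y.2) (Icc (0 : ℝ) 1 ×ˢ {0}ᶜ)
  homogeneous : ∀ t ∈ Icc (0 : ℝ) 1, ∀ r : ℝ, 0 < r → ∀ z, H t (r • z) = r ^ 2 * H t z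
  invariant : ∀ t ∈ Icc (0 : ℝ) 1, ∀ l ∈ D.lieK₀, ∀ z, H t (Cn.rot l z) = H t z

theorem radialProj_smul (b : Fin n → ℝ) {r : ℝ} (hr : 0 < r) (z : Cn n) :
    D.radialProj b (r • z) = D.radialProj b z := by
  rw [radialProj, radialProj, Cn.moment_smul, smul_smul]
  congr 1
  rw [show D.p b / (r ^ 2 * Cn.moment b z) = (D.p b / Cn.moment b z) / r ^ 2 by
    rw [div_div, mul_comm], Real.sqrt_div' _ (by positivity), Real.sqrt_sq hr.le]
  field_simp

theorem radialProj_rot (b l : Fin n → ℝ) (z : Cn n) :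
    D.radialProj b (Cn.rot l z) = Cn.rot l (D.radialProj b z) := by
  rw [radialProj, radialProj, Cn.moment_rot, Cn.rot_smul]

theorem sqrt_moment_pos {b : Fin n → ℝ} (hb_pos : ∀ k, 0 < b k) {z : Cn n} (hz : z ≠ 0) :
    0 < Real.sqrt (D.p b / Cn.moment b z) :=
  Real.sqrt_pos.2 (div_pos (D.p_pos hb_pos) (Cn.moment_pos hb_pos hz))

theorem moment_radialProj {b : Fin n → ℝ} (hb_pos : ∀ k, 0 < b k) {z : Cn n} (hz : z ≠ 0) :
    Cn.moment b (D.radialProj b z) = D.p b := by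
  have h1 := Cn.moment_pos hb_pos hz
  have h2 := D.p_pos hb_pos
  rw [radialProj, Cn.moment_smul, Real.sq_sqrt (by positivity), div_mul_cancel₀ _ h1.ne']

theorem radialProj_of_mem_level {b : Fin n → ℝ} (hb : b ∈ D.lieK) (hb_pos : ∀ k, 0 < b k)
    {z : Cn n} (hz : z ∈ D.level) : D.radialProj b z = z := by
  rw [radialProj, hz b hb, div_self (D.p_pos hb_pos).ne', Real.sqrt_one, one_smul]

variable {D} {b : Fin n → ℝ} {h : ℝ → D.V → ℝ} {H : ℝ → Cn n → ℝ}

/-- The factor `|z|² / |pr(z)|²` equals `moment b z / p(b)`, which is visibly smooth, quadratic and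
torus invariant, while `pr` is invariant under dilations and commutes with rotations. -/
theorem IsHamiltonianLift.isConic (hb_pos : ∀ k, 0 < b k) (hH : D.IsHamiltonianLift b h H) :
    D.IsConicHamiltonian H := by
  obtain ⟨hbar, hs, hinv, -, hH⟩ := hH
  have hp := D.p_pos hb_pos
  have key {t} (ht : t ∈ Icc (0 : ℝ) 1) {z : Cn n} (hz : z ≠ 0) :
      H t z = Cn.moment b z / D.p b * hbar t (D.radialProj b z) := by
    rw [(hH t ht).2 z hz]
    congr 1
    have h1 := Cn.moment_pos hb_pos hz
    have h2 := Cn.dot_self_pos hz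
    conv_lhs => rw [radialProj, Cn.dot_smul_left, Cn.dot_smul_right]
    rw [← mul_assoc, Real.mul_self_sqrt (by positivity)]
    field_simp
  refine ⟨?_, ?_, ?_⟩
  · refine ContDiffOn.congr (f := fun y : ℝ × Cn n =>
      Cn.moment b y.2 / D.p b * hbar y.1 (D.radialProj b y.2)) ?_ ?_
    · exact (((Cn.contDiff_moment b).comp contDiff_snd).div_const _).contDiffOn.mul hs
    · rintro ⟨t, z⟩ ⟨ht, hz⟩
      exact key ht hz
  · intro t ht r hr z
    by_cases hz : z = 0
    · subst hz; simp [(hH t ht).1]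
    · rw [key ht (smul_ne_zero hr.ne' hz), key ht hz, Cn.moment_smul, D.radialProj_smul b hr]
      ring
  · intro t ht l hl z
    by_cases hz : z = 0
    · subst hz; rw [Cn.rot_zero_vec]
    · rw [key ht fun h => hz (Cn.rot_eq_zero.1 h), key ht hz, Cn.moment_rot, D.radialProj_rot,
        hinv t ht _ (D.moment_radialProj hb_pos hz) l hl]

theorem IsHamiltonianLift.eq_pull (hb : b ∈ D.lieK) (hb_pos : ∀ k, 0 < b k)
    (hH : D.IsHamiltonianLift b h H) {t : ℝ} (ht : t ∈ Icc (0 : ℝ) 1) {z : Cn n}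
    (hz : z ∈ D.level) : H t z = D.pull (h t) z := by
  obtain ⟨hbar, -, -, hres, hH⟩ := hH
  have hz0 := D.ne_zero_of_mem_level hb hb_pos hz
  rw [(hH t ht).2 z hz0, D.radialProj_of_mem_level hb hb_pos hz,
    div_self (Cn.dot_self_pos hz0).ne', one_mul, hres t ht ⟨z, hz⟩, pull, dif_pos hz]

namespace IsConicHamiltonian

theorem differentiableAt
    (hC : D.IsConicHamiltonian H)
    {t : ℝ} (ht : t ∈ Icc (0 : ℝ) 1) {z : Cn n} (hz : z ≠ 0) :
    DifferentiableAt ℝ (H t) z := by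
  have h1 : ContDiffOn ℝ ∞ (H t) {0}ᶜ :=
    hC.smooth.comp (f := fun z => (t, z)) (contDiff_prodMk_right t).contDiffOn fun z hz => ⟨ht, hz⟩
  exact (h1.contDiffAt (isOpen_compl_singleton.mem_nhds hz)).differentiableAt (by simp)

theorem contDiffOn_hamVF
    (hC : D.IsConicHamiltonian H) :
    ContDiffOn ℝ 1 (fun y : ℝ × Cn n => hamVF H y.1 y.2) (Icc (0 : ℝ) 1 ×ˢ {0}ᶜ) := by
  have hu : UniqueDiffOn ℝ (Icc (0 : ℝ) 1 ×ˢ ({0}ᶜ : Set (Cn n))) :=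
    (uniqueDiffOn_Icc one_pos).prod isOpen_compl_singleton.uniqueDiffOn
  have h1 := hC.smooth.fderivWithin (m := 1) hu
    (by rw [one_add_one_eq_two]; exact WithTop.coe_le_coe.2 (le_top : (2 : ℕ∞) ≤ ⊤))
  -- `R` restricts a derivative in `(t, z)` to the space directions. Smoothness of the field then
  -- comes from the joint derivative within `[0,1] × (ℂⁿ ∖ 0)`.
  let R : ((ℝ × Cn n) →L[ℝ] ℝ) →L[ℝ] (Cn n →L[ℝ] ℝ) :=
    (ContinuousLinearMap.compL ℝ (Cn n) (ℝ × Cn n) ℝ).flip (ContinuousLinearMap.inr ℝ ℝ (Cn n))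
  have h2 : ContDiffOn ℝ 1 (fun y : ℝ × Cn n => Complex.I • Cn.grad
      (R (fderivWithin ℝ (fun y : ℝ × Cn n => H y.1 y.2) (Icc (0 : ℝ) 1 ×ˢ {0}ᶜ) y)))
      (Icc (0 : ℝ) 1 ×ˢ {0}ᶜ) :=
    ((Cn.contDiff_grad.of_le (by exact_mod_cast le_top)).comp_contDiffOn
      (R.contDiff.comp_contDiffOn h1)).const_smul Complex.I
  refine h2.congr ?_
  rintro ⟨t, z⟩ ⟨ht, hz⟩
  have h3 : HasFDerivAt (H t) (R (fderivWithin ℝ (fun y : ℝ × Cn n => H y.1 y.2)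
      (Icc (0 : ℝ) 1 ×ˢ {0}ᶜ) (t, z))) z := by
    have h4 := (hC.smooth.differentiableOn (by simp) (t, z) ⟨ht, hz⟩).hasFDerivWithinAt
    have h5 := h4.comp z (s := {0}ᶜ) (f := fun z => (t, z)) (hasFDerivAt_prodMk_right t z).hasFDerivWithinAt
      fun z hz => ⟨ht, hz⟩
    exact h5.hasFDerivAt (isOpen_compl_singleton.mem_nhds hz)
  simp only [hamVF, h3.fderiv]

theorem fderiv_smul
    (hC : D.IsConicHamiltonian H)
    {t : ℝ} (ht : t ∈ Icc (0 : ℝ) 1) {z : Cn n} (hz : z ≠ 0) {r : ℝ} (hr : 0 < r)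
    (w : Cn n) : fderiv ℝ (H t) (r • z) w = r * fderiv ℝ (H t) z w := by
  have h1 := (hC.differentiableAt ht (smul_ne_zero hr.ne' hz)).hasFDerivAt
  have h2 : HasFDerivAt (fun z : Cn n => r • z) (r • ContinuousLinearMap.id ℝ (Cn n)) z :=
    (hasFDerivAt_id z).const_smul r
  have h3 := h1.comp z h2
  have h4 := (hC.differentiableAt ht hz).hasFDerivAt.const_mul (r ^ 2)
  have h5 : H t ∘ (fun z : Cn n => r • z) = fun z => r ^ 2 * H t z :=
    funext (hC.homogeneous t ht r hr)
  rw [h5] at h3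
  have h6 := DFunLike.congr_fun (h3.unique h4) w
  simp at h6
  refine mul_left_cancel₀ hr.ne' ?_
  rw [h6]; ring

theorem fderiv_rot
    (hC : D.IsConicHamiltonian H)
    {t : ℝ} (ht : t ∈ Icc (0 : ℝ) 1) {z : Cn n} (hz : z ≠ 0) {l : Fin n → ℝ}
    (hl : l ∈ D.lieK₀) (w : Cn n) :
    fderiv ℝ (H t) (Cn.rot l z) (Cn.rot l w) = fderiv ℝ (H t) z w := by
  have h1 := (hC.differentiableAt ht (fun h => hz (Cn.rot_eq_zero.1 h) : Cn.rot l z ≠ 0)).hasFDerivAt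
  have h2 : HasFDerivAt (Cn.rot l) (LinearMap.toContinuousLinearMap (Cn.rotL l)) z :=
    (LinearMap.toContinuousLinearMap (Cn.rotL l)).hasFDerivAt
  have h3 := h1.comp z h2
  rw [show H t ∘ Cn.rot l = H t from funext (hC.invariant t ht l hl)] at h3
  exact DFunLike.congr_fun (h3.unique (hC.differentiableAt ht hz).hasFDerivAt) w

theorem hamVF_smul
    (hC : D.IsConicHamiltonian H)
    {t : ℝ} (ht : t ∈ Icc (0 : ℝ) 1) {z : Cn n} (hz : z ≠ 0) {r : ℝ} (hr : 0 < r) :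
    hamVF H t (r • z) = r • hamVF H t z :=
  Cn.eq_of_omega_eq fun w => by
    rw [omega_hamVF, hC.fderiv_smul ht hz hr, Cn.omega_smul_left, omega_hamVF]; ring

theorem hamVF_rot
    (hC : D.IsConicHamiltonian H)
    {t : ℝ} (ht : t ∈ Icc (0 : ℝ) 1) {z : Cn n} (hz : z ≠ 0) {l : Fin n → ℝ}
    (hl : l ∈ D.lieK₀) : hamVF H t (Cn.rot l z) = Cn.rot l (hamVF H t z) :=
  Cn.eq_of_omega_eq fun w => by
    rw [← Cn.rot_rot_neg l w, omega_hamVF, hC.fderiv_rot ht hz hl, Cn.omega_rot, omega_hamVF]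

theorem fderiv_self
    (hC : D.IsConicHamiltonian H)
    {t : ℝ} (ht : t ∈ Icc (0 : ℝ) 1) {z : Cn n} (hz : z ≠ 0) :
    fderiv ℝ (H t) z z = 2 * H t z := by
  have h1 : HasDerivAt (fun r : ℝ => r • z) z 1 := by
    simpa using (hasDerivAt_id (1 : ℝ)).smul_const z
  have h2 : HasFDerivAt (H t) (fderiv ℝ (H t) z) ((1 : ℝ) • z) := by
    rw [one_smul]; exact (hC.differentiableAt ht hz).hasFDerivAt
  have h3 := h2.comp_hasDerivAt (1 : ℝ) h1
  have h4 : HasDerivAt (fun r : ℝ => r ^ 2 * H t z) (2 * H t z) 1 := by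
    simpa using ((hasDerivAt_id (1 : ℝ)).pow 2).mul_const (H t z)
  refine h3.unique (h4.congr_of_eventuallyEq ?_)
  filter_upwards [lt_mem_nhds (one_pos : (0 : ℝ) < 1)] with r hr
  exact hC.homogeneous t ht r hr z

end IsConicHamiltonian

end DelzantPolytope

namespace IsHamiltonianIsotopy

open Set

variable {n : ℕ} {H : ℝ → Cn n → ℝ} {Φ : ℝ → Equiv.Perm (Cn n)}

theorem ne_zero
    (hΦ : IsHamiltonianIsotopy H Φ)
    {t : ℝ} (ht : t ∈ Icc (0 : ℝ) 1) {z : Cn n} (hz : z ≠ 0) : Φ t z ≠ 0 := by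
  rw [← hΦ.2.1 t ht]
  exact fun h => hz ((Φ t).injective h)

theorem hasDerivWithinAt
    (hΦ : IsHamiltonianIsotopy H Φ)
    {z : Cn n} (hz : z ≠ 0) {t : ℝ} (ht : t ∈ Icc (0 : ℝ) 1) :
    HasDerivWithinAt (fun u => Φ u z) (hamVF H t (Φ t z)) (Icc 0 1) t := by
  have h1 : ContDiffOn ℝ ∞ (fun u => Φ u z) (Icc (0 : ℝ) 1) :=
    hΦ.2.2.1.comp (f := fun u => (u, z)) (contDiff_prodMk_left z).contDiffOn fun u hu => ⟨hu, hz⟩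
  have h2 := (h1.differentiableOn (by simp) t ht).hasDerivWithinAt
  refine h2.congr_deriv (Cn.eq_of_omega_eq fun w => ?_)
  rw [omega_hamVF, hΦ.2.2.2 z hz t ht w]

theorem contDiffAt
    (hΦ : IsHamiltonianIsotopy H Φ)
    {t : ℝ} (ht : t ∈ Icc (0 : ℝ) 1) {z : Cn n} (hz : z ≠ 0) :
    ContDiffAt ℝ ∞ (Φ t) z := by
  have h1 : ContDiffOn ℝ ∞ (Φ t) {0}ᶜ :=
    hΦ.2.2.1.comp (f := fun z => (t, z)) (contDiff_prodMk_right t).contDiffOn fun z hz => ⟨ht, hz⟩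
  exact h1.contDiffAt (isOpen_compl_singleton.mem_nhds hz)

variable {d : ℕ} {D : DelzantPolytope d n}

theorem eq_of_hasDerivWithinAt
    (hΦ : IsHamiltonianIsotopy H Φ)
    (hC : D.IsConicHamiltonian H)
    {y : ℝ → Cn n} (h0 : y 0 ≠ 0)
    (hy : ∀ t ∈ Icc (0 : ℝ) 1, HasDerivWithinAt y (hamVF H t (y t)) (Icc 0 1) t) {t : ℝ}
    (ht : t ∈ Icc (0 : ℝ) 1) : Φ t (y 0) = y t :=
  eqOn_of_hasDerivWithinAt isOpen_compl_singleton hC.contDiffOn_hamVF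
    (fun _ => hΦ.hasDerivWithinAt h0) (fun _ ht => hΦ.ne_zero ht h0) hy (hΦ.1 _) ht

/-- A dilated integral curve is again an integral curve, because the field is homogeneous of degree
one; uniqueness off the origin does the rest. Invariance under `𝕂₀` gives `map_rot` in the same way.
-/
theorem map_smul
    (hΦ : IsHamiltonianIsotopy H Φ)
    (hC : D.IsConicHamiltonian H)
    {t : ℝ} (ht : t ∈ Icc (0 : ℝ) 1) {r : ℝ} (hr : 0 < r) (z : Cn n) :
    Φ t (r • z) = r • Φ t z := by
  by_cases hz : z = 0
  · subst hz; simp [hΦ.2.1 t ht]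
  · have := hΦ.eq_of_hasDerivWithinAt hC (y := fun u => r • Φ u z)
      (by rw [hΦ.1]; exact smul_ne_zero hr.ne' hz) (fun u hu => by
        rw [hC.hamVF_smul hu (hΦ.ne_zero hu hz) hr]
        exact (hΦ.hasDerivWithinAt hz hu).const_smul r) ht
    simpa [hΦ.1] using this

theorem map_rot
    (hΦ : IsHamiltonianIsotopy H Φ)
    (hC : D.IsConicHamiltonian H)
    {t : ℝ} (ht : t ∈ Icc (0 : ℝ) 1) {l : Fin n → ℝ} (hl : l ∈ D.lieK₀) (z : Cn n) :
    Φ t (Cn.rot l z) = Cn.rot l (Φ t z) := by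
  by_cases hz : z = 0
  · subst hz; simp [hΦ.2.1 t ht, Cn.rot_zero_vec]
  · have := hΦ.eq_of_hasDerivWithinAt hC (y := fun u => Cn.rot l (Φ u z))
      (by rw [hΦ.1]; exact fun h => hz (Cn.rot_eq_zero.1 h)) (fun u hu => by
        rw [hC.hamVF_rot hu (hΦ.ne_zero hu hz) hl]
        have h1 : HasFDerivAt (Cn.rot l) (LinearMap.toContinuousLinearMap (Cn.rotL l)) (Φ u z) :=
          (LinearMap.toContinuousLinearMap (Cn.rotL l)).hasFDerivAt
        exact h1.comp_hasDerivWithinAt u (hΦ.hasDerivWithinAt hz hu)) ht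
    simpa [hΦ.1] using this

end IsHamiltonianIsotopy

/-! ### Integration of orbit directions: the Reeb flow and the lift of the contact isotopy. -/

open Topology in
/-- The solution of a linear equation with injective continuous coefficients is continuous. -/
theorem continuousAt_of_injective {X E F : Type*} [TopologicalSpace X] [NormedAddCommGroup E]
    [NormedSpace ℝ E] [FiniteDimensional ℝ E] [NormedAddCommGroup F] [NormedSpace ℝ F]
    {L : X → E →L[ℝ] F} {m : X → E} {x₀ : X} (hL : ContinuousAt L x₀)
    (hm : ContinuousAt (fun x => L x (m x)) x₀) (hinj : Function.Injective (L x₀)) :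
    ContinuousAt m x₀ := by
  obtain ⟨K, hK0, hK⟩ := (L x₀ : E →ₗ[ℝ] F).injective_iff_antilipschitz.1 hinj
  have hbound (v : E) : ‖v‖ ≤ K * ‖L x₀ v‖ := by
    simpa [dist_eq_norm] using hK.le_mul_dist v 0
  have hK' : (0 : ℝ) < K := hK0
  have hL0 : Filter.Tendsto (fun x => ‖L x - L x₀‖) (𝓝 x₀) (𝓝 0) := tendsto_iff_norm_sub_tendsto_zero.1 hL
  have hm0 := tendsto_iff_norm_sub_tendsto_zero.1 hm
  rw [ContinuousAt, tendsto_iff_norm_sub_tendsto_zero]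
  refine squeeze_zero' (Filter.Eventually.of_forall fun _ => norm_nonneg _)
    (g := fun x => 2 * K * (‖L x (m x) - L x₀ (m x₀)‖ + ‖L x - L x₀‖ * ‖m x₀‖)) ?_ ?_
  -- Once `‖L x - L x₀‖ < 1/(2K)`, the error term containing `m x - m x₀` is at most half of the
  -- left-hand side and is absorbed there; hence the factor `2K` in the bound.
  · have hev : ∀ᶠ x in 𝓝 x₀, ‖L x - L x₀‖ < 1 / (2 * K) :=
      hL0.eventually (gt_mem_nhds (by positivity))
    filter_upwards [hev] with x hx
    have h1 := hbound (m x - m x₀)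
    have h2 : L x₀ (m x - m x₀) = (L x (m x) - L x₀ (m x₀))
        - (L x - L x₀) (m x - m x₀) - (L x - L x₀) (m x₀) := by
      simp only [map_sub, sub_apply]; abel
    have h3 : ‖L x₀ (m x - m x₀)‖ ≤ ‖L x (m x) - L x₀ (m x₀)‖
        + ‖L x - L x₀‖ * ‖m x - m x₀‖ + ‖L x - L x₀‖ * ‖m x₀‖ := by
      rw [h2]
      refine (norm_sub_le _ _).trans (add_le_add ((norm_sub_le _ _).trans
        (add_le_add le_rfl ?_)) ?_) <;> exact ContinuousLinearMap.le_opNorm _ _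
    have h4 : K * (‖L x - L x₀‖ * ‖m x - m x₀‖) ≤ ‖m x - m x₀‖ / 2 := by
      have : K * ‖L x - L x₀‖ ≤ 1 / 2 := by
        calc K * ‖L x - L x₀‖ ≤ K * (1 / (2 * K)) := by gcongr
          _ = 1 / 2 := by field_simp
      nlinarith [norm_nonneg (m x - m x₀)]
    have h5 := mul_le_mul_of_nonneg_left h3 hK'.le
    linarith
  · have := (hm0.add (hL0.mul_const ‖m x₀‖)).const_mul (2 * (K : ℝ))
    simpa using this

namespace DelzantPolytope

variable {d n : ℕ} (D : DelzantPolytope d n)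

/-- The infinitesimal action of `𝔨` at a point, as a linear map on `𝔨`. -/
def infK (z : Cn n) : D.lieK →L[ℝ] Cn n :=
  LinearMap.toContinuousLinearMap
    { toFun := fun l => Cn.inf l z
      map_add' := fun _ _ => Cn.inf_add _ _ _
      map_smul' := fun _ _ => Cn.inf_smul _ _ _ }

theorem infK_apply (z : Cn n) (l : D.lieK) : D.infK z l = Cn.inf l z := rfl

/-- The elements `m t` are only known pointwise. Since the infinitesimal action is injective at
points of the level, they depend continuously on `t`, and so they can be integrated to a path in
`𝔨`. -/
theorem exists_primitive {c Y : ℝ → Cn n} (hc : Continuous c) (hcl : ∀ t, c t ∈ D.level)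
    (hY : Continuous Y) {m : ℝ → D.lieK} (hm : ∀ t, Cn.inf (m t) (c t) = Y t) :
    ∃ g : ℝ → D.lieK, g 0 = 0 ∧ ∀ t, HasDerivAt g (m t) t := by
  have hmc : Continuous m := by
    rw [continuous_iff_continuousAt]
    intro t
    refine continuousAt_of_injective (L := fun t => D.infK (c t)) ?_ ?_ ?_
    · refine (continuous_clm_apply.2 fun l => continuous_pi fun k => ?_).continuousAt
      exact continuous_const.mul ((continuous_apply k).comp hc)
    · simp only [infK_apply, hm]; exact hY.continuousAt
    · rw [injective_iff_map_eq_zero]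
      intro l hl
      exact Subtype.ext (D.eq_zero_of_inf_eq_zero (hcl t) l.2 hl)
  refine ⟨fun t => ∫ u in (0 : ℝ)..t, m u, intervalIntegral.integral_same, fun t => ?_⟩
  exact intervalIntegral.integral_hasDerivAt_right (hmc.intervalIntegrable _ _)
    (hmc.stronglyMeasurableAtFilter _ _) hmc.continuousAt

theorem hasDerivAt_p {g : ℝ → D.lieK} {m : D.lieK} {t : ℝ} (hg : HasDerivAt g m t) :
    HasDerivAt (fun u => D.p (g u)) (D.p m) t :=
  (LinearMap.toContinuousLinearMap (D.p ∘ₗ D.lieK.subtype)).hasFDerivAt.comp_hasDerivAt t hg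

theorem hasDerivAt_coe {g : ℝ → D.lieK} {m : D.lieK} {t : ℝ} (hg : HasDerivAt g m t) :
    HasDerivAt (fun u => (g u : Fin n → ℝ)) (m : Fin n → ℝ) t :=
  D.lieK.subtypeL.hasFDerivAt.comp_hasDerivAt t hg

theorem proj_eq_iff {z w : D.level} :
    D.proj z = D.proj w ↔ ∃ l ∈ D.lieK₀, (w : Cn n) = Cn.rot l z := Quotient.eq

theorem moment_eq_p {z : Cn n} (hz : z ∈ D.level) {l : Fin n → ℝ} (hl : l ∈ D.lieK) :
    Cn.alpha z (Cn.inf l z) = D.p l := by rw [Cn.alpha_inf, hz l hl]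

theorem isTangent_inf (l : Fin n → ℝ) (z : Cn n) : D.IsTangent z (Cn.inf l z) := by
  intro m _
  have : ∀ k, m k * ((z k).re * (Cn.inf l z k).re + (z k).im * (Cn.inf l z k).im) = 0 := by
    intro k; simp [Cn.inf]; ring_nf; simp
  rw [Finset.sum_eq_zero fun k _ => this k, mul_zero]

theorem isReebVector_inf {z : Cn n} (hz : z ∈ D.level) {l : Fin n → ℝ} (hl : l ∈ D.lieK)
    (hp : D.p l = 1) : D.IsReebVector z (Cn.inf l z) :=
  ⟨D.isTangent_inf l z, by rw [D.moment_eq_p hz hl, hp], fun w hw => D.isTangent_iff.1 hw l hl⟩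

/-- Rotation along `b / p(b)` projects to the Reeb flow. In time `p(m)` it differs from rotation by
`m` by an element of `𝔨₀`, which is invisible in `V`. -/
theorem reebFlowsTo_rot {b : Fin n → ℝ} (hb : b ∈ D.lieK) (hb_pos : ∀ k, 0 < b k) (z : D.level)
    {m : Fin n → ℝ} (hm : m ∈ D.lieK) :
    D.ReebFlowsTo (D.proj z) (D.p m) (D.proj ⟨Cn.rot m z, D.rot_mem_level z.2 m⟩) := by
  have hp := D.p_pos hb_pos
  let μ : Fin n → ℝ := (D.p b)⁻¹ • b
  have hμ : μ ∈ D.lieK := D.lieK.smul_mem _ hb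
  have hpμ : D.p μ = 1 := by simp only [μ, map_smul, smul_eq_mul]; field_simp
  have hder (t : ℝ) : HasDerivAt (fun u : ℝ => Cn.rot (u • μ) (z : Cn n))
      (Cn.inf μ (Cn.rot (t • μ) z)) t := by
    have h1 : HasDerivAt (fun u : ℝ => u • μ) μ t := by
      simpa using (hasDerivAt_id t).smul_const μ
    have := Cn.hasDerivWithinAt_rot (s := Set.univ) h1.hasDerivWithinAt
      (hasDerivWithinAt_const t _ (z : Cn n))
    rw [hasDerivWithinAt_univ] at this
    rwa [zero_add, ← Cn.inf_rot] at this
  refine ⟨fun t => ⟨Cn.rot (t • μ) z, D.rot_mem_level z.2 _⟩, ?_, ?_, ?_, fun t => ?_⟩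
  · rw [contDiff_pi]
    intro k
    simp only [Cn.rot]
    refine ContDiff.mul (ContDiff.cexp (contDiff_const.mul ?_)) contDiff_const
    exact Complex.ofRealCLM.contDiff.comp (contDiff_id.mul contDiff_const)
  · congr 1; ext1; simp [Cn.rot_zero]
  · rw [D.proj_eq_iff]
    refine ⟨m - D.p m • μ, D.mem_lieK₀_iff.2 ⟨D.lieK.sub_mem hm (D.lieK.smul_mem _ hμ), ?_⟩, ?_⟩
    · rw [map_sub, map_smul, hpμ, smul_eq_mul, mul_one, sub_self]
    · rw [← Cn.rot_add, sub_add_cancel]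
  · rw [(hder t).deriv]
    exact D.isReebVector_inf (D.rot_mem_level z.2 _) hμ hpμ

/-- The given lift of the Reeb orbit is arbitrary, but its velocity is symplectically orthogonal to
the level, hence is an orbit direction `m t` with `p(m t) = 1`. Rotating the lift back by the
primitive of `m` makes it constant. -/
theorem ReebFlowsTo.exists_rot {D : DelzantPolytope d n} {q q' : D.V} {s : ℝ}
    (h : D.ReebFlowsTo q s q') {z : D.level} (hz : D.proj z = q) :
    ∃ m, ∃ _ : m ∈ D.lieK, D.p m = s ∧ D.proj ⟨Cn.rot m z, D.rot_mem_level z.2 m⟩ = q' := by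
  obtain ⟨c, hc, hc0, hcs, hR⟩ := h
  have hex (t : ℝ) : ∃ m : D.lieK,
      Cn.inf m (c t : Cn n) = deriv (fun u => (c u : Cn n)) t := by
    obtain ⟨m, hm, h⟩ := D.exists_eq_inf (hR t).2.2
    exact ⟨⟨m, hm⟩, h.symm⟩
  choose m hm using hex
  obtain ⟨g, hg0, hg⟩ := D.exists_primitive hc.continuous (fun t => (c t).2)
    (hc.continuous_deriv (by simp)) hm
  have hpm (t : ℝ) : D.p (m t) = 1 := by
    rw [← D.moment_eq_p (c t).2 (m t).2, hm, (hR t).2.1]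
  have hpg (t : ℝ) : D.p (g t) = t := by
    have h1 (u : ℝ) : HasDerivAt (fun u => D.p (g u) - u) 0 u := by
      have := (D.hasDerivAt_p (hg u)).sub (hasDerivAt_id u)
      rw [hpm, sub_self] at this
      exact this
    have := is_const_of_deriv_eq_zero (fun u => (h1 u).differentiableAt) (fun u => (h1 u).deriv) t 0
    simp only [hg0] at this
    simpa [sub_eq_zero] using this
  have hrot (t : ℝ) : (c t : Cn n) = Cn.rot (g t) (c 0) := by
    have h1 (u : ℝ) : HasDerivAt (fun u => Cn.rot (-(g u : Fin n → ℝ)) (c u : Cn n)) 0 u := by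
      have h2 := ((hc.differentiable (by simp)) u).hasDerivAt
      have := Cn.hasDerivWithinAt_rot (s := Set.univ) (D.hasDerivAt_coe (hg u)).neg.hasDerivWithinAt
        h2.hasDerivWithinAt
      rw [hasDerivWithinAt_univ] at this
      refine this.congr_deriv ?_
      rw [← hm, ← Cn.inf_add, add_neg_cancel]
      funext k; simp [Cn.rot, Cn.inf]
    have := is_const_of_deriv_eq_zero (fun u => (h1 u).differentiableAt) (fun u => (h1 u).deriv) t 0
    simp only [hg0, ZeroMemClass.coe_zero, neg_zero, Cn.rot_zero] at this
    rw [← this, Cn.rot_rot_neg]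
  obtain ⟨l, hl, hl'⟩ := D.proj_eq_iff.1 (hc0.trans hz.symm)
  refine ⟨g s, (g s).2, hpg s, ?_⟩
  rw [← hcs, eq_comm, D.proj_eq_iff]
  refine ⟨l, hl, ?_⟩
  change Cn.rot (g s) (z : Cn n) = Cn.rot l (c s)
  rw [hrot s, hl', Cn.rot_comm]

variable {D} {b : Fin n → ℝ} {h : ℝ → D.V → ℝ} {H : ℝ → Cn n → ℝ}

/-- The Hamiltonian vector field of a lift differs from any lift of the contact vector field by a
radial vector and a vector tangent to the `𝕂₀`-orbit. -/
theorem IsContactVector.hamVF_eq (hb : b ∈ D.lieK) (hb_pos : ∀ k, 0 < b k)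
    (hH : D.IsHamiltonianLift b h H) {t : ℝ} (ht : t ∈ Set.Icc (0 : ℝ) 1) {z : D.level} {X : Cn n}
    (hX : D.IsContactVector (h t) z X) :
    ∃ m : D.lieK, D.p m = 0 ∧ Cn.inf m (z : Cn n) =
      hamVF H t z - X - (Cn.dot (hamVF H t z - X) z / Cn.dot (z : Cn n) z) • (z : Cn n) := by
  have hC := hH.isConic hb_pos
  have hz0 := D.ne_zero_of_mem_level hb hb_pos z.2
  obtain ⟨hXt, hXa, df, hdf, R, hR, hXR⟩ := hX
  have hdH : HasFDerivWithinAt (D.pull (h t)) (fderiv ℝ (H t) z) D.level z :=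
    (hC.differentiableAt ht hz0).hasFDerivAt.hasFDerivWithinAt.congr'
      (fun w hw => (hH.eq_pull hb hb_pos ht hw).symm) z.2
  -- On tangent vectors `ω(X_H - X, ·) = -df(R) α`, and `ω(z, ·) = 2α`; the multiple of `z` is
  -- chosen to cancel this.
  obtain ⟨m, hm, hmY⟩ := D.exists_eq_inf (z := z)
    (Y := hamVF H t z - X + ((1 / 2) * df R) • (z : Cn n)) (fun w hw => by
      rw [Cn.omega_add_left, Cn.omega_sub_left, Cn.omega_smul_left, omega_hamVF, hXR w hw,
        D.fderiv_eq_on_tangent z.2 hdH hdf hw, Cn.alpha_eq]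
      ring)
  -- Infinitesimal rotations are orthogonal to `z`, so the scalar product recovers `df(R)` from the
  -- fields themselves. In this form the coefficient is continuous along a curve.
  have hdot : Cn.dot (hamVF H t z - X) z = -((1 / 2) * df R) * Cn.dot (z : Cn n) z := by
    have h1 := Cn.dot_inf m (z : Cn n)
    rw [← hmY, Cn.dot_add_left, Cn.dot_smul_left] at h1
    linarith
  refine ⟨⟨m, hm⟩, ?_, ?_⟩
  -- Here `p(m) = α(Y) = α(X_H) - α(X)`, and `α(X_H) = dH(z)/2 = H` by Euler's relation. Since `H`
  -- restricts to `h`, the difference is zero.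
  · rw [← D.moment_eq_p z.2 hm, ← hmY]
    have h2 : D.pull (h t) z = h t (D.proj z) := dif_pos z.2
    rw [Cn.alpha_eq, Cn.omega_add_right, Cn.omega_smul_right, Cn.omega_self, Cn.omega_sub_right,
      Cn.omega_swap _ (hamVF H t z), omega_hamVF, hC.fderiv_self ht hz0,
      hH.eq_pull hb hb_pos ht z.2, h2, ← hXa, Cn.alpha_eq]
    ring
  · rw [hdot, mul_div_cancel_right₀ _ (Cn.dot_self_pos hz0).ne', neg_smul, sub_neg_eq_add, hmY]

open Set in
/-- The Hamiltonian isotopy of a lift covers the contact isotopy up to rescaling. -/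
theorem IsContactIsotopy.exists_smul_mem_level {φ : ℝ → D.V → D.V} (hφ : D.IsContactIsotopy h φ)
    (hb : b ∈ D.lieK) (hb_pos : ∀ k, 0 < b k) (hH : D.IsHamiltonianLift b h H)
    {Φ : ℝ → Equiv.Perm (Cn n)} (hΦ : IsHamiltonianIsotopy H Φ) (z : D.level) :
    ∃ r : ℝ, 0 < r ∧ ∃ hr : r • Φ 1 z ∈ D.level, D.proj ⟨r • Φ 1 z, hr⟩ = φ 1 (D.proj z) := by
  have hC := hH.isConic hb_pos
  obtain ⟨hφ0, c, hc, hcφ⟩ := hφ (D.proj z)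
  have hc0 : D.proj z = D.proj (c 0) := by
    rw [(hcφ 0 ⟨le_rfl, zero_le_one⟩).1, hφ0]
  obtain ⟨l₀, hl₀, hcz⟩ := D.proj_eq_iff.1 hc0
  have hne (t : ℝ) : (c t : Cn n) ≠ 0 := D.ne_zero_of_mem_level hb hb_pos (c t).2
  let c' : ℝ → Cn n := fun t => derivWithin (fun u => (c u : Cn n)) (Icc 0 1) t
  let W : ℝ → Cn n := fun t => hamVF H t (c t) - c' t
  let κ : ℝ → ℝ := fun t => Cn.dot (W t) (c t) / Cn.dot (c t : Cn n) (c t)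
  have hcc : ContinuousOn (fun t => (c t : Cn n)) (Icc 0 1) := hc.continuousOn
  have hWc : ContinuousOn W (Icc 0 1) := by
    refine ContinuousOn.sub ?_ (hc.continuousOn_derivWithin (uniqueDiffOn_Icc one_pos) (by simp))
    exact hC.contDiffOn_hamVF.continuousOn.comp (f := fun t => (t, (c t : Cn n)))
      (continuousOn_id.prodMk hcc) fun t ht => ⟨ht, hne t⟩
  have hdotc {f g : ℝ → Cn n} (hf : ContinuousOn f (Icc 0 1)) (hg : ContinuousOn g (Icc 0 1)) :
      ContinuousOn (fun t => Cn.dot (f t) (g t)) (Icc 0 1) :=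
    Cn.contDiff_dot.continuous.comp_continuousOn (hf.prodMk hg)
  have hκc : ContinuousOn κ (Icc 0 1) :=
    (hdotc hWc hcc).div (hdotc hcc hcc) fun t _ => (Cn.dot_self_pos (hne t)).ne'
  have hex (t : Icc (0 : ℝ) 1) : ∃ m : D.lieK, D.p m = 0 ∧
      Cn.inf m (c t : Cn n) = W t - κ t • (c t : Cn n) :=
    (hcφ t t.2).2.hamVF_eq hb hb_pos hH t.2
  choose m hpm hm using hex
  -- Clamping time to `[0,1]` extends all data continuously to `ℝ`, where primitives have two-sided
  -- derivatives.
  let P : ℝ → Icc (0 : ℝ) 1 := projIcc 0 1 zero_le_one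
  have hP : Continuous P := continuous_projIcc
  have hPt {t : ℝ} (ht : t ∈ Icc (0 : ℝ) 1) : P t = ⟨t, ht⟩ := projIcc_of_mem _ ht
  have hext {E : Type} [TopologicalSpace E] {f : ℝ → E} (hf : ContinuousOn f (Icc 0 1)) :
      Continuous fun t => f (P t) :=
    (continuousOn_iff_continuous_domRestrict.1 hf).comp hP
  obtain ⟨g, hg0, hg⟩ := D.exists_primitive (c := fun t => c (P t)) (m := fun t => m (P t))
    (hext hcc) (fun t => (c _).2) (hext (hWc.sub (hκc.smul hcc))) (fun t => hm (P t))
  have hpg (t : ℝ) : D.p (g t) = 0 := by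
    have h1 (u : ℝ) : HasDerivAt (fun u => D.p (g u)) 0 u := by
      simpa only [hpm] using D.hasDerivAt_p (hg u)
    have := is_const_of_deriv_eq_zero (fun u => (h1 u).differentiableAt) (fun u => (h1 u).deriv) t 0
    simpa [hg0] using this
  have hgK (t : ℝ) : (g t : Fin n → ℝ) ∈ D.lieK₀ := D.mem_lieK₀_iff.2 ⟨(g t).2, hpg t⟩
  let k : ℝ → ℝ := fun t => ∫ u in (0 : ℝ)..t, κ (P u)
  have hκP : Continuous fun t => κ (P t) := hext hκc
  have hk (t : ℝ) : HasDerivAt k (κ (P t)) t :=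
    intervalIntegral.integral_hasDerivAt_right (hκP.intervalIntegrable _ _)
      (hκP.stronglyMeasurableAtFilter _ _) hκP.continuousAt
  -- Rescaling by `exp k` supplies the missing radial component `κ c`, and rotation by `g` the
  -- missing component along the `𝕂₀`-orbit. As the field is homogeneous and `𝕂₀`-invariant, the
  -- corrected curve is an integral curve of it.
  let y : ℝ → Cn n := fun t => Real.exp (k t) • Cn.rot (g t) (c t)
  have hy0 : y 0 = c 0 := by simp [y, k, hg0, Cn.rot_zero]
  have hy : ∀ t ∈ Icc (0 : ℝ) 1, HasDerivWithinAt y (hamVF H t (y t)) (Icc 0 1) t := by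
    intro t ht
    have h1 := ((hc.differentiableOn (by simp)) t ht).hasDerivWithinAt
    have h2 := Cn.hasDerivWithinAt_rot (D.hasDerivAt_coe (hg t)).hasDerivWithinAt h1
    have h3 := (hk t).exp.hasDerivWithinAt (s := Icc 0 1)
    refine (h3.smul h2).congr_deriv ?_
    have hrot : Cn.rot (g t) (c t : Cn n) ≠ 0 := fun h => hne t (Cn.rot_eq_zero.1 h)
    simp only [y]
    rw [hC.hamVF_smul ht hrot (Real.exp_pos _), hC.hamVF_rot ht (hne t) (hgK t)]
    have h4 := hm ⟨t, ht⟩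
    rw [hPt ht, h4, mul_smul, ← smul_add, ← Cn.rot_smul, ← Cn.rot_add_vec]
    congr 2
    simp only [W, c']
    abel
  have hend := hΦ.eq_of_hasDerivWithinAt hC (y := y) (hy0 ▸ hne 0) hy ⟨zero_le_one, le_rfl⟩
  rw [hy0, hcz, hΦ.map_rot hC ⟨zero_le_one, le_rfl⟩ hl₀] at hend
  have hend' : (Real.exp (k 1))⁻¹ • Φ 1 (z : Cn n) = Cn.rot (-l₀ + (g 1 : Fin n → ℝ)) (c 1) := by
    rw [← Cn.rot_neg_rot l₀ (Φ 1 (z : Cn n)), hend, Cn.rot_smul, smul_smul,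
      inv_mul_cancel₀ (Real.exp_ne_zero _), one_smul, ← Cn.rot_add]
  refine ⟨(Real.exp (k 1))⁻¹, by positivity, hend' ▸ D.rot_mem_level (c 1).2 _, ?_⟩
  rw [← (hcφ 1 ⟨zero_le_one, le_rfl⟩).1, eq_comm, D.proj_eq_iff]
  exact ⟨-l₀ + (g 1 : Fin n → ℝ), D.lieK₀.add_mem (D.lieK₀.neg_mem hl₀) (hgK 1), hend'⟩

end DelzantPolytope

/-! ### Generating functions of homogeneous maps. -/

namespace Cn

variable {n : ℕ}

theorem half_smul (z : Cn n) : (2⁻¹ : ℂ) • z = (2⁻¹ : ℝ) • z := by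
  funext k
  apply Complex.ext <;> simp

theorem hasDerivAt_rot_const {c : ℝ → Cn n} {c' : Cn n} {t : ℝ} (l : Fin n → ℝ)
    (hc : HasDerivAt c c' t) : HasDerivAt (fun u => rot l (c u)) (rot l c') t := by
  have h1 : HasFDerivAt (rot l) (LinearMap.toContinuousLinearMap (rotL l)) (c t) :=
    (LinearMap.toContinuousLinearMap (rotL l)).hasFDerivAt
  exact h1.comp_hasDerivAt t hc

end Cn

namespace IsGeneratingFunction

variable {n : ℕ} {f : Cn n → Cn n} {G : Cn n → ℝ}

theorem differentiable
    (hG : IsGeneratingFunction f G)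
    : Differentiable ℝ G := hG.1.differentiable one_ne_zero

theorem fderiv_apply
    (hG : IsGeneratingFunction f G)
    (z u : Cn n) :
    fderiv ℝ G ((2⁻¹ : ℝ) • (z + f z)) u = Cn.dot (Complex.I • (z - f z)) u :=
  (hG.2 _ _).1 ⟨z, Cn.half_smul _, rfl⟩ u

theorem exists_midpoint
    (hG : IsGeneratingFunction f G)
    (x : Cn n) : ∃ z, x = (2⁻¹ : ℝ) • (z + f z) := by
  obtain ⟨z, hz, -⟩ := (hG.2 x (Cn.grad (fderiv ℝ G x))).2 fun u => (Cn.dot_grad _ _).symm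
  exact ⟨z, by rw [← hz, Cn.half_smul]⟩

theorem eq_of_fderiv
    (hG : IsGeneratingFunction f G)
    {x y : Cn n} (h : ∀ u, fderiv ℝ G x u = Cn.dot y u) :
    ∃ z, x = (2⁻¹ : ℝ) • (z + f z) ∧ y = Complex.I • (z - f z) := by
  obtain ⟨z, hz, hz'⟩ := (hG.2 x y).2 h
  exact ⟨z, by rw [← hz, Cn.half_smul], hz'.symm⟩

/-- The graph of a homogeneous map is invariant under positive dilations, hence so is the graph of
`dG`. -/
theorem fderiv_smul
    (hG : IsGeneratingFunction f G)
    (hf : ∀ r : ℝ, 0 < r → ∀ z, f (r • z) = r • f z)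
    {r : ℝ} (hr : 0 < r) (x u : Cn n) :
    fderiv ℝ G (r • x) u = r * fderiv ℝ G x u := by
  obtain ⟨z, rfl⟩ := hG.exists_midpoint x
  have := hG.fderiv_apply (r • z) u
  rw [hf r hr, ← smul_add, ← smul_sub, smul_comm _ r, smul_comm _ r, Cn.dot_smul_left] at this
  rw [this, hG.fderiv_apply]

/-- Only `dG` is known to be homogeneous, and `G` is merely `C¹`. The function `G(s x) - (s²/2)
dG_x(x)` has zero derivative for `s > 0` and tends to `0` as `s → 0` because `G 0 = 0`; its value at
`s = 1` is the claim. -/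
theorem fderiv_self
    (hG : IsGeneratingFunction f G)
    (hf : ∀ r : ℝ, 0 < r → ∀ z, f (r • z) = r • f z)
    (h0 : G 0 = 0) (x : Cn n) : fderiv ℝ G x x = 2 * G x := by
  have hder (s : ℝ) : HasDerivAt (fun s : ℝ => G (s • x)) (fderiv ℝ G (s • x) x) s := by
    have h1 : HasDerivAt (fun s : ℝ => s • x) x s := by
      simpa using (hasDerivAt_id s).smul_const x
    exact (hG.differentiable (s • x)).hasFDerivAt.comp_hasDerivAt s h1
  have h2 (s : ℝ) : HasDerivAt (fun s : ℝ => s ^ 2 / 2 * fderiv ℝ G x x) (s * fderiv ℝ G x x) s := by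
    have := (((hasDerivAt_id s).pow 2).div_const 2).mul_const (fderiv ℝ G x x)
    refine this.congr_deriv ?_
    simp
  have hsub (s : ℝ) := (hder s).sub (h2 s)
  have hcont : Continuous (fun s : ℝ => G (s • x) - s ^ 2 / 2 * fderiv ℝ G x x) :=
    continuous_iff_continuousAt.2 fun s => (hsub s).continuousAt
  have hconst (s : ℝ) (hs : 0 < s) :
      G (s • x) - s ^ 2 / 2 * fderiv ℝ G x x = G x - fderiv ℝ G x x / 2 := by
    have := (convex_Ioi (0 : ℝ)).is_const_of_fderivWithin_eq_zero (𝕜 := ℝ)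
      (f := fun s : ℝ => G (s • x) - s ^ 2 / 2 * fderiv ℝ G x x)
      (fun s _ => (hsub s).differentiableAt.differentiableWithinAt) (fun s hs => by
        rw [fderivWithin_of_isOpen isOpen_Ioi hs]
        ext
        have := (hsub s).deriv
        rw [hG.fderiv_smul hf hs, sub_self] at this
        simpa using! this) hs (Set.mem_Ioi.2 one_pos : (1 : ℝ) ∈ Set.Ioi 0)
    rw [this, one_smul]
    ring
  have hlim : Filter.Tendsto (fun s : ℝ => G (s • x) - s ^ 2 / 2 * fderiv ℝ G x x)
      (nhdsWithin 0 (Set.Ioi 0)) (nhds 0) := by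
    have := (hcont.tendsto 0).mono_left (nhdsWithin_le_nhds (s := Set.Ioi 0))
    simpa [h0] using this
  have hlim' : Filter.Tendsto (fun s : ℝ => G (s • x) - s ^ 2 / 2 * fderiv ℝ G x x)
      (nhdsWithin 0 (Set.Ioi 0)) (nhds (G x - fderiv ℝ G x x / 2)) := by
    refine Filter.Tendsto.congr' ?_ tendsto_const_nhds
    filter_upwards [self_mem_nhdsWithin] with s hs
    exact (hconst s hs).symm
  have := tendsto_nhds_unique hlim hlim'
  linarith

/-- A homogeneous map that has a generating function preserves `α_std`. -/
theorem omega_eq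
    (hG : IsGeneratingFunction f G)
    (hf : ∀ r : ℝ, 0 < r → ∀ z, f (r • z) = r • f z)
    (h0 : G 0 = 0) {c : ℝ → Cn n} {c' e' : Cn n} {t : ℝ} (hc : HasDerivAt c c' t)
    (he : HasDerivAt (fun u => f (c u)) e' t) :
    Cn.omega (f (c t)) e' = Cn.omega (c t) c' := by
  -- By Euler's relation `G` at the midpoint of `z` and `f z` is `ω(z, f z)/2`. Differentiating this
  -- along `c`, once through `dG` and once through `ω`, leaves the equality of the two values of
  -- `α_std`. The map `f` is never differentiated, only the image curve is.
  have hG' (z : Cn n) : G ((2⁻¹ : ℝ) • (z + f z)) = (1 / 2) * Cn.omega z (f z) := by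
    have h1 := hG.fderiv_self hf h0 ((2⁻¹ : ℝ) • (z + f z))
    rw [hG.fderiv_apply, ← Cn.omega_eq_dot, Cn.omega_smul_right, Cn.omega_add_right,
      Cn.omega_sub_left, Cn.omega_sub_left, Cn.omega_self, Cn.omega_self,
      Cn.omega_swap (f z) z] at h1
    linarith
  have h1 : HasDerivAt (fun u => (2⁻¹ : ℝ) • (c u + f (c u))) ((2⁻¹ : ℝ) • (c' + e')) t :=
    (hc.fun_add he).fun_const_smul _
  have h2 := (hG.differentiable ((2⁻¹ : ℝ) • (c t + f (c t)))).hasFDerivAt.comp_hasDerivAt t h1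
  have h3 : HasDerivAt (fun u => (1 / 2 : ℝ) * Cn.omega (c u) (f (c u)))
      ((1 / 2 : ℝ) * (Cn.omega c' (f (c t)) + Cn.omega (c t) e')) t := by
    have := Cn.hasDerivWithinAt_omega (s := Set.univ) hc.hasDerivWithinAt he.hasDerivWithinAt
    rw [hasDerivWithinAt_univ] at this
    exact this.const_mul _
  have h4 : (G ∘ fun u => (2⁻¹ : ℝ) • (c u + f (c u)))
      = fun u => (1 / 2 : ℝ) * Cn.omega (c u) (f (c u)) := funext fun u => hG' (c u)
  rw [h4] at h2
  have h5 := h2.unique h3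
  rw [hG.fderiv_apply, ← Cn.omega_eq_dot, Cn.omega_smul_right, Cn.omega_add_right,
      Cn.omega_sub_left, Cn.omega_sub_left, Cn.omega_swap (f (c t)) c'] at h5
  linarith

end IsGeneratingFunction

section Pieces

variable {n d : ℕ} {D : DelzantPolytope d n} {H : ℝ → Cn n → ℝ} {Φ : ℝ → Equiv.Perm (Cn n)}
  {N₁ : ℕ} {G : ℕ → Cn n → ℝ}

theorem div_mem_Icc {j : ℕ} (hN₁ : 0 < N₁) (hj : j ≤ 2 * N₁) :
    (j : ℝ) / (2 * N₁) ∈ Set.Icc (0 : ℝ) 1 := by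
  have h1 : (0 : ℝ) < 2 * N₁ := by positivity
  have h2 : (j : ℝ) ≤ 2 * N₁ := by exact_mod_cast hj
  exact ⟨by positivity, (div_le_one h1).2 h2⟩

theorem pieceOf_apply (Φ : ℝ → Equiv.Perm (Cn n)) (N₁ j : ℕ) (z : Cn n) :
    pieceOf Φ N₁ j (Φ ((j : ℝ) / (2 * N₁)) z) = Φ (((j + 1 : ℕ) : ℝ) / (2 * N₁)) z := by
  rw [pieceOf, Equiv.symm_apply_apply]; push_cast; rfl

theorem pieceOf_smul (hΦ : IsHamiltonianIsotopy H Φ) (hC : D.IsConicHamiltonian H)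
    (hN₁ : 0 < N₁) {j : ℕ} (hj : j < 2 * N₁) {r : ℝ} (hr : 0 < r) (z : Cn n) :
    pieceOf Φ N₁ j (r • z) = r • pieceOf Φ N₁ j z := by
  obtain ⟨w, rfl⟩ := (Φ ((j : ℝ) / (2 * N₁))).surjective z
  rw [← hΦ.map_smul hC (div_mem_Icc hN₁ hj.le) hr, pieceOf_apply, pieceOf_apply,
    hΦ.map_smul hC (div_mem_Icc hN₁ hj) hr]

/-- Each piece preserves `α_std` because it has a generating function. The images of the line `z + u
w` under `Φ^{j/2N₁}` are differentiable at `u = 0` and are carried to one another by the pieces, so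
induction on `j` applies. -/
theorem omega_fderiv_flow (hΦ : IsHamiltonianIsotopy H Φ) (hC : D.IsConicHamiltonian H)
    (hN₁ : 0 < N₁)
    (hG : ∀ j < 2 * N₁, IsGeneratingFunction (pieceOf Φ N₁ j) (G j) ∧ G j 0 = 0)
    {z : Cn n} (hz : z ≠ 0) (w : Cn n) :
    Cn.omega (Φ 1 z) (fderiv ℝ (Φ 1) z w) = Cn.omega z w := by
  have hcurve : HasDerivAt (fun u : ℝ => z + u • w) w 0 := by
    simpa using ((hasDerivAt_id (0 : ℝ)).smul_const w).const_add z
  have hd {t : ℝ} (ht : t ∈ Set.Icc (0 : ℝ) 1) :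
      HasDerivAt (fun u : ℝ => Φ t (z + u • w)) (fderiv ℝ (Φ t) z w) 0 := by
    have h1 := ((hΦ.contDiffAt ht hz).differentiableAt (by simp)).hasFDerivAt
    rw [show z = z + (0 : ℝ) • w by simp] at h1
    simpa using! h1.comp_hasDerivAt (0 : ℝ) hcurve
  have key : ∀ j ≤ 2 * N₁, Cn.omega (Φ ((j : ℝ) / (2 * N₁)) z)
      (fderiv ℝ (Φ ((j : ℝ) / (2 * N₁))) z w) = Cn.omega z w := by
    intro j
    induction j with
    | zero =>
      intro _
      have h1 := hd (t := 0) ⟨le_rfl, zero_le_one⟩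
      simp only [hΦ.1] at h1
      simp only [Nat.cast_zero, zero_div, hΦ.1, h1.unique hcurve]
    | succ j ih =>
      intro hj
      rw [← ih (by omega)]
      have h1 := (hG j hj).1.omega_eq (fun r hr z => pieceOf_smul hΦ hC hN₁ hj hr z) (hG j hj).2
        (hd (div_mem_Icc hN₁ (show j ≤ 2 * N₁ by omega)))
        (e' := fderiv ℝ (Φ (((j + 1 : ℕ) : ℝ) / (2 * N₁))) z w) (by
          simp only [pieceOf_apply]
          exact hd (div_mem_Icc hN₁ hj))
      simpa only [pieceOf_apply, zero_smul, add_zero] using h1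
  have h2 := key (2 * N₁) le_rfl
  have h3 : ((2 * N₁ : ℕ) : ℝ) / (2 * N₁) = 1 := by
    push_cast
    exact div_self (by positivity)
  rwa [h3] at h2

end Pieces

/-! ### Independence of `α` from the lift of a curve. -/

open Topology in
theorem eventually_eq_zero_of_int {f : ℝ → ℝ} (hf : ContinuousAt f 0) (h0 : f 0 = 0)
    (h : ∀ᶠ u in 𝓝 0, ∃ m : ℤ, f u = m) : ∀ᶠ u in 𝓝 0, f u = 0 := by
  have h1 : ∀ᶠ u in 𝓝 (0 : ℝ), f u ∈ Set.Ioo (-1 : ℝ) 1 :=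
    hf.eventually_mem (by rw [h0]; exact Ioo_mem_nhds (by norm_num) (by norm_num))
  filter_upwards [h, h1] with u ⟨m, hm⟩ hu
  rw [hm] at hu ⊢
  have h2 : -1 < m := by exact_mod_cast hu.1
  have h3 : m < 1 := by exact_mod_cast hu.2
  have : m = 0 := by omega
  simp [this]

namespace DelzantPolytope

variable {d n : ℕ} {D : DelzantPolytope d n}

theorem beta_apply (l : Fin n → ℝ) (i : Fin d) : D.beta l i = ∑ j, l j * (D.v j i : ℝ) := rfl

open Topology in
-- The rotations `g` relating the two curves are chosen pointwise and need not be continuous. They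
-- are replaced by a path `γ`, continuous at `0`, that differs from `g` by integer vectors near `0`.
-- By rationality `p(γ)` is then integer valued, so it vanishes near `0`, and its derivative is half
-- the difference of the two sides.
theorem omega_eq_of_rot_eq (hD : D.IsRational) {c e : ℝ → Cn n} {c' e' : Cn n} {w : Cn n}
    (hw : w ∈ D.level) (hc0 : c 0 = w) (he0 : e 0 = w) (hc : HasDerivAt c c' 0)
    (he : HasDerivAt e e' 0) (h : ∀ u, ∃ g ∈ D.lieK₀, c u = Cn.rot g (e u)) :
    Cn.omega w c' = Cn.omega w e' := by
  obtain ⟨C, hC0, hC⟩ := D.exists_int_combination hw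
  choose g hgK hg using h
  rw [hasDerivAt_pi] at hc he
  let γ₀ : Fin n → ℝ → ℝ := fun k u =>
    if w k = 0 then 0 else (Complex.log (c u k / e u k)).im / (2 * Real.pi)
  -- Where `w_j ≠ 0` the principal logarithm of `c/e` gives the angle, differentiably at `0`. The
  -- other angles are filled in by the integral relations, which `g` also satisfies, so `γ - g` is
  -- integral in every coordinate.
  let γ : ℝ → Fin n → ℝ := fun u j => if w j = 0 then ∑ k, (C j k : ℝ) * γ₀ k u else γ₀ j u
  have hγ₀d (k) : HasDerivAt (γ₀ k)
      (if w k = 0 then 0 else ((c' k - e' k) / w k).im / (2 * Real.pi)) 0 := by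
    by_cases hk : w k = 0
    · simp only [γ₀, if_pos hk]; exact hasDerivAt_const _ _
    · simp only [γ₀, if_neg hk]
      have h1 : HasDerivAt (fun u => c u k / e u k) ((c' k - e' k) / w k) 0 := by
        refine ((hc k).div (he k) (by rw [he0]; exact hk)).congr_deriv ?_
        rw [hc0, he0]; field_simp
      have h2 : c 0 k / e 0 k = 1 := by rw [hc0, he0, div_self hk]
      have h3 := h1.clog_real (by rw [h2]; exact Complex.one_mem_slitPlane)
      rw [h2, div_one] at h3
      exact (Complex.imCLM.hasFDerivAt.comp_hasDerivAt (0 : ℝ) h3).div_const _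
  have hγ₀0 (k) : γ₀ k 0 = 0 := by
    by_cases hk : w k = 0
    · simp [γ₀, hk]
    · simp [γ₀, hk, hc0, he0]
  have hγc (j) : ContinuousAt (fun u => γ u j) 0 := by
    by_cases hj : w j = 0
    · simp only [γ, if_pos hj]
      exact tendsto_finsetSum _ fun k _ => (hγ₀d k).continuousAt.const_mul _
    · simp only [γ, if_neg hj]; exact (hγ₀d j).continuousAt
  have hγ0 : γ 0 = 0 := by
    funext j
    by_cases hj : w j = 0 <;> simp [γ, hj, hγ₀0]
  have hne : ∀ᶠ u in 𝓝 (0 : ℝ), ∀ k, w k ≠ 0 → e u k ≠ 0 := by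
    rw [Filter.eventually_all]
    intro k
    by_cases hk : w k = 0
    · simp [hk]
    · filter_upwards [(he k).continuousAt.eventually_ne (by rw [he0]; exact hk)] with u hu _ using hu
  have hint : ∀ᶠ u in 𝓝 (0 : ℝ), ∀ j, ∃ m : ℤ, γ u j - g u j = m := by
    filter_upwards [hne] with u hu
    have h1 (k) (hk : w k ≠ 0) : ∃ m : ℤ, γ₀ k u - g u k = m := by
      have h2 : c u k / e u k = Complex.exp (2 * Real.pi * Complex.I * (g u k : ℂ)) := by
        rw [hg u, Cn.rot, mul_div_cancel_right₀ _ (hu k hk)]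
      have h3 : ‖c u k / e u k‖ = 1 := by rw [h2, Cn.norm_exp_rot]
      have h4 : Complex.exp (2 * Real.pi * Complex.I * (γ₀ k u : ℂ)) = c u k / e u k := by
        have h5 : (2 * Real.pi * Complex.I * (γ₀ k u : ℂ)) = Complex.log (c u k / e u k) := by
          have hπ := Real.pi_pos.ne'
          apply Complex.ext
          · rw [Complex.log_re, h3, Real.log_one]; simp
          · simp only [γ₀, if_neg hk]
            rw [show (2 * Real.pi * Complex.I *
              (((Complex.log (c u k / e u k)).im / (2 * Real.pi) : ℝ) : ℂ))
                = (((Complex.log (c u k / e u k)).im : ℝ) : ℂ) * Complex.I by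
              have : (Real.pi : ℂ) ≠ 0 := Complex.ofReal_ne_zero.2 hπ
              push_cast
              field_simp]
            simp
        rw [h5, Complex.exp_log]
        rw [← norm_ne_zero_iff, h3]; exact one_ne_zero
      have h6 : Cn.rot (fun k => γ₀ k u) (e u) k = Cn.rot (g u) (e u) k := by
        rw [Cn.rot, Cn.rot, h4, h2]
      exact Cn.int_of_rot_eq (hu k hk) h6
    intro j
    by_cases hj : w j = 0
    · choose! m hm using h1
      refine ⟨∑ k, C j k * m k, ?_⟩
      simp only [γ, if_pos hj]
      rw [hC (g u) (D.mem_lieK₀_iff.1 (hgK u)).1 j hj, ← Finset.sum_sub_distrib]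
      push_cast
      refine Finset.sum_congr rfl fun k _ => ?_
      by_cases hk : w k = 0
      · simp [hC0 j k hk]
      · rw [← mul_sub, hm k hk]
    · simp only [γ, if_neg hj]; exact h1 j hj
  -- `β_Δ(γ) = β_Δ(γ - g)` is an integer vector, is continuous at `0` and vanishes there; so `γ`
  -- lies in `𝔨` near `0`.
  have hbeta : ∀ᶠ u in 𝓝 (0 : ℝ), ∀ i, D.beta (γ u) i = 0 := by
    rw [Filter.eventually_all]
    intro i
    refine eventually_eq_zero_of_int (f := fun u => D.beta (γ u) i) ?_ (by simp [hγ0]) ?_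
    · simp only [beta_apply]
      exact tendsto_finsetSum _ fun k _ => (hγc k).mul_const _
    · filter_upwards [hint] with u hu
      choose m hm using hu
      refine ⟨∑ j, m j * D.v j i, ?_⟩
      have h1 : D.beta (g u) i = 0 :=
        congrFun (D.mem_lieK_iff.1 (D.mem_lieK₀_iff.1 (hgK u)).1) i
      have h2 : D.beta (γ u) i = D.beta (γ u - g u) i := by
        rw [map_sub, Pi.sub_apply, h1, sub_zero]
      rw [h2, beta_apply]
      push_cast
      exact Finset.sum_congr rfl fun j _ => by rw [Pi.sub_apply, hm]
  -- Near `0` this is `p(γ u)` by the level equation at `w`. The formula involves only the nonzero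
  -- coordinates of `w`, which makes its derivative computable.
  let T : ℝ → ℝ := fun u => Real.pi * ∑ k, γ₀ k u * ‖w k‖ ^ 2
  have hTm (u) : T u = Cn.moment (γ u) w := by
    simp only [T, Cn.moment]
    congr 1
    refine Finset.sum_congr rfl fun k _ => ?_
    by_cases hk : w k = 0
    · simp [hk]
    · simp [γ, hk]
  have hTd : HasDerivAt T (Real.pi * ∑ k,
      (if w k = 0 then 0 else ((c' k - e' k) / w k).im / (2 * Real.pi)) * ‖w k‖ ^ 2) 0 :=
    (HasDerivAt.fun_sum fun k _ => (hγ₀d k).mul_const _).const_mul _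
  have hT : ∀ᶠ u in 𝓝 (0 : ℝ), T u = 0 := by
    refine eventually_eq_zero_of_int hTd.continuousAt (by simp [T, hγ₀0]) ?_
    filter_upwards [hint, hbeta] with u hu hβ
    have hK : γ u ∈ D.lieK := D.mem_lieK_iff.2 (funext hβ)
    have hgu := D.mem_lieK₀_iff.1 (hgK u)
    obtain ⟨m, hm⟩ := hD (γ u - g u) ⟨D.lieK.sub_mem hK hgu.1, hu⟩
    refine ⟨m, ?_⟩
    rw [hTm, hw _ hK, ← hm, map_sub, hgu.2, sub_zero]
  have hT0 := hTd.unique ((hasDerivAt_const (0 : ℝ) (0 : ℝ)).congr_of_eventuallyEq hT)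
  have hdiff : Cn.omega w (c' - e') = 2 * (Real.pi * ∑ k,
      (if w k = 0 then 0 else ((c' k - e' k) / w k).im / (2 * Real.pi)) * ‖w k‖ ^ 2) := by
    have hπ := Real.pi_pos.ne'
    simp only [Cn.omega, Finset.mul_sum]
    refine Finset.sum_congr rfl fun k _ => ?_
    by_cases hk : w k = 0
    · simp [hk]
    · rw [if_neg hk, Complex.div_im, Complex.sq_norm]
      have : Complex.normSq (w k) ≠ 0 := by simpa using hk
      field_simp
      simp
  rw [hT0, mul_zero, Cn.omega_sub_right] at hdiff
  linarith

/-- The value of `α_std` on the velocity of a curve in the level only depends on the projection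
of the curve to `V`. -/
theorem alpha_eq_of_proj_eq (hD : D.IsRational) {c e : ℝ → D.level} {c' e' : Cn n}
    (hc : HasDerivAt (fun u => (c u : Cn n)) c' 0) (he : HasDerivAt (fun u => (e u : Cn n)) e' 0)
    (h : ∀ u, D.proj (c u) = D.proj (e u)) : Cn.alpha (c 0) c' = Cn.alpha (e 0) e' := by
  obtain ⟨l, hl, hl'⟩ := D.proj_eq_iff.1 (h 0)
  have h1 := omega_eq_of_rot_eq hD (c := fun u => Cn.rot l (c u)) (e := fun u => (e u : Cn n))
    (w := e 0) (e 0).2 hl'.symm rfl (Cn.hasDerivAt_rot_const l hc) he (fun u => by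
      obtain ⟨m, hm, hm'⟩ := D.proj_eq_iff.1 (h u).symm
      exact ⟨l + m, D.lieK₀.add_mem hl hm, by rw [hm', ← Cn.rot_add]⟩)
  rw [Cn.alpha_eq, Cn.alpha_eq, ← h1, hl', Cn.omega_rot]

end DelzantPolytope

/-! ### The quadratic form of the twisted shift. -/

section Shift

variable {n M : ℕ}

theorem sum_twistedShift (ψ : Cn n → Cn n → ℝ) (hψ : ∀ a b, ψ (-a) (-b) = ψ a b)
    (z w : Fin M → Cn n) :
    ∑ j, ψ (twistedShift z j) (twistedShift w j) = ∑ j, ψ (z j) (w j) := by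
  cases M with
  | zero => simp
  | succ m =>
    rw [Fin.sum_univ_castSucc, Fin.sum_univ_succ (fun j => ψ (z j) (w j)), add_comm]
    congr 1
    · simp only [twistedShift, Fin.val_last, lt_irrefl, dif_neg, not_false_eq_true, hψ]
      rfl
    · refine Finset.sum_congr rfl fun j _ => ?_
      simp only [twistedShift, Fin.val_castSucc, add_lt_add_iff_right, j.2, dif_pos]
      rfl

/-- The discrete trajectory as a linear map. -/
def discretePathL (n M : ℕ) : (Fin M → Cn n) →ₗ[ℝ] (Fin M → Cn n) where
  toFun := discretePath
  map_add' x y := by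
    funext j
    simp only [discretePath, Pi.add_apply, smul_add, Finset.sum_add_distrib]
  map_smul' r x := by
    funext j
    simp only [discretePath, Pi.smul_apply, RingHom.id_apply, Finset.smul_sum]
    exact Finset.sum_congr rfl fun k _ => by rw [smul_comm _ r, smul_comm _ r]

/-- The twisted cyclic shift as a linear map. -/
def twistedShiftL (n M : ℕ) : (Fin M → Cn n) →ₗ[ℝ] (Fin M → Cn n) where
  toFun := twistedShift
  map_add' x y := by
    funext j
    simp only [twistedShift, Pi.add_apply]
    split_ifs
    · rfl
    · rw [neg_add]
  map_smul' r x := by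
    funext j
    simp only [twistedShift, Pi.smul_apply, RingHom.id_apply]
    split_ifs
    · rfl
    · rw [smul_neg]

theorem discretePath_add (x y : Fin M → Cn n) :
    discretePath (x + y) = discretePath x + discretePath y := (discretePathL n M).map_add x y

theorem discretePath_smul (r : ℝ) (x : Fin M → Cn n) :
    discretePath (r • x) = r • discretePath x := (discretePathL n M).map_smul r x

theorem twistedShift_add (x y : Fin M → Cn n) :
    twistedShift (x + y) = twistedShift x + twistedShift y := (twistedShiftL n M).map_add x y

theorem twistedShift_smul (r : ℝ) (x : Fin M → Cn n) :
    twistedShift (r • x) = r • twistedShift x := (twistedShiftL n M).map_smul r x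

theorem midpoint_discretePath (hM : Even M) (x : Fin M → Cn n) (j : Fin M) :
    (2⁻¹ : ℝ) • (discretePath x j + twistedShift (discretePath x) j) = x j := by
  rw [discretePath_add_twistedShift hM, smul_smul]
  norm_num

/-- In finite dimension the right inverse `discretePathL` of the midpoint map is also a left
inverse. -/
theorem discretePath_midpoint (hM : Even M) (z : Fin M → Cn n) :
    discretePath (fun j => (2⁻¹ : ℝ) • (z j + twistedShift z j)) = z := by
  have h1 : ((2⁻¹ : ℝ) • (1 + twistedShiftL n M)) * discretePathL n M = 1 := by
    refine LinearMap.ext fun x => funext fun j => ?_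
    exact midpoint_discretePath hM x j
  exact LinearMap.congr_fun (mul_eq_one_comm.1 h1) z

/-- The bilinear form of `𝒬`. -/
def shiftBilin (x u : Fin M → Cn n) : ℝ :=
  ∑ j, Cn.dot (Complex.I • (discretePath x j - twistedShift (discretePath x) j)) (u j)

theorem shiftForm_eq (x : Fin M → Cn n) : shiftForm x = (1 / 2) * shiftBilin x x := rfl

/-- Write `x_j` and `u_j` as midpoints of paths `z` and `w`. The terms `ω(z_j, w_j)` and `ω(z_{j+1},
w_{j+1})` cancel in the sum because the sign in the twist drops out of a bilinear form, and the
mixed terms are symmetric. Thus the gradient of `𝒬` is the stated one. -/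
theorem shiftBilin_comm (hM : Even M) (x u : Fin M → Cn n) : shiftBilin x u = shiftBilin u x := by
  have hexp (x u : Fin M → Cn n) : shiftBilin x u = 2⁻¹ *
      ∑ j, (Cn.omega (discretePath x j) (twistedShift (discretePath u) j)
        + Cn.omega (discretePath u j) (twistedShift (discretePath x) j)) := by
    have h1 := sum_twistedShift (fun a b => Cn.omega a b)
      (fun a b => by rw [Cn.omega_neg_left, Cn.omega_neg_right, neg_neg])
      (discretePath x) (discretePath u)
    have h2 : ∀ j, Cn.dot (Complex.I • (discretePath x j - twistedShift (discretePath x) j)) (u j)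
        = 2⁻¹ * (Cn.omega (discretePath x j) (twistedShift (discretePath u) j)
          + Cn.omega (discretePath u j) (twistedShift (discretePath x) j))
          + (2⁻¹ * Cn.omega (discretePath x j) (discretePath u j) -
            2⁻¹ * Cn.omega (twistedShift (discretePath x) j) (twistedShift (discretePath u) j)) := by
      intro j
      rw [← Cn.omega_eq_dot]
      conv_lhs => rw [← midpoint_discretePath hM u j]
      rw [Cn.omega_smul_right, Cn.omega_sub_left, Cn.omega_add_right, Cn.omega_add_right,
        Cn.omega_swap (discretePath u j)]
      ring
    rw [shiftBilin, Finset.sum_congr rfl fun j _ => h2 j, Finset.sum_add_distrib,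
      Finset.sum_sub_distrib, ← Finset.mul_sum, ← Finset.mul_sum, ← Finset.mul_sum, h1, sub_self,
      add_zero]
  rw [hexp, hexp]
  congr 1
  exact Finset.sum_congr rfl fun j _ => add_comm _ _

theorem shiftBilin_add_left (x y u : Fin M → Cn n) :
    shiftBilin (x + y) u = shiftBilin x u + shiftBilin y u := by
  simp only [shiftBilin, ← Finset.sum_add_distrib, discretePath_add, twistedShift_add]
  refine Finset.sum_congr rfl fun j _ => ?_
  rw [← Cn.dot_add_left, ← smul_add, Pi.add_apply, Pi.add_apply, add_sub_add_comm]

theorem shiftBilin_smul_left (r : ℝ) (x u : Fin M → Cn n) :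
    shiftBilin (r • x) u = r * shiftBilin x u := by
  simp only [shiftBilin, Finset.mul_sum, discretePath_smul, twistedShift_smul]
  refine Finset.sum_congr rfl fun j _ => ?_
  rw [← Cn.dot_smul_left, Pi.smul_apply, Pi.smul_apply, ← smul_sub, smul_comm]

theorem hasDerivAt_shiftForm (hM : Even M) (x u : Fin M → Cn n) :
    HasDerivAt (fun s : ℝ => shiftForm (x + s • u)) (shiftBilin x u) 0 := by
  have h1 (s : ℝ) : shiftForm (x + s • u) =
      shiftForm x + s * shiftBilin x u + s ^ 2 * shiftForm u := by
    simp only [shiftForm_eq, shiftBilin_add_left, shiftBilin_smul_left]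
    rw [shiftBilin_comm hM x (x + s • u), shiftBilin_comm hM u (x + s • u)]
    simp only [shiftBilin_add_left, shiftBilin_smul_left]
    rw [shiftBilin_comm hM u x]
    ring
  simp only [h1]
  have h2 := (((hasDerivAt_id (0 : ℝ)).mul_const (shiftBilin x u)).const_add (shiftForm x)).add
    (((hasDerivAt_id (0 : ℝ)).pow 2).mul_const (shiftForm u))
  simpa using! h2

theorem differentiable_shiftForm : Differentiable ℝ (shiftForm : (Fin M → Cn n) → ℝ) := by
  let A (j : Fin M) : (Fin M → Cn n) →ₗ[ℝ] Cn n :=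
    (LinearMap.proj j) ∘ₗ (discretePathL n M - twistedShiftL n M ∘ₗ discretePathL n M)
  have hA (j) : Differentiable ℝ (fun x => Complex.I • (A j x)) :=
    (LinearMap.toContinuousLinearMap (A j)).differentiable.const_smul Complex.I
  have hj (j : Fin M) : Differentiable ℝ fun x : Fin M → Cn n =>
      Cn.dot (Complex.I • (discretePath x j - twistedShift (discretePath x) j)) (x j) :=
    (Cn.contDiff_dot.differentiable (by simp)).comp ((hA j).prodMk (differentiable_apply j))
  exact (Differentiable.fun_sum fun j _ => hj j).const_mul _

end Shift

/-! ### The generating function of a small rotation. -/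

section Rotation

variable {n : ℕ}

theorem cos_pos_of_abs_lt {N₂ : ℕ} {x : ℝ} (hx : |x| < N₂) :
    0 < Real.cos (Real.pi * x / (2 * N₂)) := by
  have hN : (0 : ℝ) < N₂ := (abs_nonneg x).trans_lt hx
  have h1 := abs_lt.1 hx
  have hπ := Real.pi_pos
  refine Real.cos_pos_of_mem_Ioo ⟨?_, ?_⟩
  · rw [lt_div_iff₀ (by positivity)]; nlinarith
  · rw [div_lt_iff₀ (by positivity)]; nlinarith

/-- The gradient of `𝒯_l`, up to the factor `2`. -/
def tanDiag (N₂ : ℕ) (l : Fin n → ℝ) (x : Cn n) : Cn n :=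
  fun k => (Real.tan (Real.pi * l k / (2 * N₂)) : ℂ) * x k

theorem hasDerivAt_rotGen (N₂ : ℕ) (l : Fin n → ℝ) (x u : Cn n) :
    HasDerivAt (fun s : ℝ => rotGen N₂ l (x + s • u)) (Cn.dot ((2 : ℝ) • tanDiag N₂ l x) u) 0 := by
  have h1 (s : ℝ) : rotGen N₂ l (x + s • u) = rotGen N₂ l x
      + s * Cn.dot ((2 : ℝ) • tanDiag N₂ l x) u + s ^ 2 * rotGen N₂ l u := by
    simp only [rotGen, Cn.dot, Finset.mul_sum, ← Finset.sum_add_distrib]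
    refine Finset.sum_congr rfl fun k _ => ?_
    simp only [Complex.sq_norm, Complex.normSq_apply]
    simp only [Pi.add_apply, Pi.smul_apply, Complex.add_re, Complex.add_im, Complex.smul_re,
      Complex.smul_im, smul_eq_mul, tanDiag, Complex.re_ofReal_mul, Complex.im_ofReal_mul]
    ring
  simp only [h1]
  have h2 := (((hasDerivAt_id (0 : ℝ)).mul_const
    (Cn.dot ((2 : ℝ) • tanDiag N₂ l x) u)).const_add (rotGen N₂ l x)).add
    (((hasDerivAt_id (0 : ℝ)).pow 2).mul_const (rotGen N₂ l u))
  simpa using! h2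

theorem contDiff_norm_sq_apply (k : Fin n) : ContDiff ℝ ∞ (fun x : Cn n => ‖x k‖ ^ 2) := by
  have hre : ContDiff ℝ ∞ fun z : Cn n => (z k).re :=
    Complex.reCLM.contDiff.comp (contDiff_apply ℝ ℂ k)
  have him : ContDiff ℝ ∞ fun z : Cn n => (z k).im :=
    Complex.imCLM.contDiff.comp (contDiff_apply ℝ ℂ k)
  simp only [Complex.sq_norm, Complex.normSq_apply]
  exact (hre.mul hre).add (him.mul him)

theorem contDiff_rotGen (N₂ : ℕ) (l : Fin n → ℝ) : ContDiff ℝ ∞ (rotGen N₂ l) :=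
  ContDiff.sum fun k _ => contDiff_const.mul (contDiff_norm_sq_apply k)

theorem fderiv_rotGen (N₂ : ℕ) (l : Fin n → ℝ) (x u : Cn n) :
    fderiv ℝ (rotGen N₂ l) x u = Cn.dot ((2 : ℝ) • tanDiag N₂ l x) u := by
  have h1 : HasDerivAt (fun s : ℝ => x + s • u) u 0 := by
    simpa using ((hasDerivAt_id (0 : ℝ)).smul_const u).const_add x
  have h2 := ((contDiff_rotGen N₂ l).differentiable (by simp) x).hasFDerivAt
  rw [show x = x + (0 : ℝ) • u by simp] at h2
  have h3 := h2.comp_hasDerivAt (0 : ℝ) h1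
  simpa using h3.unique (hasDerivAt_rotGen N₂ l x u)

theorem rot_half_apply (N₂ : ℕ) (l : Fin n → ℝ) (z : Cn n) (k : Fin n) :
    Cn.rot ((2 * N₂ : ℝ)⁻¹ • l) z k =
      Complex.exp (((Real.pi * l k / (2 * N₂) : ℝ) : ℂ) * Complex.I) ^ 2 * z k := by
  rw [Cn.rot, ← Complex.exp_nat_mul]
  congr 2
  rw [Pi.smul_apply, smul_eq_mul]
  push_cast
  ring

theorem one_add_exp_sq (θ : ℝ) : 1 + Complex.exp (θ * Complex.I) ^ 2
    = 2 * (Real.cos θ : ℂ) * Complex.exp (θ * Complex.I) := by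
  rw [Complex.exp_mul_I, ← Complex.ofReal_cos, ← Complex.ofReal_sin]
  have h : ((Real.sin θ : ℂ)) ^ 2 + (Real.cos θ : ℂ) ^ 2 = 1 := by
    exact_mod_cast Real.sin_sq_add_cos_sq θ
  linear_combination (-1 : ℂ) * h + (Real.sin θ : ℂ) ^ 2 * Complex.I_sq

theorem I_mul_one_sub_exp_sq (θ : ℝ) : Complex.I * (1 - Complex.exp (θ * Complex.I) ^ 2)
    = 2 * (Real.sin θ : ℂ) * Complex.exp (θ * Complex.I) := by
  rw [Complex.exp_mul_I, ← Complex.ofReal_cos, ← Complex.ofReal_sin]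
  have h : ((Real.sin θ : ℂ)) ^ 2 + (Real.cos θ : ℂ) ^ 2 = 1 := by
    exact_mod_cast Real.sin_sq_add_cos_sq θ
  linear_combination (-Complex.I) * h
    - (Complex.I * (Real.sin θ : ℂ) ^ 2 + 2 * (Real.sin θ : ℂ) * (Real.cos θ : ℂ)) * Complex.I_sq

theorem midpoint_rot_apply (N₂ : ℕ) (l : Fin n → ℝ) (z : Cn n) (k : Fin n) :
    ((2⁻¹ : ℝ) • (z + Cn.rot ((2 * N₂ : ℝ)⁻¹ • l) z)) k =
      (Real.cos (Real.pi * l k / (2 * N₂)) : ℂ) *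
        Complex.exp (((Real.pi * l k / (2 * N₂) : ℝ) : ℂ) * Complex.I) * z k := by
  rw [Pi.smul_apply, Pi.add_apply, rot_half_apply, Complex.real_smul]
  push_cast
  have := one_add_exp_sq (Real.pi * l k / (2 * N₂))
  push_cast at this
  linear_combination (2⁻¹ : ℂ) * z k * this

/-- With `θ = π l_k / 2N₂` the rotation is by `2θ`. The midpoint is `cos θ e^{iθ} z_k` and `i(1 -
e^{2iθ}) z_k = 2 sin θ e^{iθ} z_k`, whose ratio is `2 tan θ`. The bound on `l` gives `cos θ ≠ 0`,
which also makes every `x` a midpoint. -/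
theorem isGeneratingFunction_rotGen {N₂ : ℕ} {l : Fin n → ℝ} (hl : ∀ k, |l k| < N₂) :
    IsGeneratingFunction (Cn.rot ((2 * N₂ : ℝ)⁻¹ • l)) (rotGen N₂ l) := by
  refine ⟨(contDiff_rotGen N₂ l).of_le (by exact_mod_cast le_top), fun x y => ?_⟩
  have hcos (k) : (Real.cos (Real.pi * l k / (2 * N₂)) : ℂ) ≠ 0 :=
    Complex.ofReal_ne_zero.2 (cos_pos_of_abs_lt (hl k)).ne'
  have htan (k) : (Real.tan (Real.pi * l k / (2 * N₂)) : ℂ)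
      = (Real.sin (Real.pi * l k / (2 * N₂)) : ℂ) / (Real.cos (Real.pi * l k / (2 * N₂)) : ℂ) := by
    rw [Real.tan_eq_sin_div_cos, Complex.ofReal_div]
  have hdiff (z : Cn n) : Complex.I • (z - Cn.rot ((2 * N₂ : ℝ)⁻¹ • l) z)
      = (2 : ℝ) • tanDiag N₂ l ((2⁻¹ : ℝ) • (z + Cn.rot ((2 * N₂ : ℝ)⁻¹ • l) z)) := by
    funext k
    rw [Pi.smul_apply, Pi.smul_apply, tanDiag, midpoint_rot_apply, Pi.sub_apply, rot_half_apply,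
      htan, Complex.real_smul, smul_eq_mul]
    have h1 := I_mul_one_sub_exp_sq (Real.pi * l k / (2 * N₂))
    have h2 := hcos k
    generalize (Real.cos (Real.pi * l k / (2 * N₂)) : ℂ) = C at *
    generalize (Real.sin (Real.pi * l k / (2 * N₂)) : ℂ) = S at *
    generalize Complex.exp (((Real.pi * l k / (2 * N₂) : ℝ) : ℂ) * Complex.I) = E at *
    field_simp
    push_cast
    linear_combination z k * h1
  simp only [fderiv_rotGen]
  constructor
  · rintro ⟨z, rfl, rfl⟩ u
    rw [Cn.half_smul, hdiff]
  · intro h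
    let z : Cn n := fun k => x k / ((Real.cos (Real.pi * l k / (2 * N₂)) : ℂ) *
        Complex.exp (((Real.pi * l k / (2 * N₂) : ℝ) : ℂ) * Complex.I))
    have hz : (2⁻¹ : ℝ) • (z + Cn.rot ((2 * N₂ : ℝ)⁻¹ • l) z) = x := by
      funext k
      rw [midpoint_rot_apply]
      exact mul_div_cancel₀ _ (mul_ne_zero (hcos k) (Complex.exp_ne_zero _))
    refine ⟨z, by rw [Cn.half_smul, hz], ?_⟩
    rw [hdiff, hz]
    exact Cn.eq_of_dot_eq h

end Rotation

/-! ### Discrete trajectories. -/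

variable {n : ℕ}

/-- The maps whose composition is `exp(l) Φ¹`. -/
def stepMap (Φ : ℝ → Equiv.Perm (Cn n)) (N₁ N₂ : ℕ) (l : Fin n → ℝ) (j : ℕ) : Cn n → Cn n :=
  if j < 2 * N₁ then pieceOf Φ N₁ j else Cn.rot ((2 * N₂ : ℝ)⁻¹ • l)

/-- The generating functions of the maps `stepMap`. -/
def stepGen (G : ℕ → Cn n → ℝ) (N₁ N₂ : ℕ) (l : Fin n → ℝ) (j : ℕ) : Cn n → ℝ :=
  if j < 2 * N₁ then G j else rotGen N₂ l

/-- The orbit of a point under the maps `stepMap`. -/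
def stepOrbit (Φ : ℝ → Equiv.Perm (Cn n)) (N₁ N₂ : ℕ) (l : Fin n → ℝ) (z : Cn n) : ℕ → Cn n
  | 0 => z
  | j + 1 => stepMap Φ N₁ N₂ l j (stepOrbit Φ N₁ N₂ l z j)

theorem genFamily_eq (G : ℕ → Cn n → ℝ) (N₁ N₂ : ℕ) (x : Fin (2 * (N₁ + N₂)) → Cn n)
    (l : Fin n → ℝ) :
    genFamily G N₁ N₂ (x, l) = shiftForm x - ∑ j : Fin (2 * (N₁ + N₂)), stepGen G N₁ N₂ l j (x j) := by
  simp only [genFamily, stepGen]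
  congr 1
  refine Finset.sum_congr rfl fun j _ => ?_
  split_ifs <;> rfl

/-- `x` is the sequence of midpoints of a closed discrete trajectory. -/
def IsTrajectory (Φ : ℝ → Equiv.Perm (Cn n)) (N₁ N₂ : ℕ) (l : Fin n → ℝ)
    (x : Fin (2 * (N₁ + N₂)) → Cn n) : Prop :=
  ∀ j, twistedShift (discretePath x) j = stepMap Φ N₁ N₂ l j (discretePath x j)

section Orbit

variable {d : ℕ} {D : DelzantPolytope d n} {H : ℝ → Cn n → ℝ} {Φ : ℝ → Equiv.Perm (Cn n)}
  {N₁ N₂ : ℕ} {l : Fin n → ℝ}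

theorem stepOrbit_flow (hΦ : IsHamiltonianIsotopy H Φ) (z : Cn n) :
    ∀ j ≤ 2 * N₁, stepOrbit Φ N₁ N₂ l z j = Φ ((j : ℝ) / (2 * N₁)) z := by
  intro j
  induction j with
  | zero => intro _; simp [stepOrbit, hΦ.1]
  | succ j ih =>
    intro hj
    rw [stepOrbit, ih (by omega), stepMap, if_pos (by omega), pieceOf_apply]

theorem stepOrbit_rot (hΦ : IsHamiltonianIsotopy H Φ) (hN₁ : 0 < N₁) (z : Cn n) (i : ℕ) :
    stepOrbit Φ N₁ N₂ l z (2 * N₁ + i) = Cn.rot ((i : ℝ) • (2 * N₂ : ℝ)⁻¹ • l) (Φ 1 z) := by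
  induction i with
  | zero =>
    rw [add_zero, stepOrbit_flow hΦ z _ le_rfl, Nat.cast_zero, zero_smul, Cn.rot_zero]
    congr 2
    push_cast
    exact div_self (by positivity)
  | succ i ih =>
    rw [← add_assoc, stepOrbit, ih, stepMap, if_neg (by omega), ← Cn.rot_add]
    congr 1
    push_cast
    module

theorem stepOrbit_end (hΦ : IsHamiltonianIsotopy H Φ) (hN₁ : 0 < N₁) (hN₂ : 0 < N₂) (z : Cn n) :
    stepOrbit Φ N₁ N₂ l z (2 * (N₁ + N₂)) = Cn.rot l (Φ 1 z) := by
  rw [mul_add, stepOrbit_rot hΦ hN₁, smul_smul]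
  push_cast
  rw [mul_inv_cancel₀ (by positivity), one_smul]

theorem stepOrbit_smul (hΦ : IsHamiltonianIsotopy H Φ) (hC : D.IsConicHamiltonian H)
    (hN₁ : 0 < N₁) {r : ℝ} (hr : 0 < r) (z : Cn n) (j : ℕ) :
    stepOrbit Φ N₁ N₂ l (r • z) j = r • stepOrbit Φ N₁ N₂ l z j := by
  rcases le_total j (2 * N₁) with hj | hj
  · rw [stepOrbit_flow hΦ _ j hj, stepOrbit_flow hΦ _ j hj, hΦ.map_smul hC (div_mem_Icc hN₁ hj) hr]
  · obtain ⟨i, rfl⟩ := Nat.exists_eq_add_of_le hj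
    rw [stepOrbit_rot hΦ hN₁, stepOrbit_rot hΦ hN₁, hΦ.map_smul hC ⟨zero_le_one, le_rfl⟩ hr,
      Cn.rot_smul]

theorem stepOrbit_map_rot (hΦ : IsHamiltonianIsotopy H Φ) (hC : D.IsConicHamiltonian H)
    (hN₁ : 0 < N₁) {m : Fin n → ℝ} (hm : m ∈ D.lieK₀) (z : Cn n) (j : ℕ) :
    stepOrbit Φ N₁ N₂ l (Cn.rot m z) j = Cn.rot m (stepOrbit Φ N₁ N₂ l z j) := by
  rcases le_total j (2 * N₁) with hj | hj
  · rw [stepOrbit_flow hΦ _ j hj, stepOrbit_flow hΦ _ j hj, hΦ.map_rot hC (div_mem_Icc hN₁ hj) hm]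
  · obtain ⟨i, rfl⟩ := Nat.exists_eq_add_of_le hj
    rw [stepOrbit_rot hΦ hN₁, stepOrbit_rot hΦ hN₁, hΦ.map_rot hC ⟨zero_le_one, le_rfl⟩ hm,
      Cn.rot_comm]

theorem IsTrajectory.discretePath_eq {x : Fin (2 * (N₁ + N₂)) → Cn n}
    (hx : IsTrajectory Φ N₁ N₂ l x) (j : Fin (2 * (N₁ + N₂))) :
    discretePath x j = stepOrbit Φ N₁ N₂ l (initialPoint x) j := by
  obtain ⟨j, hj⟩ := j
  induction j with
  | zero => rw [discretePath_zero, stepOrbit]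
  | succ j ih =>
    have h1 := hx ⟨j, by omega⟩
    rw [twistedShift, dif_pos hj, ih] at h1
    exact h1

/-- At the last index the twisted shift returns `-z₁`, while the composition of all steps is `exp(l)
Φ¹`. -/
theorem IsTrajectory.rot_flow {x : Fin (2 * (N₁ + N₂)) → Cn n} (hx : IsTrajectory Φ N₁ N₂ l x)
    (hΦ : IsHamiltonianIsotopy H Φ) (hN₁ : 0 < N₁) (hN₂ : 0 < N₂) :
    Cn.rot l (Φ 1 (initialPoint x)) = - initialPoint x := by
  have h1 := hx ⟨2 * (N₁ + N₂) - 1, by omega⟩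
  rw [hx.discretePath_eq, twistedShift, dif_neg (by simp only; omega), discretePath_zero] at h1
  rw [← stepOrbit_end hΦ hN₁ hN₂, h1]
  obtain ⟨k, hk⟩ : ∃ k, 2 * (N₁ + N₂) = k + 1 := ⟨2 * (N₁ + N₂) - 1, by omega⟩
  simp only [hk, stepOrbit, Nat.add_sub_cancel]

/-- The sequence of midpoints of the orbit of `z`. -/
def orbitMidpoints (Φ : ℝ → Equiv.Perm (Cn n)) (N₁ N₂ : ℕ) (l : Fin n → ℝ) (z : Cn n)
    (j : Fin (2 * (N₁ + N₂))) : Cn n :=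
  (2⁻¹ : ℝ) • (stepOrbit Φ N₁ N₂ l z j + stepOrbit Φ N₁ N₂ l z (j + 1))

theorem IsTrajectory.eq_orbitMidpoints {x : Fin (2 * (N₁ + N₂)) → Cn n}
    (hx : IsTrajectory Φ N₁ N₂ l x) : x = orbitMidpoints Φ N₁ N₂ l (initialPoint x) := by
  funext j
  rw [orbitMidpoints, stepOrbit, ← hx.discretePath_eq, ← hx j,
    midpoint_discretePath (even_two_mul _)]

theorem discretePath_orbitMidpoints (hΦ : IsHamiltonianIsotopy H Φ) (hN₁ : 0 < N₁) (hN₂ : 0 < N₂)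
    {z : Cn n} (hz : Cn.rot l (Φ 1 z) = -z) (j : Fin (2 * (N₁ + N₂))) :
    discretePath (orbitMidpoints Φ N₁ N₂ l z) j = stepOrbit Φ N₁ N₂ l z j ∧
      twistedShift (discretePath (orbitMidpoints Φ N₁ N₂ l z)) j
        = stepOrbit Φ N₁ N₂ l z (j + 1) := by
  have h1 (j : Fin (2 * (N₁ + N₂))) :
      twistedShift (fun j : Fin (2 * (N₁ + N₂)) => stepOrbit Φ N₁ N₂ l z j) j
        = stepOrbit Φ N₁ N₂ l z (j + 1) := by
    rw [twistedShift]
    split_ifs with h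
    · rfl
    · have hj : (j : ℕ) + 1 = 2 * (N₁ + N₂) := by omega
      rw [hj, stepOrbit_end hΦ hN₁ hN₂, hz, stepOrbit]
  have h2 : orbitMidpoints Φ N₁ N₂ l z = fun j : Fin (2 * (N₁ + N₂)) => (2⁻¹ : ℝ) • (stepOrbit Φ N₁ N₂ l z j
      + twistedShift (fun j : Fin (2 * (N₁ + N₂)) => stepOrbit Φ N₁ N₂ l z j) j) := by
    funext j; rw [h1, orbitMidpoints]
  rw [h2, discretePath_midpoint (even_two_mul _)]
  exact ⟨rfl, h1 j⟩

theorem isTrajectory_orbitMidpoints (hΦ : IsHamiltonianIsotopy H Φ) (hN₁ : 0 < N₁) (hN₂ : 0 < N₂)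
    {z : Cn n} (hz : Cn.rot l (Φ 1 z) = -z) :
    IsTrajectory Φ N₁ N₂ l (orbitMidpoints Φ N₁ N₂ l z) := fun j => by
  obtain ⟨h1, h2⟩ := discretePath_orbitMidpoints hΦ hN₁ hN₂ hz j
  rw [h1, h2, stepOrbit]

theorem initialPoint_orbitMidpoints (hΦ : IsHamiltonianIsotopy H Φ) (hN₁ : 0 < N₁) (hN₂ : 0 < N₂)
    {z : Cn n} (hz : Cn.rot l (Φ 1 z) = -z) :
    initialPoint (orbitMidpoints Φ N₁ N₂ l z) = z := by
  rw [← discretePath_zero _ (by omega : 0 < 2 * (N₁ + N₂)),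
    (discretePath_orbitMidpoints hΦ hN₁ hN₂ hz _).1, stepOrbit]

end Orbit

/-! ### The differential of the generating family. -/

section Derivative

variable {d : ℕ} {D : DelzantPolytope d n} {H : ℝ → Cn n → ℝ} {Φ : ℝ → Equiv.Perm (Cn n)}
  {N₁ N₂ : ℕ} {l : Fin n → ℝ} {G : ℕ → Cn n → ℝ}

theorem isGeneratingFunction_step
    (hG : ∀ j < 2 * N₁, IsGeneratingFunction (pieceOf Φ N₁ j) (G j) ∧ G j 0 = 0)
    (hl : ∀ k, |l k| < N₂)
    (j : ℕ) :
    IsGeneratingFunction (stepMap Φ N₁ N₂ l j) (stepGen G N₁ N₂ l j) := by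
  unfold stepMap stepGen
  split_ifs with h
  · exact (hG j h).1
  · exact isGeneratingFunction_rotGen hl

theorem stepGen_zero
    (hG : ∀ j < 2 * N₁, IsGeneratingFunction (pieceOf Φ N₁ j) (G j) ∧ G j 0 = 0)
    (j : ℕ) : stepGen G N₁ N₂ l j 0 = 0 := by
  unfold stepGen
  split_ifs with h
  · exact (hG j h).2
  · simp [rotGen]

theorem differentiableAt_genFamily
    (hG : ∀ j < 2 * N₁, IsGeneratingFunction (pieceOf Φ N₁ j) (G j) ∧ G j 0 = 0)
    (hl : ∀ k, |l k| < N₂)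
    (x : Fin (2 * (N₁ + N₂)) → Cn n) :
    DifferentiableAt ℝ (genFamily G N₁ N₂) (x, l) := by
  have hxj (j : Fin (2 * (N₁ + N₂))) : DifferentiableAt ℝ
      (fun y : (Fin (2 * (N₁ + N₂)) → Cn n) × (Fin n → ℝ) => y.1 j) (x, l) :=
    DifferentiableAt.comp (g := fun z : Fin (2 * (N₁ + N₂)) → Cn n => z j) (f := Prod.fst) (x, l)
      (differentiableAt_apply j x) differentiableAt_fst
  change DifferentiableAt ℝ (fun y : (Fin (2 * (N₁ + N₂)) → Cn n) × (Fin n → ℝ) => shiftForm y.1 -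
    ∑ j : Fin (2 * (N₁ + N₂)), if (j : ℕ) < 2 * N₁ then G j (y.1 j) else rotGen N₂ y.2 (y.1 j)) (x, l)
  refine DifferentiableAt.fun_sub ?_ (DifferentiableAt.fun_sum fun j _ => ?_)
  · exact DifferentiableAt.comp (g := shiftForm) (f := Prod.fst) (x, l)
      (differentiable_shiftForm x) differentiableAt_fst
  · by_cases h : (j : ℕ) < 2 * N₁
    · simp only [if_pos h]
      exact DifferentiableAt.comp (x, l) ((hG j h).1.differentiable (x j)) (hxj j)
    · simp only [if_neg h]
      refine DifferentiableAt.fun_sum fun k _ => DifferentiableAt.fun_mul ?_ ?_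
      · have h0 : DifferentiableAt ℝ
            (fun y : (Fin (2 * (N₁ + N₂)) → Cn n) × (Fin n → ℝ) => y.2 k) (x, l) :=
          DifferentiableAt.comp (g := fun m : Fin n → ℝ => m k) (f := Prod.snd) (x, l)
            (differentiableAt_apply k l) differentiableAt_snd
        have h1 : DifferentiableAt ℝ (fun y : (Fin (2 * (N₁ + N₂)) → Cn n) × (Fin n → ℝ) =>
            Real.pi * y.2 k / (2 * N₂)) (x, l) := by
          simpa only [div_eq_mul_inv] using (h0.const_mul Real.pi).mul_const (2 * (N₂ : ℝ))⁻¹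
        exact DifferentiableAt.comp (g := Real.tan) (x, l)
          (Real.differentiableAt_tan.2 (cos_pos_of_abs_lt (hl k)).ne') h1
      · exact DifferentiableAt.comp (g := fun z : Cn n => ‖z k‖ ^ 2) (x, l)
          ((contDiff_norm_sq_apply k).differentiable (by simp) (x j)) (hxj j)

theorem fderiv_genFamily_fst
    (hG : ∀ j < 2 * N₁, IsGeneratingFunction (pieceOf Φ N₁ j) (G j) ∧ G j 0 = 0)
    (hl : ∀ k, |l k| < N₂)
    (x u : Fin (2 * (N₁ + N₂)) → Cn n) :
    fderiv ℝ (genFamily G N₁ N₂) (x, l) (u, 0) =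
      shiftBilin x u - ∑ j : Fin (2 * (N₁ + N₂)), fderiv ℝ (stepGen G N₁ N₂ l j) (x j) (u j) := by
  have h1 : HasDerivAt (fun s : ℝ => (x, l) + s • (u, (0 : Fin n → ℝ))) (u, 0) 0 := by
    simpa using ((hasDerivAt_id (0 : ℝ)).smul_const (u, (0 : Fin n → ℝ))).const_add (x, l)
  have h2 := (differentiableAt_genFamily hG hl x).hasFDerivAt
  rw [show (x, l) = (x, l) + (0 : ℝ) • (u, (0 : Fin n → ℝ)) by simp] at h2
  have h3 := h2.comp_hasDerivAt (0 : ℝ) h1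
  have h4 : genFamily G N₁ N₂ ∘ (fun s : ℝ => (x, l) + s • (u, (0 : Fin n → ℝ))) =
      fun s => shiftForm (x + s • u)
        - ∑ j : Fin (2 * (N₁ + N₂)), stepGen G N₁ N₂ l j (x j + s • u j) := by
    funext s
    simp only [Function.comp, Prod.smul_mk, Prod.mk_add_mk, smul_zero, add_zero]
    exact genFamily_eq G N₁ N₂ (x + s • u) l
  rw [h4] at h3
  have h5 (j : Fin (2 * (N₁ + N₂))) : HasDerivAt (fun s : ℝ => stepGen G N₁ N₂ l j (x j + s • u j))
      (fderiv ℝ (stepGen G N₁ N₂ l j) (x j) (u j)) 0 := by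
    have h6 : HasDerivAt (fun s : ℝ => x j + s • u j) (u j) 0 := by
      simpa using ((hasDerivAt_id (0 : ℝ)).smul_const (u j)).const_add (x j)
    have h7 := ((isGeneratingFunction_step hG hl j).differentiable (x j)).hasFDerivAt
    rw [show x j = x j + (0 : ℝ) • u j by simp] at h7
    simpa using! h7.comp_hasDerivAt (0 : ℝ) h6
  have h6 := (hasDerivAt_shiftForm (even_two_mul _) x u).fun_sub
    (HasDerivAt.fun_sum fun j (_ : j ∈ Finset.univ) => h5 j)
  simpa using h3.unique h6

theorem fderiv_genFamily_snd
    (hG : ∀ j < 2 * N₁, IsGeneratingFunction (pieceOf Φ N₁ j) (G j) ∧ G j 0 = 0)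
    (hl : ∀ k, |l k| < N₂)
    (x : Fin (2 * (N₁ + N₂)) → Cn n) (μ : Fin n → ℝ) :
    fderiv ℝ (genFamily G N₁ N₂) (x, l) (0, μ) =
      - ∑ j : Fin (2 * (N₁ + N₂)), if (j : ℕ) < 2 * N₁ then 0 else
        ∑ k, 1 / Real.cos (Real.pi * l k / (2 * N₂)) ^ 2 * (Real.pi * μ k / (2 * N₂))
          * ‖x j k‖ ^ 2 := by
  have h1 : HasDerivAt (fun s : ℝ => (x, l) + s • ((0 : Fin (2 * (N₁ + N₂)) → Cn n), μ)) (0, μ) 0 := by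
    simpa using ((hasDerivAt_id (0 : ℝ)).smul_const
      ((0 : Fin (2 * (N₁ + N₂)) → Cn n), μ)).const_add (x, l)
  have h2 := (differentiableAt_genFamily hG hl x).hasFDerivAt
  rw [show (x, l) = (x, l) + (0 : ℝ) • ((0 : Fin (2 * (N₁ + N₂)) → Cn n), μ) by simp] at h2
  have h3 := h2.comp_hasDerivAt (0 : ℝ) h1
  have h4 : genFamily G N₁ N₂ ∘ (fun s : ℝ => (x, l) + s • ((0 : Fin (2 * (N₁ + N₂)) → Cn n), μ)) =
      fun s => shiftForm x - ∑ j : Fin (2 * (N₁ + N₂)),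
        if (j : ℕ) < 2 * N₁ then G j (x j) else rotGen N₂ (l + s • μ) (x j) := by
    funext s
    simp [genFamily]
  rw [h4] at h3
  have h5 (j : Fin (2 * (N₁ + N₂))) : HasDerivAt (fun s : ℝ =>
      if (j : ℕ) < 2 * N₁ then G j (x j) else rotGen N₂ (l + s • μ) (x j))
      (if (j : ℕ) < 2 * N₁ then 0 else
        ∑ k, 1 / Real.cos (Real.pi * l k / (2 * N₂)) ^ 2 * (Real.pi * μ k / (2 * N₂))
          * ‖x j k‖ ^ 2) 0 := by
    split_ifs with h
    · exact hasDerivAt_const _ _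
    · refine HasDerivAt.fun_sum fun k _ => HasDerivAt.mul_const ?_ _
      have h6 : HasDerivAt (fun s : ℝ => Real.pi * (l + s • μ) k / (2 * N₂))
          (Real.pi * μ k / (2 * N₂)) 0 := by
        simpa using! ((((hasDerivAt_id (0 : ℝ)).mul_const (μ k)).const_add (l k)).const_mul
          Real.pi).div_const (2 * N₂ : ℝ)
      have h7 := Real.hasDerivAt_tan (cos_pos_of_abs_lt (hl k)).ne'
      rw [show Real.pi * l k / (2 * N₂) = Real.pi * (l + (0 : ℝ) • μ) k / (2 * N₂) by simp] at h7 ⊢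
      exact h7.comp (0 : ℝ) h6
  have h6 := (HasDerivAt.fun_sum fun j (_ : j ∈ Finset.univ) => h5 j).const_sub (shiftForm x)
  simpa using h3.unique h6

/-- Componentwise, the vanishing of the gradient says that `(x_j, i(z_j - z_{j+1}))` lies on the
graph of the differential of the `j`-th generating function. A pair of points is determined by its
midpoint and difference, so this is `z_{j+1} = Φ_j(z_j)`. -/
theorem fderiv_genFamily_fst_eq_zero_iff
    (hG : ∀ j < 2 * N₁, IsGeneratingFunction (pieceOf Φ N₁ j) (G j) ∧ G j 0 = 0)
    (hl : ∀ k, |l k| < N₂)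
    (x : Fin (2 * (N₁ + N₂)) → Cn n) :
    (∀ u, fderiv ℝ (genFamily G N₁ N₂) (x, l) (u, 0) = 0) ↔ IsTrajectory Φ N₁ N₂ l x := by
  simp only [fderiv_genFamily_fst hG hl, sub_eq_zero]
  constructor
  · intro h j
    have h1 : ∀ v, fderiv ℝ (stepGen G N₁ N₂ l j) (x j) v =
        Cn.dot (Complex.I • (discretePath x j - twistedShift (discretePath x) j)) v := by
      intro v
      have h2 := h (Pi.single j v)
      rw [shiftBilin, Finset.sum_eq_single j, Finset.sum_eq_single j, Pi.single_eq_same] at h2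
      · exact h2.symm
      · intro i _ hi; rw [Pi.single_eq_of_ne hi, map_zero]
      · simp
      · intro i _ hi; rw [Pi.single_eq_of_ne hi, Cn.dot_zero_right]
      · simp
    obtain ⟨z, hz, hz'⟩ := (isGeneratingFunction_step hG hl j).eq_of_fderiv h1
    have h3 := smul_right_injective _ Complex.I_ne_zero hz'
    have h4 : discretePath x j + twistedShift (discretePath x) j = z + stepMap Φ N₁ N₂ l j z := by
      rw [discretePath_add_twistedShift (even_two_mul _), hz, smul_smul]
      norm_num
    have h5 : discretePath x j = z := by
      have h6 : (2 : ℝ) • discretePath x j = (2 : ℝ) • z := by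
        rw [two_smul, two_smul]
        calc _ = (discretePath x j + twistedShift (discretePath x) j)
              + (discretePath x j - twistedShift (discretePath x) j) := by abel
          _ = _ := by rw [h3, h4]; abel
      exact smul_right_injective _ (two_ne_zero : (2 : ℝ) ≠ 0) h6
    rw [h5] at h4 ⊢
    exact add_left_cancel h4
  · intro h u
    refine Finset.sum_congr rfl fun j _ => ?_
    have h1 := (isGeneratingFunction_step hG hl j).fderiv_apply (discretePath x j) (u j)
    rw [← h j, midpoint_discretePath (even_two_mul _)] at h1
    exact h1.symm

theorem stepMap_smul
    (hΦ : IsHamiltonianIsotopy H Φ)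
    (hC : D.IsConicHamiltonian H)
    (hN₁ : 0 < N₁)
    (j : ℕ) (r : ℝ) (hr : 0 < r) (z : Cn n) :
    stepMap Φ N₁ N₂ l j (r • z) = r • stepMap Φ N₁ N₂ l j z := by
  unfold stepMap
  split_ifs with h
  · exact pieceOf_smul hΦ hC hN₁ h hr z
  · exact Cn.rot_smul _ _ _

theorem fderiv_genFamily_self
    (hG : ∀ j < 2 * N₁, IsGeneratingFunction (pieceOf Φ N₁ j) (G j) ∧ G j 0 = 0)
    (hl : ∀ k, |l k| < N₂)
    (hΦ : IsHamiltonianIsotopy H Φ)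
    (hC : D.IsConicHamiltonian H)
    (hN₁ : 0 < N₁)
    (x : Fin (2 * (N₁ + N₂)) → Cn n) :
    fderiv ℝ (genFamily G N₁ N₂) (x, l) (x, 0) = 2 * genFamily G N₁ N₂ (x, l) := by
  rw [fderiv_genFamily_fst hG hl, genFamily_eq, shiftForm_eq, mul_sub, Finset.mul_sum]
  congr 1
  · ring
  · exact Finset.sum_congr rfl fun j _ => (isGeneratingFunction_step hG hl j).fderiv_self
      (stepMap_smul hΦ hC hN₁ j) (stepGen_zero hG j) _

/-- On the rotation steps `|x_j^k| = cos(π l_k / 2N₂) |z₁^k|`: rotations preserve moduli, and the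
closing condition identifies those of `Φ¹(z₁)` and `z₁`. The squared cosine cancels the derivative
of the tangent, and the `2N₂` equal terms add up to the moment. -/
theorem IsTrajectory.fderiv_snd
    (hG : ∀ j < 2 * N₁, IsGeneratingFunction (pieceOf Φ N₁ j) (G j) ∧ G j 0 = 0)
    (hl : ∀ k, |l k| < N₂)
    (hΦ : IsHamiltonianIsotopy H Φ)
    (hN₁ : 0 < N₁)
    {x : Fin (2 * (N₁ + N₂)) → Cn n} (hx : IsTrajectory Φ N₁ N₂ l x)
    (hN₂ : 0 < N₂) (μ : Fin n → ℝ) :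
    fderiv ℝ (genFamily G N₁ N₂) (x, l) (0, μ) = - Cn.moment μ (initialPoint x) := by
  rw [fderiv_genFamily_snd hG hl]
  congr 1
  have h1 (k : Fin n) : ‖Φ 1 (initialPoint x) k‖ = ‖initialPoint x k‖ := by
    have := congrArg norm (congrFun (hx.rot_flow hΦ hN₁ hN₂) k)
    rwa [Cn.norm_rot_apply, Pi.neg_apply, norm_neg] at this
  have h2 (j : Fin (2 * (N₁ + N₂))) (hj : ¬ (j : ℕ) < 2 * N₁) (k : Fin n) : ‖x j k‖ ^ 2 =
      Real.cos (Real.pi * l k / (2 * N₂)) ^ 2 * ‖initialPoint x k‖ ^ 2 := by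
    obtain ⟨i, hi⟩ := Nat.exists_eq_add_of_le (not_lt.1 hj)
    have h3 : x j = (2⁻¹ : ℝ) • (discretePath x j
        + Cn.rot ((2 * N₂ : ℝ)⁻¹ • l) (discretePath x j)) := by
      have h4 := hx j
      rw [stepMap, if_neg hj] at h4
      rw [← h4, midpoint_discretePath (even_two_mul _)]
    have h5 : ‖discretePath x j k‖ = ‖initialPoint x k‖ := by
      rw [hx.discretePath_eq, hi, stepOrbit_rot hΦ hN₁, Cn.norm_rot_apply, h1]
    rw [h3, midpoint_rot_apply, norm_mul, norm_mul, Complex.norm_exp_ofReal_mul_I, h5,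
      Complex.norm_real, mul_one, mul_pow, Real.norm_eq_abs, sq_abs]
  have h3 : ∀ j : Fin (2 * (N₁ + N₂)), (if (j : ℕ) < 2 * N₁ then 0 else
        ∑ k, 1 / Real.cos (Real.pi * l k / (2 * N₂)) ^ 2 * (Real.pi * μ k / (2 * N₂))
          * ‖x j k‖ ^ 2) =
      if (j : ℕ) < 2 * N₁ then 0 else (2 * N₂ : ℝ)⁻¹ * Cn.moment μ (initialPoint x) := by
    intro j
    split_ifs with hj
    · rfl
    · rw [Cn.moment, Finset.mul_sum, Finset.mul_sum]
      refine Finset.sum_congr rfl fun k _ => ?_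
      rw [h2 j hj k]
      have := (cos_pos_of_abs_lt (hl k)).ne'
      have hN : (N₂ : ℝ) ≠ 0 := by positivity
      field_simp
  rw [Finset.sum_congr rfl fun j _ => h3 j]
  generalize Cn.moment μ (initialPoint x) = c
  rw [Fin.sum_univ_eq_sum_range (fun j => if j < 2 * N₁ then 0
      else (2 * N₂ : ℝ)⁻¹ * c), mul_add, Finset.sum_range_add,
    Finset.sum_eq_zero fun j hj => if_pos (Finset.mem_range.1 hj), zero_add,
    Finset.sum_congr rfl fun j _ => if_neg (by omega), Finset.sum_const, Finset.card_range,
    nsmul_eq_mul]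
  push_cast
  rw [← mul_assoc, mul_inv_cancel₀ (by positivity), one_mul]

end Derivative

/-! ### Regularity of zero and the critical points. -/

section Critical

variable {n d : ℕ} {D : DelzantPolytope d n} {H : ℝ → Cn n → ℝ} {Φ : ℝ → Equiv.Perm (Cn n)}
  {N₁ N₂ : ℕ} {l b : Fin n → ℝ} {G : ℕ → Cn n → ℝ} {Λ : Set (Fin n → ℝ)}

theorem orbitMidpoints_smul (hΦ : IsHamiltonianIsotopy H Φ) (hC : D.IsConicHamiltonian H)
    (hN₁ : 0 < N₁) {r : ℝ} (hr : 0 < r) (z : Cn n) (j : Fin (2 * (N₁ + N₂))) :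
    orbitMidpoints Φ N₁ N₂ l (r • z) j = r • orbitMidpoints Φ N₁ N₂ l z j := by
  rw [orbitMidpoints, stepOrbit_smul hΦ hC hN₁ hr, stepOrbit_smul hΦ hC hN₁ hr, ← smul_add,
    smul_comm, orbitMidpoints]

theorem orbitMidpoints_rot (hΦ : IsHamiltonianIsotopy H Φ) (hC : D.IsConicHamiltonian H)
    (hN₁ : 0 < N₁) {m : Fin n → ℝ} (hm : m ∈ D.lieK₀) (z : Cn n) (j : Fin (2 * (N₁ + N₂))) :
    orbitMidpoints Φ N₁ N₂ l (Cn.rot m z) j = Cn.rot m (orbitMidpoints Φ N₁ N₂ l z j) := by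
  rw [orbitMidpoints, stepOrbit_map_rot hΦ hC hN₁ hm, stepOrbit_map_rot hΦ hC hN₁ hm,
    ← Cn.rot_add_vec, ← Cn.rot_smul, orbitMidpoints]

theorem IsTrajectory.initialPoint_ne_zero (hΦ : IsHamiltonianIsotopy H Φ)
    (hC : D.IsConicHamiltonian H) (hN₁ : 0 < N₁) {x : Fin (2 * (N₁ + N₂)) → Cn n}
    (hx : IsTrajectory Φ N₁ N₂ l x) (hxS : x ∈ unitSphere n (2 * (N₁ + N₂))) :
    initialPoint x ≠ 0 := by
  intro h0
  -- Homogeneity with factor `2` forces the orbit of the origin to stay at the origin.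
  have h1 (j) : stepOrbit Φ N₁ N₂ l (0 : Cn n) j = 0 := by
    have h2 := stepOrbit_smul (N₂ := N₂) (l := l) hΦ hC hN₁ (two_pos : (0 : ℝ) < 2) (0 : Cn n) j
    rw [smul_zero, two_smul] at h2
    exact left_eq_add.1 h2
  have h2 (j) : x j = 0 := by
    rw [hx.eq_orbitMidpoints, h0, orbitMidpoints, h1, h1, add_zero, smul_zero]
  simp [unitSphere, h2] at hxS

theorem initialPoint_rot {M : ℕ} {m : Fin n → ℝ} {x x' : Fin M → Cn n}
    (h : ∀ j, x' j = Cn.rot m (x j)) : initialPoint x' = Cn.rot m (initialPoint x) := by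
  simp only [initialPoint, h]
  change _ = Cn.rotL m _
  rw [map_sum]
  exact Finset.sum_congr rfl fun k _ => (Cn.rot_smul _ _ _).symm

theorem DelzantPolytope.pos_of_mem_window (hl : l ∈ D.window N₂) : 0 < N₂ := by
  have h1 := hl.2 ⟨0, D.n_pos⟩
  exact_mod_cast (abs_nonneg _).trans_lt h1

/-- By Euler's relation the radial derivative is twice the value of `ℱ_N`, which is zero here; so
vanishing on the sphere's tangent space is vanishing in all `x`-directions. -/
theorem isTrajectory_of_fderiv_eq_zero
    (hΦ : IsHamiltonianIsotopy H Φ)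
    (hC : D.IsConicHamiltonian H)
    (hN₁ : 0 < N₁)
    (hG : ∀ j < 2 * N₁, IsGeneratingFunction (pieceOf Φ N₁ j) (G j) ∧ G j 0 = 0)
    (hl : ∀ k, |l k| < N₂) {x : Fin (2 * (N₁ + N₂)) → Cn n}
    (hx : x ∈ unitSphere n (2 * (N₁ + N₂))) (hF : genFamily G N₁ N₂ (x, l) = 0)
    (h : ∀ u, D.IsTangentDir x (u, 0) → fderiv ℝ (genFamily G N₁ N₂) (x, l) (u, 0) = 0) :
    IsTrajectory Φ N₁ N₂ l x := by
  rw [← fderiv_genFamily_fst_eq_zero_iff hG hl]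
  intro u
  let c : ℝ := ∑ j, Cn.dot (x j) (u j)
  have h1 : D.IsTangentDir x (u - c • x, 0) := by
    refine ⟨?_, D.lieK.zero_mem⟩
    simp only [Pi.sub_apply, Pi.smul_apply, Cn.dot_sub_right, Cn.dot_smul_right,
      Finset.sum_sub_distrib, ← Finset.mul_sum]
    rw [show ∑ j, Cn.dot (x j) (x j) = 1 from hx, mul_one, sub_self]
  have h2 : (u, (0 : Fin n → ℝ)) = (u - c • x, 0) + c • (x, 0) := by simp
  rw [h2, map_add, h _ h1, map_smul, fderiv_genFamily_self hG hl hΦ hC hN₁, hF]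
  simp

/-- Were the differential zero on the tangent space, `x` would be a trajectory with `z₁ ≠ 0`, but
then the derivative in the direction `b` is strictly negative. -/
theorem zeroIsRegularValue
    (hΦ : IsHamiltonianIsotopy H Φ)
    (hC : D.IsConicHamiltonian H)
    (hN₁ : 0 < N₁)
    (hG : ∀ j < 2 * N₁, IsGeneratingFunction (pieceOf Φ N₁ j) (G j) ∧ G j 0 = 0)
    (hb : b ∈ D.lieK) (hb_pos : ∀ k, 0 < b k) (hΛ : Λ ⊆ D.window N₂) :
    D.ZeroIsRegularValue G N₁ N₂ Λ := by
  rintro ⟨x, l⟩ ⟨hx, hlΛ, hF⟩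
  have hl := hΛ hlΛ
  refine ⟨differentiableAt_genFamily hG hl.2 x, ?_⟩
  by_contra! hcon
  have hT := isTrajectory_of_fderiv_eq_zero (D := D) hΦ hC hN₁ hG hl.2 hx hF fun u hu => hcon _ hu
  have h1 := hcon (0, b) ⟨by simp, hb⟩
  rw [hT.fderiv_snd hG hl.2 hΦ hN₁ (D.pos_of_mem_window hl), neg_eq_zero] at h1
  exact (Cn.moment_pos hb_pos (hT.initialPoint_ne_zero hΦ hC hN₁ hx)).ne' h1

/-- The critical points of `p̂_N` are the closed discrete trajectories that start on the cone over
the level. -/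
theorem isCriticalPoint_iff
    (hΦ : IsHamiltonianIsotopy H Φ)
    (hC : D.IsConicHamiltonian H)
    (hN₁ : 0 < N₁)
    (hG : ∀ j < 2 * N₁, IsGeneratingFunction (pieceOf Φ N₁ j) (G j) ∧ G j 0 = 0)
    (hb : b ∈ D.lieK) (hb_pos : ∀ k, 0 < b k) (hΛ : Λ ⊆ D.window N₂)
    {x : Fin (2 * (N₁ + N₂)) → Cn n} :
    D.IsCriticalPoint G N₁ N₂ Λ (x, l) ↔ x ∈ unitSphere n (2 * (N₁ + N₂)) ∧ l ∈ Λ ∧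
      IsTrajectory Φ N₁ N₂ l x ∧ ∃ r : ℝ, 0 < r ∧ r • initialPoint x ∈ D.level := by
  have hpb := D.p_pos hb_pos
  constructor
  · rintro ⟨⟨hx, hlΛ, hF⟩, hcrit⟩
    have hl := hΛ hlΛ
    have hN₂ := D.pos_of_mem_window hl
    have hT : IsTrajectory Φ N₁ N₂ l x := by
      refine isTrajectory_of_fderiv_eq_zero (D := D) hΦ hC hN₁ hG hl.2 hx hF fun u hu => ?_
      set A := fderiv ℝ (genFamily G N₁ N₂) (x, l) (u, 0)
      set B := fderiv ℝ (genFamily G N₁ N₂) (x, l) (0, b)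
      -- The combination `B u - A b` lies in the kernel of the differential, so `p` vanishes on it:
      -- `A p(b) = 0`, whence `A = 0`. This is the Lagrange condition without naming a multiplier.
      have h1 : (B • u, -A • b) = B • (u, (0 : Fin n → ℝ)) + (-A) • (0, b) := by simp
      have h2 := hcrit (B • u, -A • b) ⟨by
        simp only [Pi.smul_apply, Cn.dot_smul_right, ← Finset.mul_sum]
        rw [hu.1, mul_zero], D.lieK.smul_mem _ hb⟩ (by
        rw [h1, map_add, map_smul, map_smul, smul_eq_mul, smul_eq_mul]
        change B * A + -A * B = 0
        ring)
      simp only [map_smul, smul_eq_mul] at h2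
      simpa using (mul_eq_zero.1 h2).resolve_right hpb.ne'
    have hz0 := hT.initialPoint_ne_zero hΦ hC hN₁ hx
    have hmb := Cn.moment_pos hb_pos hz0
    refine ⟨hx, hlΛ, hT, _, D.sqrt_moment_pos hb_pos hz0, fun μ hμ => ?_⟩
    rw [Cn.moment_smul, Real.sq_sqrt (by positivity)]
    -- The same device in the `λ`-directions shows that the moments of `μ` and `b` at `z₁` are in
    -- the ratio `p(μ) : p(b)`; the chosen square root then scales `z₁` onto the level.
    have h3 := hcrit (0, Cn.moment b (initialPoint x) • μ - Cn.moment μ (initialPoint x) • b)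
      ⟨by simp, D.lieK.sub_mem (D.lieK.smul_mem _ hμ) (D.lieK.smul_mem _ hb)⟩ (by
      have h4 : ((0 : Fin (2 * (N₁ + N₂)) → Cn n),
          Cn.moment b (initialPoint x) • μ - Cn.moment μ (initialPoint x) • b) =
          Cn.moment b (initialPoint x) • (0, μ) - Cn.moment μ (initialPoint x) • (0, b) := by simp
      rw [h4, map_sub, map_smul, map_smul, hT.fderiv_snd hG hl.2 hΦ hN₁ hN₂,
        hT.fderiv_snd hG hl.2 hΦ hN₁ hN₂, smul_eq_mul, smul_eq_mul]
      ring)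
    simp only [map_sub, map_smul, smul_eq_mul] at h3
    field_simp
    linarith
  · rintro ⟨hx, hlΛ, hT, r, hr, hlev⟩
    have hl := hΛ hlΛ
    have hN₂ := D.pos_of_mem_window hl
    have hfst := (fderiv_genFamily_fst_eq_zero_iff hG hl.2 x).2 hT
    refine ⟨⟨hx, hlΛ, ?_⟩, ?_⟩
    · have h1 := fderiv_genFamily_self hG hl.2 hΦ hC hN₁ x
      rw [hfst] at h1
      linarith
    · rintro ⟨u, μ⟩ ⟨-, hμ⟩ h0
      have h1 : (u, μ) = (u, (0 : Fin n → ℝ)) + (0, μ) := by simp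
      dsimp only at h0 hμ ⊢
      rw [h1, map_add, hfst, zero_add, hT.fderiv_snd hG hl.2 hΦ hN₁ hN₂, neg_eq_zero] at h0
      rw [← hlev μ hμ, Cn.moment_smul, h0, mul_zero]

end Critical

/-! ### Closed trajectories and translated points. -/

namespace DelzantPolytope

variable {n d : ℕ} {D : DelzantPolytope d n}

theorem exists_level_rep (q : D.V) : ∃ z : D.level, D.proj z = q := Quotient.exists_rep q

theorem negV_proj (z : D.level) : D.negV (D.proj z) = D.proj ⟨-z, D.neg_mem_level z.2⟩ := rfl

theorem proj_congr {z w : Cn n} (hz : z ∈ D.level) (hw : w ∈ D.level) (h : z = w) :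
    D.proj ⟨z, hz⟩ = D.proj ⟨w, hw⟩ := by subst h; rfl

variable {b : Fin n → ℝ} {h : ℝ → D.V → ℝ} {φ : ℝ → D.V → D.V} {H : ℝ → Cn n → ℝ}
  {Φ : ℝ → Equiv.Perm (Cn n)} {N₁ : ℕ} {G : ℕ → Cn n → ℝ}

/-- Smooth curves of `V` are mapped to smooth curves by `g ∘ φ_h`, and `α` is multiplied by the
square of the factor which brings `Φ¹` back to the level. -/
theorem exists_image_curve (hb : b ∈ D.lieK) (hb_pos : ∀ k, 0 < b k)
    (hφ : D.IsContactIsotopy h φ) (hH : D.IsHamiltonianLift b h H)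
    (hΦ : IsHamiltonianIsotopy H Φ) (hN₁ : 0 < N₁)
    (hG : ∀ j < 2 * N₁, IsGeneratingFunction (pieceOf Φ N₁ j) (G j) ∧ G j 0 = 0)
    {c : ℝ → D.level} (hc : ContDiff ℝ ∞ fun u => (c u : Cn n)) :
    ∃ e : ℝ → D.level, ContDiff ℝ ∞ (fun u => (e u : Cn n)) ∧
      (∀ u, D.proj (e u) = D.negV (φ 1 (D.proj (c u)))) ∧
      ∃ ρ : ℝ, 0 < ρ ∧ (e 0 : Cn n) = -(ρ • Φ 1 (c 0)) ∧
        Cn.alpha (e 0) (deriv (fun u => (e u : Cn n)) 0)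
          = ρ ^ 2 * Cn.alpha (c 0) (deriv (fun u => (c u : Cn n)) 0) := by
  have hC := hH.isConic hb_pos
  have h1 : (1 : ℝ) ∈ Set.Icc (0 : ℝ) 1 := ⟨zero_le_one, le_rfl⟩
  have hc0 (u) : (c u : Cn n) ≠ 0 := D.ne_zero_of_mem_level hb hb_pos (c u).2
  let y : ℝ → Cn n := fun u => Φ 1 (c u)
  have hy0 (u) : y u ≠ 0 := hΦ.ne_zero h1 (hc0 u)
  have hpb := D.p_pos hb_pos
  have hy : ContDiff ℝ ∞ y := contDiff_iff_contDiffAt.2 fun u =>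
    (hΦ.contDiffAt h1 (hc0 u)).comp u hc.contDiffAt
  let f : ℝ → ℝ := fun u => Real.sqrt (D.p b / Cn.moment b (y u))
  have hf : ContDiff ℝ ∞ f := by
    refine ContDiff.sqrt (contDiff_const.div ((Cn.contDiff_moment b).comp hy) fun u =>
      (Cn.moment_pos hb_pos (hy0 u)).ne') fun u => ?_
    exact (div_pos hpb (Cn.moment_pos hb_pos (hy0 u))).ne'
  -- The rescaling supplied by the covering of `φ_h` has no a priori regularity in `u`. It must
  -- agree with radial projection to `S_p`, since the level lies in `S_p`, and this gives the smooth
  -- formula `f`.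
  have hlev (u) : ∃ hr : f u • y u ∈ D.level, D.proj ⟨f u • y u, hr⟩ = φ 1 (D.proj (c u)) := by
    obtain ⟨r, hr, hrl, hrφ⟩ := hφ.exists_smul_mem_level hb hb_pos hH hΦ (c u)
    have h2 : f u • y u = r • Φ 1 (c u : Cn n) := by
      have h3 := D.radialProj_of_mem_level hb hb_pos hrl
      rwa [D.radialProj_smul b hr] at h3
    exact ⟨h2 ▸ hrl, by rw [← hrφ]; exact proj_congr _ _ h2⟩
  choose hfl hfφ using hlev
  have hder : HasDerivAt (fun u => -(f u • y u)) (-(f 0 • deriv y 0 + deriv f 0 • y 0)) 0 :=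
    ((hf.differentiable (by simp) 0).hasDerivAt.fun_smul
      (hy.differentiable (by simp) 0).hasDerivAt).fun_neg
  have hyder : deriv y 0 = fderiv ℝ (Φ 1) (c 0) (deriv (fun u => (c u : Cn n)) 0) :=
    (((hΦ.contDiffAt h1 (hc0 0)).differentiableAt (by simp)).hasFDerivAt.comp_hasDerivAt (0 : ℝ)
      (hc.differentiable (by simp) 0).hasDerivAt).deriv
  refine ⟨fun u => ⟨-(f u • y u), D.neg_mem_level (hfl u)⟩, (hf.smul hy).neg, fun u => ?_, f 0,
    D.sqrt_moment_pos hb_pos (hy0 0), rfl, ?_⟩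
  · rw [← hfφ u, negV_proj]
  -- The derivative of the factor `f` contributes a multiple of `y 0`, which is killed by `ω(y 0,
  -- ·)`.
  · rw [hder.deriv, Cn.alpha_eq, Cn.alpha_eq, Cn.omega_neg_left, Cn.omega_neg_right,
      Cn.omega_smul_left, Cn.omega_add_right, Cn.omega_smul_right, Cn.omega_smul_right,
      Cn.omega_self, hyder, omega_fderiv_flow hΦ hC hN₁ hG (hc0 0)]
    ring

/-- A closed trajectory gives a translated point. -/
theorem isTranslatedPoint_of_rot_flow (hb : b ∈ D.lieK) (hb_pos : ∀ k, 0 < b k)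
    (hφ : D.IsContactIsotopy h φ) (hH : D.IsHamiltonianLift b h H)
    (hΦ : IsHamiltonianIsotopy H Φ) (hN₁ : 0 < N₁)
    (hG : ∀ j < 2 * N₁, IsGeneratingFunction (pieceOf Φ N₁ j) (G j) ∧ G j 0 = 0)
    {l : Fin n → ℝ} (hl : l ∈ D.lieK) (z : D.level) (hz : Cn.rot l (Φ 1 (z : Cn n)) = -z) :
    D.IsTranslatedPoint (D.negV ∘ φ 1) (D.proj z) (-(D.p l)) := by
  have hC := hH.isConic hb_pos
  have h1 : (1 : ℝ) ∈ Set.Icc (0 : ℝ) 1 := ⟨zero_le_one, le_rfl⟩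
  have hΦz : Φ 1 (z : Cn n) = -Cn.rot (-l) z := by
    rw [← Cn.rot_neg_rot l (Φ 1 (z : Cn n)), hz, Cn.rot_neg_vec]
  have hΦl : Φ 1 (z : Cn n) ∈ D.level := by
    rw [hΦz]; exact D.neg_mem_level (D.rot_mem_level z.2 _)
  constructor
  · obtain ⟨r, hr, hrl, hrφ⟩ := hφ.exists_smul_mem_level hb hb_pos hH hΦ z
    -- `Φ¹(z)` is already on the level, and a ray meets the level at most once, so the rescaling is
    -- trivial.
    obtain rfl := (D.smul_mem_level_iff hb hb_pos hΦl hr).1 hrl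
    have h2 := D.reebFlowsTo_rot hb hb_pos z (D.lieK.neg_mem hl)
    rw [map_neg] at h2
    rw [Function.comp_apply, ← hrφ, negV_proj]
    convert h2 using 1
    refine proj_congr _ _ ?_
    change -((1 : ℝ) • Φ 1 (z : Cn n)) = _
    rw [one_smul, hΦz, neg_neg]
  · intro c hc hcq
    obtain ⟨e, he, heφ, ρ, hρ, he0, hα⟩ := exists_image_curve hb hb_pos hφ hH hΦ hN₁ hG hc
    refine ⟨e, he, heφ, ?_⟩
    obtain ⟨g, hg, hg'⟩ := D.proj_eq_iff.1 hcq.symm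
    -- The test curve may start at another representative of `q`; equivariance under `𝕂₀` keeps its
    -- image on the level.
    have h2 : Φ 1 (c 0 : Cn n) ∈ D.level := by
      rw [hg', hΦ.map_rot hC h1 hg]; exact D.rot_mem_level hΦl _
    have h3 : ρ • Φ 1 (c 0 : Cn n) ∈ D.level := by
      have := D.neg_mem_level (e 0).2
      rwa [he0, neg_neg] at this
    rw [hα, (D.smul_mem_level_iff hb hb_pos h2 hρ).1 h3, one_pow, one_mul]

/-- A translated point gives a closed trajectory. -/
theorem IsTranslatedPoint.exists_rot_flow (hD : D.IsRational) (hb : b ∈ D.lieK)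
    (hb_pos : ∀ k, 0 < b k)
    (hφ : D.IsContactIsotopy h φ) (hH : D.IsHamiltonianLift b h H)
    (hΦ : IsHamiltonianIsotopy H Φ) (hN₁ : 0 < N₁)
    (hG : ∀ j < 2 * N₁, IsGeneratingFunction (pieceOf Φ N₁ j) (G j) ∧ G j 0 = 0)
    {z : D.level} {s : ℝ} (hq : D.IsTranslatedPoint (D.negV ∘ φ 1) (D.proj z) s) :
    ∃ l ∈ D.lieK, D.p l = -s ∧ Cn.rot l (Φ 1 (z : Cn n)) = -z := by
  obtain ⟨hflow, hform⟩ := hq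
  have hpb := D.p_pos hb_pos
  -- Rotation along `b` is a test curve on which `α` takes the nonzero value `p(b)`, so preservation
  -- of `α` along it forces `ρ² = 1`.
  let c : ℝ → D.level := fun u => ⟨Cn.rot (u • b) z, D.rot_mem_level z.2 _⟩
  have hc0 : (c 0 : Cn n) = z := by simp [c, Cn.rot_zero]
  have hc : ContDiff ℝ ∞ fun u => (c u : Cn n) := by
    rw [contDiff_pi]
    intro k
    simp only [c, Cn.rot]
    refine ContDiff.mul (ContDiff.cexp (contDiff_const.mul ?_)) contDiff_const
    exact Complex.ofRealCLM.contDiff.comp (contDiff_id.mul contDiff_const)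
  have hcd : deriv (fun u => (c u : Cn n)) 0 = Cn.inf b z := by
    have h1 : HasDerivAt (fun u : ℝ => u • b) b 0 := by
      simpa using (hasDerivAt_id (0 : ℝ)).smul_const b
    have := Cn.hasDerivWithinAt_rot (s := Set.univ) h1.hasDerivWithinAt
      (hasDerivWithinAt_const 0 _ (z : Cn n))
    rw [hasDerivWithinAt_univ, zero_smul, Cn.rot_zero, zero_add] at this
    exact this.deriv
  have hcq : D.proj (c 0) = D.proj z := congrArg D.proj (Subtype.ext hc0)
  obtain ⟨e, he, heφ, ρ, hρ, he0, hα⟩ := exists_image_curve hb hb_pos hφ hH hΦ hN₁ hG hc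
  obtain ⟨c', hc', hc'φ, hα'⟩ := hform c hc hcq
  -- `c'` and `e` are two lifts of the same image curve in `V`. The former carries the hypothesis on
  -- `α`, the latter the computed factor `ρ²`.
  have h1 := alpha_eq_of_proj_eq hD (hc'.differentiable (by simp) 0).hasDerivAt
    (he.differentiable (by simp) 0).hasDerivAt fun u => (hc'φ u).trans (heφ u).symm
  rw [hα', hα, hcd, hc0, D.moment_eq_p z.2 hb] at h1
  have hρ1 : ρ = 1 := by
    have h2 : (ρ ^ 2 - 1) * D.p b = 0 := by linarith
    have h3 := (mul_eq_zero.1 h2).resolve_right hpb.ne'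
    nlinarith
  rw [hρ1, one_smul, hc0] at he0
  obtain ⟨m, hm, hms, hmq⟩ := hflow.exists_rot rfl
  have h4 : D.proj ⟨Cn.rot m z, D.rot_mem_level z.2 m⟩ = D.proj (e 0) := by
    rw [hmq, heφ, hcq]; rfl
  obtain ⟨g, hg, hg'⟩ := D.proj_eq_iff.1 h4
  rw [he0] at hg'
  change -Φ 1 (z : Cn n) = Cn.rot g (Cn.rot m z) at hg'
  obtain ⟨hgK, hgp⟩ := D.mem_lieK₀_iff.1 hg
  refine ⟨-(g + m), D.lieK.neg_mem (D.lieK.add_mem hgK hm), ?_, ?_⟩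
  · rw [map_neg, map_add, hgp, hms, zero_add]
  · rw [← Cn.rot_add] at hg'
    rw [← neg_neg (Φ 1 (z : Cn n)), hg', Cn.rot_neg_vec, Cn.rot_neg_rot]

end DelzantPolytope

end

theorem proposition3p3p1 {d n : ℕ} (D : DelzantPolytope d n) (hD : D.IsRational)
    (b : Fin n → ℝ) (hb : b ∈ D.lieK) (hb_pos : ∀ k, 0 < b k)
    (h : ℝ → D.V → ℝ) (φ : ℝ → D.V → D.V) (hφ : D.IsContactIsotopy h φ)
    (H : ℝ → Cn n → ℝ) (hH : D.IsHamiltonianLift b h H)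
    (Φ : ℝ → Equiv.Perm (Cn n)) (hΦ : IsHamiltonianIsotopy H Φ)
    (N₁ : ℕ) (hN₁ : 0 < N₁) (G : ℕ → Cn n → ℝ)
    (hG : ∀ j < 2 * N₁, IsGeneratingFunction (pieceOf Φ N₁ j) (G j) ∧ G j 0 = 0) :
    (∀ (N₂ : ℕ) (Λ : Set (Fin n → ℝ)), Λ ⊆ D.window N₂ →
      D.ZeroIsRegularValue G N₁ N₂ Λ ∧
      (∀ x l x', D.IsCriticalPoint G N₁ N₂ Λ (x, l) → D.SameOrbit x x' →
        D.IsCriticalPoint G N₁ N₂ Λ (x', l)) ∧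
      (∀ x l, D.IsCriticalPoint G N₁ N₂ Λ (x, l) →
        ∃ q, D.CorrespondsTo x q ∧ (∀ q', D.CorrespondsTo x q' → q' = q) ∧
          D.IsTranslatedPoint (D.negV ∘ φ 1) q (-(D.p l))) ∧
      (∀ x x' l q, D.IsCriticalPoint G N₁ N₂ Λ (x, l) → D.IsCriticalPoint G N₁ N₂ Λ (x', l) →
        D.CorrespondsTo x q → (D.CorrespondsTo x' q ↔ D.SameOrbit x x'))) ∧
    (∀ q s, D.IsTranslatedPoint (D.negV ∘ φ 1) q s →
      ∃ l ∈ D.lieK, D.p l = -s ∧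
        ∀ (N₂ : ℕ) (Λ : Set (Fin n → ℝ)), Λ ⊆ D.window N₂ → ∀ l' ∈ Λ,
          (l' - l ∈ D.latticeK ↔
            ∃ x, D.IsCriticalPoint G N₁ N₂ Λ (x, l') ∧ D.CorrespondsTo x q)) := by
  have hC := hH.isConic hb_pos
  have hlift {x y : Cn n} {l : Fin n → ℝ} {r : ℝ} (hy : Cn.rot l (Φ 1 x) = -x) (hr : 0 < r)
      (hxy : y = r • x) : Cn.rot l (Φ 1 y) = -y := by
    rw [hxy, hΦ.map_smul hC ⟨zero_le_one, le_rfl⟩ hr, Cn.rot_smul, hy, smul_neg]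
  have hliftRot {x y : Cn n} {l m : Fin n → ℝ} (hy : Cn.rot l (Φ 1 x) = -x) (hm : m ∈ D.lieK₀)
      (hxy : y = Cn.rot m x) : Cn.rot l (Φ 1 y) = -y := by
    rw [hxy, hΦ.map_rot hC ⟨zero_le_one, le_rfl⟩ hm, Cn.rot_comm, hy, Cn.rot_neg_vec]
  have hcrit {N₂ : ℕ} {Λ : Set (Fin n → ℝ)} (hΛ : Λ ⊆ D.window N₂) {x l} :=
    isCriticalPoint_iff (x := x) (l := l) hΦ hC hN₁ hG hb hb_pos hΛ
  refine ⟨fun N₂ Λ hΛ => ⟨zeroIsRegularValue hΦ hC hN₁ hG hb hb_pos hΛ, ?_, ?_, ?_⟩, ?_⟩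
  · rintro x l x' hx ⟨m, hm, hxx'⟩
    rw [hcrit hΛ] at hx ⊢
    obtain ⟨hxS, hlΛ, hT, r, hr, hrl⟩ := hx
    have hN₂ := D.pos_of_mem_window (hΛ hlΛ)
    refine ⟨?_, hlΛ, ?_, r, hr, ?_⟩
    · simp only [unitSphere, Set.mem_ofPred_eq, hxx', Cn.dot_rot]; exact hxS
    · have h1 : x' = orbitMidpoints Φ N₁ N₂ l (Cn.rot m (initialPoint x)) := by
        funext j
        rw [orbitMidpoints_rot hΦ hC hN₁ hm, ← hT.eq_orbitMidpoints, hxx']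
      rw [h1]
      exact isTrajectory_orbitMidpoints hΦ hN₁ hN₂ (hliftRot (hT.rot_flow hΦ hN₁ hN₂) hm rfl)
    · rw [initialPoint_rot hxx', ← Cn.rot_smul]
      exact D.rot_mem_level hrl m
  · intro x l hx
    rw [hcrit hΛ] at hx
    obtain ⟨hxS, hlΛ, hT, r, hr, hrl⟩ := hx
    have hN₂ := D.pos_of_mem_window (hΛ hlΛ)
    refine ⟨D.proj ⟨r • initialPoint x, hrl⟩, ⟨r, hr, _, rfl, rfl⟩, ?_, ?_⟩
    · rintro q' ⟨r', hr', z', hz', rfl⟩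
      have h1 : (r' / r) • (r • initialPoint x) = r' • initialPoint x := by
        rw [smul_smul, div_mul_cancel₀ _ hr.ne']
      have h2 := (D.smul_mem_level_iff hb hb_pos hrl (div_pos hr' hr)).1 (by
        rw [h1, ← hz']; exact z'.2)
      rw [h2, one_smul] at h1
      exact congrArg D.proj (Subtype.ext (hz'.trans h1.symm))
    · exact DelzantPolytope.isTranslatedPoint_of_rot_flow hb hb_pos hφ hH hΦ hN₁ hG (hΛ hlΛ).1 _
        (hlift (hT.rot_flow hΦ hN₁ hN₂) hr rfl)
  · rintro x x' l q hx hx' ⟨r, hr, z, hz, rfl⟩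
    rw [hcrit hΛ] at hx hx'
    obtain ⟨hxS, hlΛ, hT, -⟩ := hx
    obtain ⟨hxS', -, hT', -⟩ := hx'
    constructor
    · rintro ⟨r', hr', z', hz', hzz'⟩
      obtain ⟨m, hm, hm'⟩ := D.proj_eq_iff.1 hzz'.symm
      have h1 : initialPoint x' = (r'⁻¹ * r) • Cn.rot m (initialPoint x) := by
        rw [← smul_smul, ← Cn.rot_smul, ← hz, ← hm', hz', smul_smul, inv_mul_cancel₀ hr'.ne',
          one_smul]
      have hρ : 0 < r'⁻¹ * r := by positivity
      have h2 (j) : x' j = (r'⁻¹ * r) • Cn.rot m (x j) := by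
        rw [hT'.eq_orbitMidpoints, h1, orbitMidpoints_smul hΦ hC hN₁ hρ,
          orbitMidpoints_rot hΦ hC hN₁ hm, ← hT.eq_orbitMidpoints]
      -- Equal `q` only gives `x'` as a positive multiple of a rotated `x`; both lie on the unit
      -- sphere, so the multiple is `1`.
      have h3 : (r'⁻¹ * r) * ((r'⁻¹ * r) * 1) = 1 := by
        have h4 : ∑ j, Cn.dot (x' j) (x' j) = 1 := hxS'
        simp only [h2, Cn.dot_smul_left, Cn.dot_smul_right, Cn.dot_rot, ← Finset.mul_sum] at h4
        rwa [show ∑ j, Cn.dot (x j) (x j) = 1 from hxS] at h4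
      have h4 : r'⁻¹ * r = 1 := by nlinarith
      exact ⟨m, hm, fun j => by rw [h2, h4, one_smul]⟩
    · rintro ⟨m, hm, hxx'⟩
      refine ⟨r, hr, ⟨Cn.rot m z, D.rot_mem_level z.2 m⟩, ?_, ?_⟩
      · change Cn.rot m (z : Cn n) = _
        rw [initialPoint_rot hxx', hz, Cn.rot_smul]
      · exact (D.proj_eq_iff.2 ⟨m, hm, rfl⟩).symm
  · intro q s hq
    obtain ⟨z, rfl⟩ := DelzantPolytope.exists_level_rep q
    obtain ⟨l, hl, hls, hlz⟩ := hq.exists_rot_flow hD hb hb_pos hφ hH hΦ hN₁ hG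
    refine ⟨l, hl, hls, fun N₂ Λ hΛ l' hl' => ?_⟩
    have hN₂ := D.pos_of_mem_window (hΛ hl')
    have hz0 := D.ne_zero_of_mem_level hb hb_pos z.2
    constructor
    · intro hll'
      have hl'z : Cn.rot l' (Φ 1 (z : Cn n)) = -z := by
        rw [← hlz]; exact Cn.rot_eq_of_int hll'.2 _
      set x₀ := orbitMidpoints Φ N₁ N₂ l' (z : Cn n) with hx₀
      have hx₀z : initialPoint x₀ = z := initialPoint_orbitMidpoints hΦ hN₁ hN₂ hl'z
      have hS : 0 < ∑ j, Cn.dot (x₀ j) (x₀ j) := by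
        have hne : ∃ j, x₀ j ≠ 0 := by
          by_contra! hcon
          apply hz0
          rw [← hx₀z, initialPoint]
          exact Finset.sum_eq_zero fun k _ => by rw [hcon, smul_zero]
        obtain ⟨j, hj⟩ := hne
        exact Finset.sum_pos' (fun j _ => Cn.dot_self_nonneg _)
          ⟨j, Finset.mem_univ j, Cn.dot_self_pos hj⟩
      -- The midpoints of the trajectory from `z` need not have unit norm. Homogeneity allows `z` to
      -- be scaled beforehand, without moving its ray.
      set r := (Real.sqrt (∑ j, Cn.dot (x₀ j) (x₀ j)))⁻¹ with hr
      have hr0 : 0 < r := inv_pos.2 (Real.sqrt_pos.2 hS)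
      have hrz := hlift hl'z hr0 rfl
      have hinit : initialPoint (orbitMidpoints Φ N₁ N₂ l' (r • (z : Cn n))) = r • (z : Cn n) :=
        initialPoint_orbitMidpoints hΦ hN₁ hN₂ hrz
      have hback : r⁻¹ • initialPoint (orbitMidpoints Φ N₁ N₂ l' (r • (z : Cn n))) = z := by
        rw [hinit, smul_smul, inv_mul_cancel₀ hr0.ne', one_smul]
      refine ⟨orbitMidpoints Φ N₁ N₂ l' (r • (z : Cn n)), (hcrit hΛ).2 ⟨?_, hl',
        isTrajectory_orbitMidpoints hΦ hN₁ hN₂ hrz, r⁻¹, inv_pos.2 hr0, ?_⟩,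
        r⁻¹, inv_pos.2 hr0, z, hback.symm, rfl⟩
      · simp only [unitSphere, Set.mem_ofPred_eq, orbitMidpoints_smul hΦ hC hN₁ hr0,
          Cn.dot_smul_left, Cn.dot_smul_right, ← Finset.mul_sum]
        rw [← mul_assoc, hr, ← mul_inv, Real.mul_self_sqrt hS.le]
        exact inv_mul_cancel₀ hS.ne'
      · rw [hback]; exact z.2
    · rintro ⟨x, hx, r, hr, z', hz', hzz'⟩
      rw [hcrit hΛ] at hx
      obtain ⟨-, -, hT, -⟩ := hx
      obtain ⟨m, hm, hm'⟩ := D.proj_eq_iff.1 hzz'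
      have h1 := hliftRot (hlift (hT.rot_flow hΦ hN₁ hN₂) hr hz') hm hm'
      -- Both `l` and `l'` rotate `Φ¹(z)` to `-z`, so freeness of the action is applied at `Φ¹(z)`,
      -- which lies on the level as a rotation of `-z`.
      have h2 : Φ 1 (z : Cn n) ∈ D.level := by
        rw [← Cn.rot_neg_rot l (Φ 1 (z : Cn n)), hlz]
        exact D.rot_mem_level (D.neg_mem_level z.2) _
      exact D.sub_mem_latticeK_of_rot_eq h2 (hΛ hl').1 hl (h1.trans hlz.symm)
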